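/- Let $T$ be an irreducible conservative generator of a continuous-time Markov chain $\varphi$ on a finite set $\mathcal S$, with stationary distribution $\xi$, and let $c_i\in\mathbb R$ $(i\in\mathcal S)$ be rates. Put $\mathcal S_1=\{c_i>0\}$, $\mathcal S_2=\{c_i<0\}$, $\mathcal S_0=\{c_i=0\}$, and let $T_{kl}$ be the corresponding blocks of $T$. Assume $\mathcal S_1\neq\varnothing$ and $\sum_i c_i\xi_i<0$. Let $X(t)\ge 0$ be the fluid level driven by $\varphi$: when $\varphi(t)=i$, the level changes at rate $c_i$ if $X(t)>0$ and at rate $\max\{0,c_i\}$ if $X(t)=0$. Let $\theta=\inf\{t>0: X(t)=0\}$, and for real $s$, $i\in\mathcal S_1$, $j\in\mathcal S_2$ let $$[\Psi(s)]_{ij}=E\big(e^{-s\theta}\mathbf 1\{\theta<\infty,\ \varphi(\theta)=j\}\ \big|\ \varphi(0)=i,\ X(0)=0\big)\in[0,\infty];$$ write $\Psi(s)<\infty$ if all entries are finite and $\Psi(s)=\infty$ otherwise. Let $C_1=\mathrm{diag}(c_i)_{i\in\mathcal S_1}$, $C_2=\mathrm{diag}(|c_i|)_{i\in\mathcal S_2}$,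 $$Q_{11}(s)=C_1^{-1}\big(T_{11}-sI-T_{10}(T_{00}-sI)^{-1}T_{01}\big),\qquad Q_{22}(s)=C_2^{-1}\big(T_{22}-sI-T_{20}(T_{00}-sI)^{-1}T_{02}\big),$$ $$Q_{21}(s)=C_2^{-1}\big(T_{21}-T_{20}(T_{00}-sI)^{-1}T_{01}\big),$$ where these are said to exist if $\mathcal S_0=\varnothing$ or $\int_0^\infty e^{-st}e^{T_{00}t}\,dt$ converges, and let $$K(s)=Q_{11}(s)+\Psi(s)Q_{21}(s),\qquad D(s)=Q_{22}(s)+Q_{21}(s)\Psi(s).$$ Write $\mathrm{sp}(A)$ for the set of complex eigenvalues of $A$. Then the maximum $$s^*=\max\{s\le 0:\ \Psi(s)<\infty,\ \Psi(z)=\infty\text{ for all }z<s\}$$ exists, $\Psi(s)<\infty$ and $Q_{11}(s),Q_{22}(s),Q_{21}(s)$ exist for all $s\ge s^*$, the maximum $$\delta^*=\max\{s\in[s^*,0):\ \mathrm{sp}(K(s))\cap\mathrm{sp}(-D(s))\neq\varnothing\}$$ exists, and $s^*=\delta^*$. -/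

import Mathlib

open MeasureTheory ProbabilityTheory

noncomputable section

/-- The data of a stochastic fluid model on a finite set `S` of phases: a conservative generator
`T` of the phase process and the rates `c i` at which the level changes in phase `i`. -/
structure FluidModel (S : Type*) [Fintype S] where
  /-- the generator of the phase process -/
  T : Matrix S S ℝ
  /-- the fluid rates -/
  c : S → ℝ
  offDiag_nonneg : ∀ i j, i ≠ j → 0 ≤ T i j
  row_sum : ∀ i, ∑ j, T i j = 0

namespace FluidModel

section Generator

variable {S : Type*} [Fintype S] (M : FluidModel S)

/-- The phase process is irreducible: every phase leads to every phase through transitions of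
positive rate (a diagonal entry of `T` is never positive). -/
def Irreducible : Prop :=
  ∀ i j : S, Relation.ReflTransGen (fun a b => 0 < M.T a b) i j

/-- `ξ` is a stationary distribution of the phase process. -/
def IsStationary (ξ : S → ℝ) : Prop :=
  (∀ i, 0 ≤ ξ i) ∧ ∑ i, ξ i = 1 ∧ ∀ j, ∑ i, ξ i * M.T i j = 0

lemma diag_nonpos (i : S) : M.T i i ≤ 0 := by
  classical
  have h := M.row_sum i
  rw [← Finset.add_sum_erase _ _ (Finset.mem_univ i)] at h
  have h2 : 0 ≤ ∑ j ∈ Finset.univ.erase i, M.T i j :=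
    Finset.sum_nonneg fun j hj => M.offDiag_nonneg i j (Finset.ne_of_mem_erase hj).symm
  linarith

open Classical in
/-- The parameter of the exponential holding time in phase `i`, namely `-T i i`. An absorbing
phase (`T i i = 0`) is represented by fictitious jumps from the phase to itself at rate `1`. -/
def holdRate (i : S) : ℝ := if M.T i i = 0 then 1 else -M.T i i

open Classical in
/-- The transition probabilities of the jump chain: `T i j / (-T i i)` for `j ≠ i`; an absorbing
phase jumps to itself. -/
def jumpProb (i j : S) : ℝ :=
  if M.T i i = 0 then (if i = j then 1 else 0)
  else if i = j then 0 else M.T i j / (-M.T i i)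

lemma holdRate_pos (i : S) : 0 < M.holdRate i := by
  unfold holdRate
  split_ifs with h
  · exact one_pos
  · exact neg_pos.2 (lt_of_le_of_ne (M.diag_nonpos i) h)

lemma jumpProb_nonneg (i j : S) : 0 ≤ M.jumpProb i j := by
  unfold jumpProb
  split_ifs with h h1 h2
  · exact zero_le_one
  · exact le_rfl
  · exact le_rfl
  · exact div_nonneg (M.offDiag_nonneg i j h2) (neg_nonneg.2 (M.diag_nonpos i))

lemma sum_jumpProb (i : S) : ∑ j, M.jumpProb i j = 1 := by
  classical
  by_cases h : M.T i i = 0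
  · simp [jumpProb, h]
  · have h1 := M.row_sum i
    rw [← Finset.add_sum_erase _ _ (Finset.mem_univ i)] at h1 ⊢
    have h2 : ∑ j ∈ Finset.univ.erase i, M.jumpProb i j
        = ∑ j ∈ Finset.univ.erase i, M.T i j / (-M.T i i) := by
      refine Finset.sum_congr rfl fun j hj => ?_
      simp [jumpProb, h, (Finset.ne_of_mem_erase hj).symm]
    rw [h2, ← Finset.sum_div, eq_neg_of_add_eq_zero_right h1, div_self (neg_ne_zero.2 h)]
    simp [jumpProb, h]

end Generator

section PhaseProcess

variable {S : Type*} [Fintype S] [MeasurableSpace S] [MeasurableSingletonClass S]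
  (M : FluidModel S)

/-- The law of the next phase of the jump chain after phase `i`. -/
def jumpLaw (i : S) : Measure S := ∑ j, ENNReal.ofReal (M.jumpProb i j) • Measure.dirac j

/-- The law of (phase, holding time) of a sojourn in phase `i`. -/
def sojournLaw (i : S) : Measure (S × ℝ) := (Measure.dirac i).prod (expMeasure (M.holdRate i))

instance (i : S) : IsProbabilityMeasure (M.jumpLaw i) := by
  refine ⟨?_⟩
  simp only [jumpLaw, Measure.coe_finsetSum, Finset.sum_apply, Measure.smul_apply,
    measure_univ, smul_eq_mul, mul_one]
  rw [← ENNReal.ofReal_sum_of_nonneg fun j _ => M.jumpProb_nonneg i j, M.sum_jumpProb i,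
    ENNReal.ofReal_one]

instance (i : S) : IsProbabilityMeasure (M.sojournLaw i) := by
  have := isProbabilityMeasure_expMeasure (M.holdRate_pos i)
  unfold sojournLaw
  infer_instance

/-- The law of the next phase, as a kernel. -/
def jumpKernel : Kernel S S := Kernel.ofFunOfCountable M.jumpLaw

/-- The law of a sojourn, as a kernel. -/
def sojournKernel : Kernel S (S × ℝ) := Kernel.ofFunOfCountable M.sojournLaw

instance : IsMarkovKernel M.jumpKernel :=
  ⟨fun i => inferInstanceAs (IsProbabilityMeasure (M.jumpLaw i))⟩

instance : IsMarkovKernel M.sojournKernel :=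
  ⟨fun i => inferInstanceAs (IsProbabilityMeasure (M.sojournLaw i))⟩

/-- From a sojourn in phase `i`, go to a sojourn in a phase drawn from `jumpLaw i`, with an
exponential holding time that depends on the past only through the new phase. -/
def stepKernel : Kernel (S × ℝ) (S × ℝ) :=
  (M.sojournKernel ∘ₖ M.jumpKernel).comap Prod.fst measurable_fst

instance : IsMarkovKernel M.stepKernel := by
  unfold stepKernel
  infer_instance

/-- The kernel from the first `n + 1` sojourns to the next one. -/
def pathKernel (n : ℕ) : Kernel (Finset.Iic n → S × ℝ) (S × ℝ) :=
  M.stepKernel.comap (fun x => x ⟨n, Finset.mem_Iic.2 le_rfl⟩) (measurable_pi_apply _)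

instance (n : ℕ) : IsMarkovKernel (M.pathKernel n) := by
  unfold pathKernel
  infer_instance

/-- The law `P(· | φ(0) = i)` of the phase process, the continuous-time Markov chain with
generator `T` started in `i`, given as the law of the sequence
(phase of the `n`-th sojourn, length of the `n`-th sojourn). -/
def pathLaw (i : S) : Measure (ℕ → S × ℝ) :=
  Kernel.trajMeasure (X := fun _ => S × ℝ) (M.sojournLaw i) M.pathKernel

/-- The epoch at which the `n`-th sojourn begins. -/
def epoch (ω : ℕ → S × ℝ) (n : ℕ) : ℝ := ∑ k ∈ Finset.range n, (ω k).2

/-- The index of the sojourn in progress at time `t`. -/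
def sojournAt (ω : ℕ → S × ℝ) (t : ℝ) : ℕ := sInf {n | t < epoch ω (n + 1)}

/-- The phase `φ(t)`. -/
def phase (ω : ℕ → S × ℝ) (t : ℝ) : S := (ω (sojournAt ω t)).1

/-- The level `X` at the beginning of the `n`-th sojourn when `X(0) = x`. During a sojourn in phase
`i` the level changes at rate `c i` while it is positive and at rate `max 0 (c i)` while it is `0`,
so that after a time `u` it has moved from `y ≥ 0` to `max 0 (y + c i * u)`. -/
def levelAtEpoch (x : ℝ) (ω : ℕ → S × ℝ) : ℕ → ℝ
  | 0 => x
  | n + 1 => max 0 (levelAtEpoch x ω n + M.c (ω n).1 * (ω n).2)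

/-- The level `X(t)` when `X(0) = x`. -/
def level (x : ℝ) (ω : ℕ → S × ℝ) (t : ℝ) : ℝ :=
  max 0 (M.levelAtEpoch x ω (sojournAt ω t)
    + M.c (phase ω t) * (t - epoch ω (sojournAt ω t)))

/-- The event `θ(0) < ∞`, for the process with `X(0) = x`. -/
def HitsZero (x : ℝ) (ω : ℕ → S × ℝ) : Prop := ∃ t, 0 < t ∧ M.level x ω t = 0

/-- `θ(0) = inf {t > 0 : X(t) = 0}`, for the process with `X(0) = x`; it is used only where this
set is nonempty. -/
def theta (x : ℝ) (ω : ℕ → S × ℝ) : ℝ := sInf {t | 0 < t ∧ M.level x ω t = 0}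

/-- The phases in which the level increases. -/
abbrev Up : Type _ := {i : S // 0 < M.c i}

/-- The phases in which the level decreases. -/
abbrev Down : Type _ := {i : S // M.c i < 0}

/-- The phases in which the level is constant. -/
abbrev Flat : Type _ := {i : S // M.c i = 0}

open Classical in
/-- `[Ψ(s)] i j = E(e^{-s θ(0)} 1{θ(0) < ∞, φ(θ(0)) = j} | φ(0) = i, X(0) = 0)`, which may be
infinite. -/
def Psi (s : ℝ) (i : M.Up) (j : M.Down) : ENNReal :=
  ∫⁻ ω, (if M.HitsZero 0 ω ∧ phase ω (M.theta 0 ω) = j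
    then ENNReal.ofReal (Real.exp (-s * M.theta 0 ω)) else 0) ∂(M.pathLaw i)

/-- `Ψ(s) < ∞`. -/
def PsiFinite (s : ℝ) : Prop := ∀ i j, M.Psi s i j < ⊤

/-- `Ψ(s)` as a real matrix, for `s` with `Ψ(s) < ∞`. -/
def PsiMatrix (s : ℝ) : Matrix M.Up M.Down ℝ := Matrix.of fun i j => (M.Psi s i j).toReal

/-- The real `s ≤ 0` with `Ψ(s) < ∞` and `Ψ(z) = ∞` for all `z < s`. -/
def abscissaSet : Set ℝ := {s | s ≤ 0 ∧ M.PsiFinite s ∧ ∀ z < s, ¬ M.PsiFinite z}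

end PhaseProcess

section Blocks

variable {S : Type*} [Fintype S] [DecidableEq S] (M : FluidModel S)

/-- The diagonal matrix of the rates of the increasing phases. -/
def C1 : Matrix M.Up M.Up ℝ := Matrix.diagonal fun i => M.c i

/-- The diagonal matrix of the absolute rates of the decreasing phases. -/
def C2 : Matrix M.Down M.Down ℝ := Matrix.diagonal fun i => |M.c i|

/-- `T₁₁` -/
def T11 : Matrix M.Up M.Up ℝ := M.T.submatrix Subtype.val Subtype.val
/-- `T₁₂` -/
def T12 : Matrix M.Up M.Down ℝ := M.T.submatrix Subtype.val Subtype.val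
/-- `T₁₀` -/
def T10 : Matrix M.Up M.Flat ℝ := M.T.submatrix Subtype.val Subtype.val
/-- `T₂₁` -/
def T21 : Matrix M.Down M.Up ℝ := M.T.submatrix Subtype.val Subtype.val
/-- `T₂₂` -/
def T22 : Matrix M.Down M.Down ℝ := M.T.submatrix Subtype.val Subtype.val
/-- `T₂₀` -/
def T20 : Matrix M.Down M.Flat ℝ := M.T.submatrix Subtype.val Subtype.val
/-- `T₀₁` -/
def T01 : Matrix M.Flat M.Up ℝ := M.T.submatrix Subtype.val Subtype.val
/-- `T₀₂` -/
def T02 : Matrix M.Flat M.Down ℝ := M.T.submatrix Subtype.val Subtype.val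
/-- `T₀₀` -/
def T00 : Matrix M.Flat M.Flat ℝ := M.T.submatrix Subtype.val Subtype.val

/-- `Q(s)` exists: the integral of `e^{-st} e^{T₀₀ t}` over `t > 0` converges, or there is no phase
of rate `0`. -/
def QExists (s : ℝ) : Prop :=
  ∀ i j : M.Flat, IntegrableOn
    (fun t : ℝ => Real.exp (-s * t) * (NormedSpace.exp (t • M.T00)) i j) (Set.Ioi 0)

/-- `Q₁₁(s)` -/
def Q11 (s : ℝ) : Matrix M.Up M.Up ℝ :=
  M.C1⁻¹ * (M.T11 - s • 1 - M.T10 * (M.T00 - s • 1)⁻¹ * M.T01)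

/-- `Q₂₁(s)` -/
def Q21 (s : ℝ) : Matrix M.Down M.Up ℝ :=
  M.C2⁻¹ * (M.T21 - M.T20 * (M.T00 - s • 1)⁻¹ * M.T01)

/-- `Q₂₂(s)` -/
def Q22 (s : ℝ) : Matrix M.Down M.Down ℝ :=
  M.C2⁻¹ * (M.T22 - s • 1 - M.T20 * (M.T00 - s • 1)⁻¹ * M.T02)

variable [MeasurableSpace S] [MeasurableSingletonClass S]

/-- `K(s) = Q₁₁(s) + Ψ(s) Q₂₁(s)` -/
def K (s : ℝ) : Matrix M.Up M.Up ℝ := M.Q11 s + M.PsiMatrix s * M.Q21 s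

/-- `D(s) = Q₂₂(s) + Q₂₁(s) Ψ(s)` -/
def D (s : ℝ) : Matrix M.Down M.Down ℝ := M.Q22 s + M.Q21 s * M.PsiMatrix s

/-- `K(s)` and `-D(s)` have a common (complex) eigenvalue. -/
def CommonEigenvalue (s : ℝ) : Prop :=
  (spectrum ℂ ((M.K s).map Complex.ofReal) ∩
    spectrum ℂ ((-M.D s).map Complex.ofReal)).Nonempty

/-- The `s` in `[a, 0)` at which `K(s)` and `-D(s)` have a common eigenvalue. -/
def coincidenceSet (a : ℝ) : Set ℝ := {s | s ∈ Set.Ico a 0 ∧ M.CommonEigenvalue s}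

end Blocks

end FluidModel

end

/-!
Fix a decreasing phase `j`. The transform `E_{y,i}(e^{-sθ} 1{θ < ∞, φ(θ) = j})` of the passage time
from level `y` to level zero is the least fixed point `passage` of the operator that conditions on
the first jump of the phase (`stepOp`). It is constructed by iteration with values in `[0, ∞]`, so
it makes sense for every real `s`, and `Psi_eq_passage` identifies its value at level zero with
`Ψ(s)`. Minimality gives the two facts on which everything rests: the transform is multiplicative
over levels (`passage_add`), since the level descends to zero through every intermediate level, and
it lies below every supersolution of the passage problem (`passage_le_of_supersolution`).

Where the transform is finite, multiplicativity and the flow identity `passage_flow` can be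
differentiated at level zero, so that its values `hitMatrix` at level zero satisfy a Riccati
equation (`riccati_hitMatrix`). Conversely a nonnegative supersolution `X` of the Riccati equation
yields the supersolution `X e^{Dy}` of the passage problem, so it forces finiteness
(`allFinite_of_riccati_nonpos`). The domain of finiteness is controlled as follows:

* the quadratic term of the Riccati equation bounds the transform, so the set of `s` with finite
  transform is bounded below and contains its infimum `s*` (`bddBelow_allFinite`,
  `allFinite_of_tendsto`);
* negative drift gives an exponential supersolution at some negative `s`, from a solution of the
  Poisson equation for the rates, so `s* < 0` (`exists_allFinite_neg`);
* where the transform is finite, its flat rows provide a positive vector on which `T₀₀ - s` is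
  negative, so the integral that defines `Q(s)` converges (`exists_flat_pos`,
  `QExists_of_flat_pos`).

The linearization of the Riccati equation at the transform is, after elimination of the flat phases,
the Sylvester operator `H ↦ K(s) H + H D(s)` up to positive factors. So `K(s)` and `-D(s)` have a
common eigenvalue exactly when it is singular (`commonEigenvalue_iff`). This operator has
nonnegative off-diagonal coefficients, hence it is nonsingular with a nonpositive inverse as soon as
it is negative on some nonnegative direction (`nonneg_of_quasiPositive`). For `s > s*` such a
direction is the difference of the transforms at `s*` and at `s`, because the Riccati equation is
convex (`exists_riccatiOp_neg`), so there is no common eigenvalue in `(s*, 0)`. If the operator were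
nonsingular at `s*`, its inverse would be nonpositive there as well, as a limit from the right. Then
the transform at `s*` could be perturbed to a strict supersolution of the Riccati equation, which
survives a slight decrease of `s`, against the choice of `s*` (`exists_allFinite_lt`).
-/

noncomputable section

namespace FluidModel

open Set
open scoped ENNReal

/-! ### The first-jump operator and the passage transform -/

section Passage

variable {S : Type*} [Fintype S] (M : FluidModel S)

/-- The durations after which the level, started from `y` and moving at rate `c i`, has not gone
below zero. -/
def window (i : S) (y : ℝ) : Set ℝ := {τ | 0 < τ ∧ 0 ≤ y + M.c i * τ}

lemma measurableSet_window {M : FluidModel S} (i : S) (y : ℝ) : MeasurableSet (M.window i y) := by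
  have h : Measurable fun τ : ℝ => y + M.c i * τ := by fun_prop
  exact (measurableSet_lt measurable_const measurable_id).inter
    (measurableSet_le measurable_const h)

lemma window_of_nonneg {M : FluidModel S} {i : S} (hi : 0 ≤ M.c i) {y : ℝ} (hy : 0 ≤ y) :
    M.window i y = Ioi 0 := by
  ext τ
  simp only [window, mem_ofPred_eq, mem_Ioi, and_iff_left_iff_imp]
  intro h
  positivity

lemma window_of_neg {M : FluidModel S} {i : S} (hi : M.c i < 0) (y : ℝ) :
    M.window i y = Ioc 0 (y / |M.c i|) := by
  ext τ
  simp only [window, mem_ofPred_eq, mem_Ioc, abs_of_neg hi]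
  rw [le_div_iff₀ (neg_pos.2 hi)]
  refine and_congr_right fun _ => ⟨fun h => by linarith, fun h => by linarith⟩

variable [DecidableEq S]

/-- The rate of jumps from phase `i` to a different phase `k`. -/
def offRate (i k : S) : ℝ≥0∞ := if i = k then 0 else ENNReal.ofReal (M.T i k)

/-- The discounted intensity with which the phase leaves `i` after a time `τ`, weighted by the
value `g` of the level and the phase reached by the jump. -/
def jumpDensity (s : ℝ) (g : ℝ → S → ℝ≥0∞) (i : S) (y τ : ℝ) : ℝ≥0∞ :=
  ENNReal.ofReal (Real.exp (-((s - M.T i i) * τ))) *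
    ∑ k, M.offRate i k * g (y + M.c i * τ) k

/-- The first-jump operator of the transform `E_{y,i}(e^{-sθ} 1{θ < ∞, φ(θ) = j})`: level zero is
reached before the first jump, or `g` gives the value after that jump. -/
def stepOp (s : ℝ) (j : S) (g : ℝ → S → ℝ≥0∞) (y : ℝ) (i : S) : ℝ≥0∞ :=
  (if M.c i < 0 ∧ i = j then ENNReal.ofReal (Real.exp (-((s - M.T i i) * (y / |M.c i|)))) else 0)
    + ∫⁻ τ in M.window i y, M.jumpDensity s g i y τ

/-- The transform of the passage time to level zero, restricted to fewer than `n` jumps. -/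
def passageIter (s : ℝ) (j : S) : ℕ → ℝ → S → ℝ≥0∞
  | 0 => fun _ _ => 0
  | n + 1 => M.stepOp s j (passageIter s j n)

/-- The transform `E_{y,i}(e^{-sθ} 1{θ < ∞, φ(θ) = j})` of the passage time from level `y` and
phase `i` to level zero through a decreasing phase, as the least fixed point of the first-jump
operator. -/
def passage (s : ℝ) (j : S) (y : ℝ) (i : S) : ℝ≥0∞ := ⨆ n, M.passageIter s j n y i

variable {M}

lemma measurable_jumpDensity {s : ℝ} {g : ℝ → S → ℝ≥0∞} (hg : ∀ k, Measurable fun y => g y k)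
    (i : S) : Measurable fun p : ℝ × ℝ => M.jumpDensity s g i p.1 p.2 := by
  unfold jumpDensity
  refine Measurable.mul (by fun_prop) (Finset.measurable_fun_sum _ fun k _ => ?_)
  exact ((hg k).comp (by fun_prop : Measurable fun p : ℝ × ℝ => p.1 + M.c i * p.2)).const_mul _

lemma measurable_jumpDensity_right {s : ℝ} {g : ℝ → S → ℝ≥0∞}
    (hg : ∀ k, Measurable fun y => g y k) (i : S) (y : ℝ) : Measurable (M.jumpDensity s g i y) :=
  (measurable_jumpDensity hg i).comp (measurable_const.prodMk measurable_id)

lemma measurable_stepOp {s : ℝ} {j : S} {g : ℝ → S → ℝ≥0∞} (hg : ∀ k, Measurable fun y => g y k)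
    (i : S) : Measurable fun y => M.stepOp s j g y i := by
  unfold stepOp
  refine Measurable.add ?_ ?_
  · split_ifs
    · fun_prop
    · fun_prop
  · have h : ∀ y, ∫⁻ τ in M.window i y, M.jumpDensity s g i y τ
        = ∫⁻ τ, {p : ℝ × ℝ | 0 < p.2 ∧ 0 ≤ p.1 + M.c i * p.2}.indicator
          (fun p => M.jumpDensity s g i p.1 p.2) (y, τ) := by
      intro y
      rw [← lintegral_indicator (measurableSet_window i y)]
      rfl
    simp_rw [h]
    refine Measurable.lintegral_prod_right' (Measurable.indicator (measurable_jumpDensity hg i) ?_)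
    have h2 : Measurable fun p : ℝ × ℝ => p.1 + M.c i * p.2 := by fun_prop
    exact (measurableSet_lt measurable_const measurable_snd).inter
      (measurableSet_le measurable_const h2)

lemma jumpDensity_mono {s : ℝ} {g g' : ℝ → S → ℝ≥0∞} {i : S} {y τ : ℝ}
    (h : ∀ k, g (y + M.c i * τ) k ≤ g' (y + M.c i * τ) k) :
    M.jumpDensity s g i y τ ≤ M.jumpDensity s g' i y τ := by
  unfold jumpDensity
  gcongr with k
  exact h k

lemma stepOp_mono {s : ℝ} {j : S} {g g' : ℝ → S → ℝ≥0∞} (h : ∀ y, 0 ≤ y → ∀ k, g y k ≤ g' y k)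
    (y : ℝ) (i : S) : M.stepOp s j g y i ≤ M.stepOp s j g' y i := by
  unfold stepOp
  gcongr 1
  refine setLIntegral_mono' (measurableSet_window i y) fun τ hτ => ?_
  exact jumpDensity_mono fun k => h _ hτ.2 k

lemma measurable_passageIter (s : ℝ) (j : S) (n : ℕ) (i : S) :
    Measurable fun y => M.passageIter s j n y i := by
  induction n generalizing i with
  | zero => exact measurable_const
  | succ n ih => exact measurable_stepOp ih i

lemma measurable_passage (s : ℝ) (j i : S) : Measurable fun y => M.passage s j y i :=
  Measurable.iSup fun n => measurable_passageIter s j n i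

lemma passageIter_le_succ (s : ℝ) (j : S) (n : ℕ) (y : ℝ) (i : S) :
    M.passageIter s j n y i ≤ M.passageIter s j (n + 1) y i := by
  induction n generalizing y i with
  | zero => exact zero_le
  | succ n ih => exact stepOp_mono (fun y _ k => ih y k) y i

lemma monotone_passageIter (s : ℝ) (j : S) (y : ℝ) (i : S) :
    Monotone fun n => M.passageIter s j n y i :=
  monotone_nat_of_le_succ fun n => passageIter_le_succ s j n y i

lemma passageIter_le_passage (s : ℝ) (j : S) (n : ℕ) (y : ℝ) (i : S) :
    M.passageIter s j n y i ≤ M.passage s j y i :=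
  le_iSup (fun n => M.passageIter s j n y i) n

lemma jumpDensity_iSup {s : ℝ} {g : ℕ → ℝ → S → ℝ≥0∞} (hg : ∀ y k, Monotone fun n => g n y k)
    (i : S) (y τ : ℝ) : M.jumpDensity s (fun y k => ⨆ n, g n y k) i y τ
      = ⨆ n, M.jumpDensity s (g n) i y τ := by
  unfold jumpDensity
  rw [← ENNReal.mul_iSup]
  congr 1
  rw [← ENNReal.finsetSum_iSup_of_monotone]
  · simp_rw [ENNReal.mul_iSup]
  · intro k m n hmn
    exact mul_le_mul_right (hg _ k hmn) _

/-- The transform satisfies the equation obtained by conditioning on the first jump. -/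
lemma stepOp_passage (s : ℝ) (j : S) (y : ℝ) (i : S) :
    M.stepOp s j (M.passage s j) y i = M.passage s j y i := by
  have h1 : M.passage s j y i = ⨆ n, M.passageIter s j (n + 1) y i :=
    ((monotone_passageIter s j y i).iSup_nat_add 1).symm
  rw [h1]
  change _ = ⨆ n, M.stepOp s j (M.passageIter s j n) y i
  unfold stepOp
  rw [← ENNReal.add_iSup]
  congr 1
  rw [← lintegral_iSup (fun n => measurable_jumpDensity_right (measurable_passageIter s j n) i y)]
  · refine lintegral_congr fun τ => ?_
    exact jumpDensity_iSup (monotone_passageIter s j) i y τ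
  · intro m n hmn τ
    exact jumpDensity_mono fun k => monotone_passageIter s j _ k hmn

/-- The least fixed point lies below every supersolution. -/
lemma passage_le_of_stepOp_le {s : ℝ} {j : S} {g : ℝ → S → ℝ≥0∞}
    (h : ∀ y, 0 ≤ y → ∀ i, M.stepOp s j g y i ≤ g y i) {y : ℝ} (hy : 0 ≤ y) (i : S) :
    M.passage s j y i ≤ g y i := by
  refine iSup_le fun n => ?_
  induction n generalizing y i with
  | zero => exact zero_le
  | succ n ih => exact (stepOp_mono (fun y hy k => ih hy k) y i).trans (h y hy i)

lemma jumpDensity_add (s : ℝ) (g : ℝ → S → ℝ≥0∞) (i : S) (y t τ : ℝ) :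
    M.jumpDensity s g i y (τ + t)
      = ENNReal.ofReal (Real.exp (-((s - M.T i i) * t)))
        * M.jumpDensity s g i (y + M.c i * t) τ := by
  unfold jumpDensity
  rw [← mul_assoc, ← ENNReal.ofReal_mul (Real.exp_nonneg _), ← Real.exp_add]
  congr 3
  · ring
  · ext k; congr 2; ring

/-- Conditioning on the phase staying in `i` up to time `t` or leaving it earlier, where the level
does not reach zero before `t`. -/
lemma stepOp_flow (s : ℝ) (j : S) (g : ℝ → S → ℝ≥0∞) (i : S) {y t : ℝ} (ht : 0 ≤ t) (hy : 0 ≤ y)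
    (hyt : 0 ≤ y + M.c i * t) :
    M.stepOp s j g y i = (∫⁻ τ in Ioc 0 t, M.jumpDensity s g i y τ)
      + ENNReal.ofReal (Real.exp (-((s - M.T i i) * t))) * M.stepOp s j g (y + M.c i * t) i := by
  have hset : M.window i y = Ioc 0 t ∪ (fun τ => τ + (-t)) ⁻¹' M.window i (y + M.c i * t) := by
    ext τ
    simp only [window, mem_ofPred_eq, mem_union, mem_Ioc, mem_preimage]
    constructor
    · rintro ⟨h1, h2⟩
      by_cases h : τ ≤ t
      · exact Or.inl ⟨h1, h⟩
      · push Not at h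
        exact Or.inr ⟨by linarith, by linarith⟩
    · rintro (⟨h1, h2⟩ | ⟨h1, h2⟩)
      · refine ⟨h1, ?_⟩
        rcases le_total 0 (M.c i) with hc | hc
        · positivity
        · nlinarith
      · exact ⟨by linarith, by linarith⟩
  have hdisj : Disjoint (Ioc 0 t) ((fun τ => τ + (-t)) ⁻¹' M.window i (y + M.c i * t)) := by
    rw [Set.disjoint_left]
    rintro τ ⟨_, h2⟩ ⟨h3, _⟩
    simp only at h3
    linarith
  have hmeas : MeasurableSet ((fun τ => τ + (-t)) ⁻¹' M.window i (y + M.c i * t)) :=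
    (measurable_id.add_const _) (measurableSet_window _ _)
  have hshift : ∫⁻ τ in (fun τ => τ + (-t)) ⁻¹' M.window i (y + M.c i * t),
      M.jumpDensity s g i y τ
      = ENNReal.ofReal (Real.exp (-((s - M.T i i) * t)))
        * ∫⁻ τ in M.window i (y + M.c i * t), M.jumpDensity s g i (y + M.c i * t) τ := by
    rw [← lintegral_const_mul' _ _ ENNReal.ofReal_ne_top]
    have := (measurePreserving_add_right (volume : Measure ℝ) (-t)).setLIntegral_comp_preimage_emb
      (measurableEmbedding_addRight (-t))
      (fun τ => M.jumpDensity s g i y (τ + t)) (M.window i (y + M.c i * t))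
    simp only [neg_add_cancel_right] at this
    rw [this]
    refine lintegral_congr fun τ => ?_
    rw [jumpDensity_add]
  unfold stepOp
  rw [hset, lintegral_union hmeas hdisj, hshift, mul_add]
  have hhit : (if M.c i < 0 ∧ i = j then
      ENNReal.ofReal (Real.exp (-((s - M.T i i) * (y / |M.c i|)))) else 0)
      = ENNReal.ofReal (Real.exp (-((s - M.T i i) * t))) * (if M.c i < 0 ∧ i = j then
      ENNReal.ofReal (Real.exp (-((s - M.T i i) * ((y + M.c i * t) / |M.c i|)))) else 0) := by
    split_ifs with h
    · rw [← ENNReal.ofReal_mul (Real.exp_nonneg _), ← Real.exp_add]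
      congr 2
      have := h.1
      rw [abs_of_neg this]
      have h0 := this.ne
      field_simp
      ring
    · simp
  rw [hhit]
  ring

/-- `stepOp_flow` at the fixed point. -/
lemma passage_flow (s : ℝ) (j i : S) {y t : ℝ} (ht : 0 ≤ t) (hy : 0 ≤ y)
    (hyt : 0 ≤ y + M.c i * t) :
    M.passage s j y i = (∫⁻ τ in Ioc 0 t, M.jumpDensity s (M.passage s j) i y τ)
      + ENNReal.ofReal (Real.exp (-((s - M.T i i) * t))) * M.passage s j (y + M.c i * t) i := by
  conv_lhs => rw [← stepOp_passage, stepOp_flow s j _ i ht hy hyt, stepOp_passage]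

/-- The first-jump operator at level zero in a decreasing phase. -/
lemma stepOp_zero_of_neg {s : ℝ} {j : S} (g : ℝ → S → ℝ≥0∞) {i : S} (hi : M.c i < 0) :
    M.stepOp s j g 0 i = if i = j then 1 else 0 := by
  have : M.window i 0 = ∅ := by
    ext τ
    simp only [window, mem_ofPred_eq, zero_add, mem_empty_iff_false, iff_false, not_and, not_le]
    intro h
    exact mul_neg_of_neg_of_pos hi h
  simp [stepOp, this, hi]

lemma passage_zero_of_neg {s : ℝ} {j i : S} (hi : M.c i < 0) :
    M.passage s j 0 i = if i = j then 1 else 0 := by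
  rw [← stepOp_passage, stepOp_zero_of_neg _ hi]

end Passage

/-! ### Additivity in the level, positivity, finiteness, monotonicity in the rate -/

section PassageProperties

variable {S : Type*} [Fintype S] [DecidableEq S] {M : FluidModel S}

/-- The first-jump operator at a sum of levels: the level `y` is reached before the first jump, or
that jump occurs above it. -/
lemma stepOp_add (s : ℝ) (j : S) (g : ℝ → S → ℝ≥0∞) (i : S) {x y : ℝ} (hx : 0 ≤ x) (hy : 0 ≤ y) :
    M.stepOp s j g (x + y) i
      = (if M.c i < 0 then ENNReal.ofReal (Real.exp (-((s - M.T i i) * (x / |M.c i|))))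
          * M.stepOp s j g y i else 0)
        + ∫⁻ τ in M.window i x, M.jumpDensity s (fun z k => g (z + y) k) i x τ := by
  have hjd : ∀ τ, M.jumpDensity s (fun z k => g (z + y) k) i x τ
      = M.jumpDensity s g i (x + y) τ := by
    intro τ
    unfold jumpDensity
    congr 2; ext k; rw [add_right_comm]
  simp_rw [hjd]
  split_ifs with hi
  · have hc := hi.ne
    have h0 : x + y + M.c i * (x / |M.c i|) = y := by
      have h1 : M.c i * (x / -M.c i) = -x := by field_simp
      rw [abs_of_neg hi, h1]; ring
    rw [stepOp_flow s j g i (t := x / |M.c i|) (by positivity) (by positivity)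
      (by rw [h0]; exact hy), h0, window_of_neg hi, add_comm]
  · rw [stepOp, if_neg (fun h => hi h.1), window_of_nonneg (not_lt.1 hi) hx,
      window_of_nonneg (not_lt.1 hi) (by positivity)]

lemma jumpDensity_sum_mul {ι : Type*} [Fintype ι] (s : ℝ) (g : ι → ℝ → S → ℝ≥0∞) (a : ι → ℝ≥0∞)
    (i : S) (y τ : ℝ) : M.jumpDensity s (fun z k => ∑ b, g b z k * a b) i y τ
      = ∑ b, M.jumpDensity s (g b) i y τ * a b := by
  have h : ∀ k, M.offRate i k * ∑ b, g b (y + M.c i * τ) k * a b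
      = ∑ b, M.offRate i k * g b (y + M.c i * τ) k * a b := by
    intro k
    rw [Finset.mul_sum]
    exact Finset.sum_congr rfl fun b _ => (mul_assoc _ _ _).symm
  have h2 : ∀ b, M.jumpDensity s (g b) i y τ * a b
      = ENNReal.ofReal (Real.exp (-((s - M.T i i) * τ))) *
        ∑ k, M.offRate i k * g b (y + M.c i * τ) k * a b := by
    intro b
    rw [jumpDensity, mul_assoc, Finset.sum_mul]
  rw [Finset.sum_congr rfl fun b _ => h2 b, jumpDensity, Finset.sum_congr rfl fun k _ => h k,
    ← Finset.mul_sum, Finset.sum_comm]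

lemma sum_stepOp_mul (s : ℝ) {g : M.Down → ℝ → S → ℝ≥0∞}
    (hg : ∀ b k, Measurable fun y => g b y k) (a : S → ℝ≥0∞) (i : S) (x : ℝ) :
    ∑ b : M.Down, M.stepOp s b (g b) x i * a b
      = (if M.c i < 0 then ENNReal.ofReal (Real.exp (-((s - M.T i i) * (x / |M.c i|)))) * a i
          else 0)
        + ∫⁻ τ in M.window i x, M.jumpDensity s (fun z k => ∑ b : M.Down, g b z k * a b) i x τ := by
  simp_rw [jumpDensity_sum_mul]
  rw [lintegral_finsetSum]
  swap
  · intro b _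
    exact (measurable_jumpDensity_right (hg b) i x).mul_const _
  simp_rw [lintegral_mul_const _ (measurable_jumpDensity_right (hg _) i x)]
  unfold stepOp
  simp_rw [add_mul]
  rw [Finset.sum_add_distrib]
  congr 1
  split_ifs with hi
  · rw [Finset.sum_eq_single ⟨i, hi⟩]
    · simp [hi]
    · intro b _ hb
      rw [if_neg, zero_mul]
      rintro ⟨-, h⟩
      exact hb (Subtype.ext h.symm)
    · simp
  · refine Finset.sum_eq_zero fun b _ => ?_
    rw [if_neg (fun h => hi h.1), zero_mul]

/-- The level descends from `x + y` to zero by first descending to `y`, so the transforms of the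
passage times multiply. Both inequalities follow from the minimality of the transform. -/
theorem passage_add (s : ℝ) (j : S) (i : S) {x y : ℝ} (hx : 0 ≤ x) (hy : 0 ≤ y) :
    M.passage s j (x + y) i = ∑ b : M.Down, M.passage s b x i * M.passage s j y b := by
  apply le_antisymm
  · -- each iterate lies below the product, by induction on the number of jumps
    refine iSup_le fun n => ?_
    induction n generalizing x i with
    | zero => exact zero_le
    | succ n ih =>
      have h1 := sum_stepOp_mul s (g := fun b : M.Down => M.passage s b)
        (fun b k => measurable_passage (M := M) s b.1 k)
        (M.passage s j y) i x
      simp_rw [stepOp_passage] at h1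
      rw [h1]
      change M.stepOp s j (M.passageIter s j n) (x + y) i ≤ _
      rw [stepOp_add s j _ i hx hy]
      gcongr 1
      · split_ifs
        · gcongr
          exact passageIter_le_passage s j (n + 1) y i
        · exact le_rfl
      · refine setLIntegral_mono' (measurableSet_window i x) fun τ hτ => ?_
        exact jumpDensity_mono fun k => ih k hτ.2
  · -- in the product only the first factor is iterated
    have h : ∀ n, ∑ b : M.Down, M.passageIter s b n x i * M.passage s j y b
        ≤ M.passage s j (x + y) i := by
      intro n
      induction n generalizing x i with
      | zero => simp [passageIter]
      | succ n ih =>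
        change ∑ b : M.Down, M.stepOp s b (M.passageIter s b n) x i * M.passage s j y b ≤ _
        rw [sum_stepOp_mul s (g := fun b : M.Down => M.passageIter s b n)
          (fun b k => measurable_passageIter (M := M) s b.1 n k) (M.passage s j y) i x,
          ← stepOp_passage s j (x + y), stepOp_add s j _ i hx hy, stepOp_passage]
        gcongr 1
        refine setLIntegral_mono' (measurableSet_window i x) fun τ hτ => ?_
        exact jumpDensity_mono fun k => ih k hτ.2
    unfold passage at h ⊢
    simp_rw [ENNReal.iSup_mul]
    rw [ENNReal.finsetSum_iSup_of_monotone]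
    · exact iSup_le h
    · intro b m n hmn
      exact mul_le_mul_left (monotone_passageIter s _ x i hmn) _

lemma exp_le_passage (s : ℝ) {j : S} (hj : M.c j < 0) (y : ℝ) :
    ENNReal.ofReal (Real.exp (-((s - M.T j j) * (y / |M.c j|)))) ≤ M.passage s j y j := by
  rw [← stepOp_passage, stepOp, if_pos ⟨hj, rfl⟩]
  exact le_self_add

lemma passage_mul_le (s : ℝ) (j : M.Down) (b : M.Down) (i : S) {x y : ℝ} (hx : 0 ≤ x)
    (hy : 0 ≤ y) : M.passage s b x i * M.passage s j y b ≤ M.passage s j (x + y) i := by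
  rw [passage_add s j.1 i hx hy]
  exact Finset.single_le_sum (f := fun b : M.Down => M.passage s b x i * M.passage s j y b)
    (fun _ _ => zero_le) (Finset.mem_univ b)

lemma offRate_ne_zero {i k : S} (h : 0 < M.T i k) : M.offRate i k ≠ 0 := by
  unfold offRate
  split_ifs with hik
  · subst hik; exact absurd h (not_lt.2 (M.diag_nonpos i))
  · simpa using h

lemma offRate_ne_top (i k : S) : M.offRate i k ≠ ∞ := by
  unfold offRate
  split_ifs <;> simp

lemma setLIntegral_le_passage (s : ℝ) (j i : S) {y t : ℝ} (ht : 0 ≤ t) (hy : 0 ≤ y)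
    (hyt : 0 ≤ y + M.c i * t) :
    ∫⁻ τ in Ioc 0 t, M.jumpDensity s (M.passage s j) i y τ ≤ M.passage s j y i := by
  rw [passage_flow s j i ht hy hyt]
  exact le_self_add

/-- From a positive level, level zero is reached in any given decreasing phase with positive
probability. -/
lemma passage_pos (hirr : M.Irreducible) (s : ℝ) (j : M.Down) (i : S) {y : ℝ} (hy : 0 < y) :
    0 < M.passage s j y i := by
  have h := hirr i j
  induction h using Relation.ReflTransGen.head_induction_on generalizing y with
  | refl =>
    refine lt_of_lt_of_le ?_ (exp_le_passage s j.2 y)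
    simp [Real.exp_pos]
  | @head i k hik _ ih =>
    have ht : 0 < y / (|M.c i| + 1) := by positivity
    have hlow : ∀ τ ∈ Ioc 0 (y / (|M.c i| + 1)), 0 < y + M.c i * τ := by
      intro τ hτ
      have h1 : (|M.c i| + 1) * τ ≤ y := by
        have := hτ.2
        rw [le_div_iff₀ (by positivity)] at this
        linarith
      have h2 := neg_abs_le (M.c i)
      nlinarith [hτ.1]
    refine lt_of_lt_of_le ?_
      (setLIntegral_le_passage s j.1 i ht.le hy.le (hlow _ ⟨ht, le_rfl⟩).le)
    rw [setLIntegral_pos_iff (measurable_jumpDensity_right (measurable_passage s j.1) i y)]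
    rw [inter_eq_self_of_subset_right]
    · simpa using ht
    · intro τ hτ
      rw [Function.mem_support]
      unfold jumpDensity
      refine mul_ne_zero (by simp [Real.exp_pos]) ?_
      intro h0
      rw [Finset.sum_eq_zero_iff] at h0
      exact mul_ne_zero (offRate_ne_zero hik) (ih (hlow τ hτ)).ne' (h0 k (Finset.mem_univ k))

lemma passage_zero_pos (hirr : M.Irreducible) (s : ℝ) (j : M.Down) {i : S} (hi : 0 < M.c i) :
    0 < M.passage s j 0 i := by
  rw [passage_flow s j.1 i zero_le_one le_rfl (by simpa using hi.le)]
  refine lt_of_lt_of_le ?_ le_add_self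
  refine ENNReal.mul_pos (by simp [Real.exp_pos]) ?_
  exact (passage_pos hirr s j i (by simpa using hi)).ne'

lemma passage_ne_top_of_add {s : ℝ} {k : M.Down} {i : S} {x y : ℝ} (hx : 0 ≤ x) (hy : 0 ≤ y)
    (h : M.passage s k (x + y) i ≠ ∞) : M.passage s k x i ≠ ∞ := by
  intro h0
  have h1 := passage_mul_le s k k i hx hy
  have h2 : M.passage s k y k ≠ 0 := by
    refine (lt_of_lt_of_le ?_ (exp_le_passage s k.2 y)).ne'
    simp [Real.exp_pos]
  rw [h0, ENNReal.top_mul h2] at h1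
  exact h (top_le_iff.1 h1)

/-- If the transform is finite at a level, then it is finite at some level reached by time `t`, in
every phase to which the phase can jump. -/
lemma exists_passage_ne_top {s : ℝ} {k : S} {i x : S} {y t : ℝ} (ht : 0 < t) (hy : 0 ≤ y)
    (hyt : 0 ≤ y + M.c i * t) (h : M.passage s k y i ≠ ∞) (hix : 0 < M.T i x) :
    ∃ τ ∈ Ioc 0 t, M.passage s k (y + M.c i * τ) x ≠ ∞ := by
  have h1 := setLIntegral_le_passage s k i ht.le hy hyt
  have h2 : ∫⁻ τ in Ioc 0 t, M.jumpDensity s (M.passage s k) i y τ ≠ ∞ :=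
    ne_top_of_le_ne_top h h1
  by_contra! hcon
  apply h2
  have h3 : ∀ τ ∈ Ioc 0 t, M.jumpDensity s (M.passage s k) i y τ = ∞ := by
    intro τ hτ
    unfold jumpDensity
    rw [ENNReal.mul_eq_top]
    left
    refine ⟨by simp [Real.exp_pos], ?_⟩
    rw [ENNReal.sum_eq_top]
    exact ⟨x, Finset.mem_univ x, by rw [hcon τ hτ, ENNReal.mul_top (offRate_ne_zero hix)]⟩
  rw [setLIntegral_congr_fun measurableSet_Ioc h3]
  simp [ht]

/-- Finiteness of the transform at one level in one increasing phase propagates along the jumps of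
the phase process, and then to every target phase. -/
theorem passage_ne_top_of_up (hirr : M.Irreducible) {s : ℝ} {k : M.Down} {l : S} (hl : 0 < M.c l)
    (h : M.passage s k 0 l ≠ ∞) (j : M.Down) (i : S) {y : ℝ} (hy : 0 ≤ y) :
    M.passage s j y i ≠ ∞ := by
  -- phase `l` may last until the level has risen from zero to `y`
  have hup : ∀ y, 0 ≤ y → M.passage s k y l ≠ ∞ := by
    intro y hy h0
    have h1 := passage_flow s k.1 l (y := 0) (t := y / M.c l) (by positivity) le_rfl
      (by have : M.c l ≠ 0 := hl.ne'
          field_simp; simpa using hy)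
    have h2 : 0 + M.c l * (y / M.c l) = y := by field_simp; simp
    rw [h2, h0, ENNReal.mul_top (by simp [Real.exp_pos]), add_top] at h1
    exact h h1
  have hall : ∀ i, ∀ y, 0 ≤ y → M.passage s k y i ≠ ∞ := by
    intro i
    induction hirr l i with
    | refl => exact hup
    | @tail b x _ hbx ih =>
      intro y hy
      -- starting at `y + |c b|`, the level is still at least `y` at any time `τ ≤ 1`
      obtain ⟨τ, hτ, hfin⟩ := exists_passage_ne_top (y := y + |M.c b|) zero_lt_one (by positivity)
        (by have := neg_abs_le (M.c b); linarith) (ih _ (by positivity)) hbx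
      have hpos : 0 ≤ |M.c b| + M.c b * τ := by
        have h1 := neg_abs_le (M.c b)
        have h2 := abs_nonneg (M.c b)
        nlinarith [hτ.1, hτ.2]
      rw [add_assoc] at hfin
      exact passage_ne_top_of_add hy hpos hfin
  intro h0
  have h1 := passage_mul_le s k j i hy zero_le_one
  rw [h0, ENNReal.top_mul (passage_pos hirr s k j one_pos).ne'] at h1
  exact hall i _ (by positivity) (top_le_iff.1 h1)

lemma jumpDensity_le_of_le {s s' : ℝ} (hs : s' ≤ s) {g g' : ℝ → S → ℝ≥0∞} {i : S} {y τ : ℝ}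
    (hτ : 0 ≤ τ) (h : ∀ k, g (y + M.c i * τ) k ≤ g' (y + M.c i * τ) k) :
    M.jumpDensity s g i y τ ≤ M.jumpDensity s' g' i y τ := by
  unfold jumpDensity
  gcongr with k
  exact h k

lemma stepOp_le_of_le {s s' : ℝ} (hs : s' ≤ s) {j : S} {g g' : ℝ → S → ℝ≥0∞}
    (h : ∀ y, 0 ≤ y → ∀ k, g y k ≤ g' y k) {y : ℝ} (hy : 0 ≤ y) (i : S) :
    M.stepOp s j g y i ≤ M.stepOp s' j g' y i := by
  unfold stepOp
  gcongr 1
  · split_ifs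
    · gcongr
    · exact le_rfl
  · refine setLIntegral_mono' (measurableSet_window i y) fun τ hτ => ?_
    exact jumpDensity_le_of_le hs hτ.1.le fun k => h _ hτ.2 k

lemma passage_anti {s s' : ℝ} (hs : s' ≤ s) (j i : S) {y : ℝ} (hy : 0 ≤ y) :
    M.passage s j y i ≤ M.passage s' j y i := by
  refine passage_le_of_stepOp_le (fun y hy i => ?_) hy i
  rw [← stepOp_passage s']
  exact stepOp_le_of_le hs (fun _ _ _ => le_rfl) hy i

lemma iSup_mul_iSup_of_monotone {f g : ℕ → ℝ≥0∞} (hf : Monotone f) (hg : Monotone g) :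
    (⨆ n, f n) * ⨆ n, g n = ⨆ n, f n * g n := by
  apply le_antisymm
  · rw [ENNReal.iSup_mul]
    refine iSup_le fun m => ?_
    rw [ENNReal.mul_iSup]
    refine iSup_le fun n => ?_
    refine le_trans ?_ (le_iSup _ (max m n))
    exact mul_le_mul' (hf (le_max_left m n)) (hg (le_max_right m n))
  · exact iSup_le fun n => mul_le_mul' (le_iSup f n) (le_iSup g n)

/-- Continuity of the transform from the right in the discount rate, by monotone convergence. -/
theorem iSup_passage_eq {s : ℝ} {σ : ℕ → ℝ} (hσ : Antitone σ)
    (hlim : Filter.Tendsto σ Filter.atTop (nhds s)) (j i : S) {y : ℝ} (hy : 0 ≤ y) :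
    ⨆ n, M.passage (σ n) j y i = M.passage s j y i := by
  have hle : ∀ n, s ≤ σ n := fun n => hσ.le_of_tendsto hlim n
  apply le_antisymm
  · exact iSup_le fun n => passage_anti (hle n) j i hy
  refine passage_le_of_stepOp_le (g := fun y i => ⨆ n, M.passage (σ n) j y i)
    (fun y hy i => ?_) hy i
  have hexp : ∀ a b : ℝ, 0 ≤ b → ENNReal.ofReal (Real.exp (-((s - a) * b)))
      = ⨆ n, ENNReal.ofReal (Real.exp (-((σ n - a) * b))) := by
    intro a b hb
    have hm : Monotone fun n => ENNReal.ofReal (Real.exp (-((σ n - a) * b))) := by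
      intro m n hmn
      have := hσ hmn
      dsimp only
      gcongr
    refine tendsto_nhds_unique ?_ (tendsto_atTop_iSup hm)
    refine ENNReal.tendsto_ofReal ((Real.continuous_exp.tendsto _).comp ?_)
    exact ((hlim.sub_const a).mul_const b).neg
  have hmono : ∀ y, 0 ≤ y → ∀ k, Monotone fun n => M.passage (σ n) j y k :=
    fun y hy k m n hmn => passage_anti (hσ hmn) j k hy
  have h1 : ∫⁻ τ in M.window i y, M.jumpDensity s (fun y i => ⨆ n, M.passage (σ n) j y i) i y τ
      = ⨆ n, ∫⁻ τ in M.window i y, M.jumpDensity (σ n) (M.passage (σ n) j) i y τ := by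
    rw [← lintegral_iSup']
    · refine setLIntegral_congr_fun (measurableSet_window i y) fun τ hτ => ?_
      simp only [jumpDensity]
      rw [hexp _ _ hτ.1.le]
      simp_rw [ENNReal.mul_iSup]
      rw [ENNReal.finsetSum_iSup_of_monotone
        (f := fun k n => M.offRate i k * M.passage (σ n) j (y + M.c i * τ) k)
        (fun k m n hmn => mul_le_mul_right (hmono _ hτ.2 k hmn) _)]
      rw [iSup_mul_iSup_of_monotone]
      · intro m n hmn
        have := hσ hmn
        have := hτ.1
        dsimp only
        gcongr
      · intro m n hmn
        dsimp only
        gcongr with k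
        exact hmono _ hτ.2 k hmn
    · intro n
      exact (measurable_jumpDensity_right (measurable_passage _ j) i y).aemeasurable
    · refine (ae_restrict_iff' (measurableSet_window i y)).2 (ae_of_all _ fun τ hτ m n hmn => ?_)
      exact jumpDensity_le_of_le (hσ hmn) hτ.1.le fun k => hmono _ hτ.2 k hmn
  simp_rw [← stepOp_passage (σ _) j y i]
  unfold stepOp
  rw [h1]
  rw [← ENNReal.iSup_add_iSup_of_monotone]
  · gcongr 1
    split_ifs
    · rw [hexp _ _ (by positivity)]
    · exact zero_le
  · intro m n hmn
    have := hσ hmn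
    dsimp only
    split_ifs
    · gcongr
    · exact le_rfl
  · intro m n hmn
    refine setLIntegral_mono' (measurableSet_window i y) fun τ hτ => ?_
    exact jumpDensity_le_of_le (hσ hmn) hτ.1.le fun k => hmono _ hτ.2 k hmn

end PassageProperties

/-! ### The law of the sequence of sojourns -/

section Sojourns

variable {S : Type*} [Fintype S] [MeasurableSpace S] {M : FluidModel S}

lemma lintegral_expMeasure (r : ℝ) {f : ℝ → ℝ≥0∞} (hf : Measurable f) :
    ∫⁻ τ, f τ ∂(expMeasure r)
      = ∫⁻ τ in Ioi 0, ENNReal.ofReal (r * Real.exp (-(r * τ))) * f τ := by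
  have h1 : expMeasure r = volume.withDensity (exponentialPDF r) := rfl
  have h2 : Measurable (exponentialPDF r) := (measurable_exponentialPDFReal r).ennreal_ofReal
  rw [h1, lintegral_withDensity_eq_lintegral_mul _ h2 hf, ← lintegral_indicator measurableSet_Ioi]
  refine lintegral_congr_ae ?_
  have h0 : ∀ᵐ τ : ℝ, τ ≠ 0 := by simp [ae_iff]
  filter_upwards [h0] with τ hτ
  simp only [Pi.mul_apply, exponentialPDF_eq, indicator_apply, mem_Ioi]
  rcases lt_or_gt_of_ne hτ with h | h
  · simp [h.not_ge, h.not_gt]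
  · simp [h, h.le]

lemma lintegral_sojournLaw (i : S) {f : S × ℝ → ℝ≥0∞} (hf : Measurable f) :
    ∫⁻ p, f p ∂(M.sojournLaw i)
      = ∫⁻ τ in Ioi 0,
        ENNReal.ofReal (M.holdRate i * Real.exp (-(M.holdRate i * τ))) * f (i, τ) := by
  have := isProbabilityMeasure_expMeasure (M.holdRate_pos i)
  rw [sojournLaw, Measure.dirac_prod, lintegral_map hf measurable_prodMk_left]
  exact lintegral_expMeasure _ (hf.comp measurable_prodMk_left)

variable [MeasurableSingletonClass S]

lemma lintegral_stepKernel (z : S × ℝ) {f : S × ℝ → ℝ≥0∞} (hf : Measurable f) :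
    ∫⁻ p, f p ∂(M.stepKernel z)
      = ∑ k, ENNReal.ofReal (M.jumpProb z.1 k) * ∫⁻ p, f p ∂(M.sojournLaw k) := by
  rw [stepKernel, Kernel.comap_apply, Kernel.lintegral_comp _ _ _ hf]
  change ∫⁻ b, ∫⁻ p, f p ∂(M.sojournLaw b) ∂(M.jumpLaw z.1) = _
  rw [jumpLaw, lintegral_finsetSum_measure]
  refine Finset.sum_congr rfl fun k _ => ?_
  rw [lintegral_smul_measure, lintegral_dirac, smul_eq_mul]

/-- Holding times are positive, and their laws have no atoms. -/
lemma ae_sojournLaw (i : S) (y : ℝ) :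
    ∀ᵐ p ∂(M.sojournLaw i), p.1 = i ∧ 0 < p.2 ∧ (M.c p.1 ≠ 0 → y + M.c p.1 * p.2 ≠ 0) := by
  have hmeas : MeasurableSet {p : S × ℝ | p.1 = i ∧ 0 < p.2 ∧
      (M.c p.1 ≠ 0 → y + M.c p.1 * p.2 ≠ 0)} := by
    have h1 : Measurable fun p : S × ℝ => M.c p.1 := (measurable_of_finite M.c).comp measurable_fst
    have h2 : Measurable fun p : S × ℝ => y + M.c p.1 * p.2 :=
      (h1.mul measurable_snd).const_add y
    have h3 : MeasurableSet {p : S × ℝ | M.c p.1 = 0} := h1 (measurableSet_singleton 0)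
    have h4 : MeasurableSet {p : S × ℝ | y + M.c p.1 * p.2 = 0} := h2 (measurableSet_singleton 0)
    have h5 : MeasurableSet {p : S × ℝ | p.1 = i} := measurable_fst (measurableSet_singleton i)
    have h6 : MeasurableSet {p : S × ℝ | 0 < p.2} :=
      measurableSet_lt measurable_const measurable_snd
    have h7 : {p : S × ℝ | M.c p.1 ≠ 0 → y + M.c p.1 * p.2 ≠ 0}
        = {p : S × ℝ | M.c p.1 = 0} ∪ {p : S × ℝ | y + M.c p.1 * p.2 = 0}ᶜ := by
      ext p
      simp only [mem_ofPred_eq, mem_union, mem_compl_iff]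
      tauto
    have h8 := h3.union h4.compl
    rw [← h7] at h8
    exact h5.inter (h6.inter h8)
  rw [ae_iff]
  change M.sojournLaw i {p : S × ℝ | p.1 = i ∧ 0 < p.2 ∧
      (M.c p.1 ≠ 0 → y + M.c p.1 * p.2 ≠ 0)}ᶜ = 0
  rw [← lintegral_indicator_one hmeas.compl, lintegral_sojournLaw i
    (measurable_one.indicator hmeas.compl)]
  rw [lintegral_eq_zero_iff']
  · have h0 : ∀ᵐ τ : ℝ, τ ≠ -y / M.c i := by simp [ae_iff]
    filter_upwards [ae_restrict_of_ae h0, ae_restrict_mem measurableSet_Ioi] with τ h1 h2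
    rw [indicator_of_notMem]
    · simp
    · simp only [mem_compl_iff, mem_ofPred_eq, not_not, true_and]
      refine ⟨h2, fun hc h => h1 ?_⟩
      field_simp
      linarith
  · refine (Measurable.mul (by fun_prop) ?_).aemeasurable
    exact (measurable_one.indicator hmeas.compl).comp measurable_prodMk_left

/-- The Markov property of the sequence of sojourns. -/
lemma lintegral_pathLaw_succ (i : S) (n : ℕ) {φ : (ℕ → S × ℝ) → S × ℝ → ℝ≥0∞}
    (hφ : Measurable (Function.uncurry φ))
    (hdep : ∀ ω ω' : ℕ → S × ℝ, (∀ k ≤ n, ω k = ω' k) → φ ω = φ ω') :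
    ∫⁻ ω, φ ω (ω (n + 1)) ∂(M.pathLaw i)
      = ∫⁻ ω, ∑ k, ENNReal.ofReal (M.jumpProb (ω n).1 k) * ∫⁻ p, φ ω p ∂(M.sojournLaw k)
        ∂(M.pathLaw i) := by
  -- an arbitrary measurable extension of finite histories, on which `φ` does not depend
  let ext : (Finset.Iic n → S × ℝ) → ℕ → S × ℝ := fun x k =>
    if h : k ≤ n then x ⟨k, Finset.mem_Iic.2 h⟩ else x ⟨n, Finset.mem_Iic.2 le_rfl⟩
  have hext : Measurable ext := by
    refine measurable_pi_lambda _ fun k => ?_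
    by_cases h : k ≤ n
    · simp only [ext, h, dif_pos]; exact measurable_pi_apply _
    · simp only [ext, h, dif_neg, not_false_eq_true]; exact measurable_pi_apply _
  have hres : ∀ ω : ℕ → S × ℝ, φ (ext (Preorder.frestrictLe n ω)) = φ ω := by
    intro ω
    refine hdep _ _ fun k hk => ?_
    simp [ext, hk, Preorder.frestrictLe_apply]
  have key := Kernel.map_frestrictLe_trajMeasure_compProd_eq_map_trajMeasure
    (X := fun _ => S × ℝ) (μ₀ := M.sojournLaw i) (κ := M.pathKernel) (a := n)
  have hF : Measurable fun q : (Finset.Iic n → S × ℝ) × (S × ℝ) => φ (ext q.1) q.2 :=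
    hφ.comp ((hext.comp measurable_fst).prodMk measurable_snd)
  have h1 : ∫⁻ ω, φ ω (ω (n + 1)) ∂(M.pathLaw i)
      = ∫⁻ q, φ (ext q.1) q.2
        ∂((M.pathLaw i).map fun x => (Preorder.frestrictLe n x, x (n + 1))) := by
    rw [lintegral_map hF (by fun_prop)]
    simp_rw [hres]
  rw [h1, pathLaw, ← key, Measure.lintegral_compProd hF,
    lintegral_map (Measurable.lintegral_kernel_prod_right hF) (by fun_prop)]
  refine lintegral_congr fun ω => ?_
  simp_rw [hres]
  rw [pathKernel, Kernel.comap_apply, lintegral_stepKernel]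
  · rfl
  · exact hφ.comp measurable_prodMk_left

lemma lintegral_pathLaw_zero (i : S) {f : S × ℝ → ℝ≥0∞} (hf : Measurable f) :
    ∫⁻ ω, f (ω 0) ∂(M.pathLaw i) = ∫⁻ p, f p ∂(M.sojournLaw i) := by
  have h0 : (M.pathLaw i).map (Preorder.frestrictLe 0)
      = (M.sojournLaw i).map
        (MeasurableEquiv.piUnique (fun _ : Finset.Iic (0 : ℕ) => S × ℝ)).symm := by
    rw [pathLaw, Kernel.trajMeasure, Measure.map_comp _ _ (by fun_prop),
      Kernel.traj_map_frestrictLe, Kernel.partialTraj_self, Measure.id_comp]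
  have hf' : Measurable fun x : Finset.Iic (0 : ℕ) → S × ℝ =>
      f (x ⟨0, Finset.mem_Iic.2 le_rfl⟩) := hf.comp (measurable_pi_apply _)
  have h1 : ∫⁻ ω, f (ω 0) ∂(M.pathLaw i)
      = ∫⁻ x, f (x ⟨0, Finset.mem_Iic.2 le_rfl⟩) ∂((M.pathLaw i).map (Preorder.frestrictLe 0)) := by
    rw [lintegral_map hf' (by fun_prop)]
    rfl
  rw [h1, h0, lintegral_map hf' (by fun_prop)]
  rfl

end Sojourns

/-! ### The passage transform as an expectation over paths -/

section Functional

variable {S : Type*} [Fintype S] (M : FluidModel S)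

/-- The level at the beginning of the `n`-th sojourn when it is not kept from going below zero. -/
def freeLevel (x : ℝ) (ω : ℕ → S × ℝ) (n : ℕ) : ℝ :=
  x + ∑ k ∈ Finset.range n, M.c (ω k).1 * (ω k).2

open Classical in
/-- The discount `e^{-st}` at the beginning `t` of the `n`-th sojourn, or `0` if the level has been
below zero before. -/
def weight (s x : ℝ) (ω : ℕ → S × ℝ) : ℕ → ℝ≥0∞
  | 0 => 1
  | n + 1 => if 0 ≤ M.freeLevel x ω (n + 1) then
      weight s x ω n * ENNReal.ofReal (Real.exp (-(s * (ω n).2))) else 0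

open Classical in
/-- The discount over the part of a sojourn that precedes the passage to level zero, if the level
reaches zero in that sojourn and its phase is `j`. -/
def hitReward (s : ℝ) (j : S) (y : ℝ) (p : S × ℝ) : ℝ≥0∞ :=
  if M.c p.1 < 0 ∧ y + M.c p.1 * p.2 ≤ 0 ∧ p.1 = j then
    ENNReal.ofReal (Real.exp (-(s * (y / |M.c p.1|)))) else 0

open Classical in
/-- The value of a sojourn that starts at level `y`, where `g` is the value after its end. -/
def sojournValue (s : ℝ) (j : S) (g : ℝ → S → ℝ≥0∞) (y : ℝ) (p : S × ℝ) : ℝ≥0∞ :=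
  M.hitReward s j y p + if 0 ≤ y + M.c p.1 * p.2 then
    ENNReal.ofReal (Real.exp (-(s * p.2))) *
      ∑ k, ENNReal.ofReal (M.jumpProb p.1 k) * g (y + M.c p.1 * p.2) k else 0

variable {M}

lemma holdRate_eq {i : S} (h : M.T i i < 0) : M.holdRate i = -M.T i i := by
  rw [holdRate, if_neg h.ne]

lemma ofReal_holdRate_mul_jumpProb [DecidableEq S] {i : S} (h : M.T i i < 0) (k : S) :
    ENNReal.ofReal (M.holdRate i) * ENNReal.ofReal (M.jumpProb i k) = M.offRate i k := by
  rw [holdRate_eq h, ← ENNReal.ofReal_mul (by linarith), jumpProb, if_neg h.ne, offRate]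
  split_ifs
  · simp
  · rw [mul_div_cancel₀ _ (by linarith)]

lemma lintegral_exp_Ioi {r a : ℝ} (hr : 0 < r) :
    ∫⁻ τ in Ioi a, ENNReal.ofReal (r * Real.exp (-(r * τ)))
      = ENNReal.ofReal (Real.exp (-(r * a))) := by
  have hint := (integrableOn_exp_mul_Ioi (neg_lt_zero.2 hr) a).const_mul r
  have h := integral_exp_mul_Ioi (neg_lt_zero.2 hr) a
  simp_rw [neg_mul] at h hint
  rw [← ofReal_integral_eq_lintegral_ofReal hint (ae_of_all _ fun τ => by positivity),
    integral_const_mul, h]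
  congr 1
  field_simp

lemma weight_succ_eq_zero {s x : ℝ} {ω : ℕ → S × ℝ} {n : ℕ} (h : ¬ 0 ≤ M.freeLevel x ω (n + 1)) :
    M.weight s x ω (n + 1) = 0 := by
  rw [weight, if_neg h]

lemma freeLevel_succ (x : ℝ) (ω : ℕ → S × ℝ) (n : ℕ) :
    M.freeLevel x ω (n + 1) = M.freeLevel x ω n + M.c (ω n).1 * (ω n).2 := by
  rw [freeLevel, freeLevel, Finset.sum_range_succ, add_assoc]

lemma freeLevel_zero (x : ℝ) (ω : ℕ → S × ℝ) : M.freeLevel x ω 0 = x := by simp [freeLevel]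

lemma freeLevel_congr (x : ℝ) {ω ω' : ℕ → S × ℝ} {n : ℕ} (h : ∀ k < n, ω k = ω' k) :
    M.freeLevel x ω n = M.freeLevel x ω' n := by
  unfold freeLevel
  rw [Finset.sum_congr rfl fun k hk => ?_]
  rw [h k (Finset.mem_range.1 hk)]

lemma weight_congr (s x : ℝ) {ω ω' : ℕ → S × ℝ} {n : ℕ} (h : ∀ k < n, ω k = ω' k) :
    M.weight s x ω n = M.weight s x ω' n := by
  induction n with
  | zero => rfl
  | succ n ih =>
    simp only [weight]
    rw [freeLevel_congr x h, ih fun k hk => h k (hk.trans n.lt_succ_self), h n n.lt_succ_self]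

/-- Weight and value at a sojourn, split into the passage in this sojourn and the value of the
next one. -/
lemma weight_mul_sojournValue (s x : ℝ) (j : S) (g : ℝ → S → ℝ≥0∞) (ω : ℕ → S × ℝ) (n : ℕ) :
    M.weight s x ω n * M.sojournValue s j g (M.freeLevel x ω n) (ω n)
      = M.weight s x ω n * M.hitReward s j (M.freeLevel x ω n) (ω n)
        + M.weight s x ω (n + 1) *
          ∑ k, ENNReal.ofReal (M.jumpProb (ω n).1 k) * g (M.freeLevel x ω (n + 1)) k := by
  rw [sojournValue, mul_add, weight, freeLevel_succ]
  congr 1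
  split_ifs
  · rw [mul_assoc]
  · simp

variable [MeasurableSpace S] [MeasurableSingletonClass S]

lemma measurable_rate : Measurable fun p : S × ℝ => M.c p.1 :=
  (measurable_of_finite M.c).comp measurable_fst

lemma measurable_freeLevel (x : ℝ) (n : ℕ) : Measurable fun ω => M.freeLevel x ω n := by
  unfold freeLevel
  refine (Finset.measurable_fun_sum _ fun k _ => ?_).const_add _
  exact (measurable_rate.comp (measurable_pi_apply k)).mul
    (measurable_snd.comp (measurable_pi_apply k))

lemma measurable_weight (s x : ℝ) (n : ℕ) : Measurable fun ω => M.weight s x ω n := by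
  induction n with
  | zero => exact measurable_const
  | succ n ih =>
    simp only [weight]
    refine Measurable.ite (measurableSet_le measurable_const (measurable_freeLevel x _))
      (ih.mul ?_) measurable_const
    have : Measurable fun ω : ℕ → S × ℝ => (ω n).2 := measurable_snd.comp (measurable_pi_apply n)
    fun_prop

lemma measurable_hitReward (s : ℝ) (j : S) :
    Measurable fun q : ℝ × (S × ℝ) => M.hitReward s j q.1 q.2 := by
  have h1 : Measurable fun q : ℝ × (S × ℝ) => M.c q.2.1 := measurable_rate.comp measurable_snd
  have h2 : Measurable fun q : ℝ × (S × ℝ) => q.1 + M.c q.2.1 * q.2.2 :=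
    measurable_fst.add (h1.mul (measurable_snd.comp measurable_snd))
  have h3 : MeasurableSet {q : ℝ × (S × ℝ) | q.2.1 = j} :=
    (measurable_fst.comp measurable_snd) (measurableSet_singleton j)
  have h4 : Measurable fun q : ℝ × (S × ℝ) => q.1 / |M.c q.2.1| :=
    measurable_fst.div (continuous_abs.measurable.comp h1)
  unfold hitReward
  refine Measurable.ite ?_ (by fun_prop) measurable_const
  exact (measurableSet_lt h1 measurable_const).inter
    ((measurableSet_le h2 measurable_const).inter h3)

lemma measurable_sojournValue (s : ℝ) (j : S) {g : ℝ → S → ℝ≥0∞}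
    (hg : ∀ k, Measurable fun y => g y k) :
    Measurable fun q : ℝ × (S × ℝ) => M.sojournValue s j g q.1 q.2 := by
  have h1 : Measurable fun q : ℝ × (S × ℝ) => M.c q.2.1 := measurable_rate.comp measurable_snd
  have h2 : Measurable fun q : ℝ × (S × ℝ) => q.1 + M.c q.2.1 * q.2.2 :=
    measurable_fst.add (h1.mul (measurable_snd.comp measurable_snd))
  unfold sojournValue
  refine (measurable_hitReward s j).add (Measurable.ite (measurableSet_le measurable_const h2)
    (Measurable.mul (by fun_prop) (Finset.measurable_fun_sum _ fun k _ => ?_)) measurable_const)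
  refine Measurable.mul ?_ ((hg k).comp h2)
  exact (measurable_of_finite fun i => ENNReal.ofReal (M.jumpProb i k)).comp
    (measurable_fst.comp measurable_snd)

lemma measurable_sojournValue_right (s : ℝ) (j : S) {g : ℝ → S → ℝ≥0∞}
    (hg : ∀ k, Measurable fun y => g y k) (y : ℝ) : Measurable (M.sojournValue s j g y) :=
  (measurable_sojournValue s j hg).comp measurable_prodMk_left

variable [DecidableEq S]

/-- Averaging the value of a sojourn over its length gives the first-jump operator. -/
lemma lintegral_sojournValue (s : ℝ) (j : S) {g : ℝ → S → ℝ≥0∞}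
    (hg : ∀ k, Measurable fun y => g y k) {i : S} (hT : M.T i i < 0) {y : ℝ} (hy : 0 ≤ y) :
    ∫⁻ p, M.sojournValue s j g y p ∂(M.sojournLaw i) = M.stepOp s j g y i := by
  have hm2 : Measurable fun τ : ℝ => M.hitReward s j y (i, τ) :=
    (measurable_hitReward s j).comp
      (measurable_const.prodMk (measurable_const.prodMk measurable_id))
  have hm3 : Measurable fun τ : ℝ =>
      ENNReal.ofReal (M.holdRate i * Real.exp (-(M.holdRate i * τ))) * M.hitReward s j y (i, τ) :=
    Measurable.mul (by fun_prop) hm2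
  rw [lintegral_sojournLaw i (measurable_sojournValue_right s j hg y)]
  have hr := M.holdRate_pos i
  simp only [sojournValue, mul_add]
  rw [lintegral_add_left hm3, stepOp]
  congr 1
  · by_cases h : M.c i < 0 ∧ i = j
    · obtain ⟨hi, rfl⟩ := h
      simp only [hi, and_self, if_true]
      have h1 : ∀ τ, ENNReal.ofReal (M.holdRate i * Real.exp (-(M.holdRate i * τ)))
          * M.hitReward s i y (i, τ) = (Ici (y / |M.c i|)).indicator
          (fun τ => ENNReal.ofReal (M.holdRate i * Real.exp (-(M.holdRate i * τ)))
            * ENNReal.ofReal (Real.exp (-(s * (y / |M.c i|))))) τ := by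
        intro τ
        have h2 : y + M.c i * τ ≤ 0 ↔ y / |M.c i| ≤ τ := by
          rw [abs_of_neg hi, div_le_iff₀ (neg_pos.2 hi)]
          constructor <;> intro h <;> linarith
        simp only [hitReward, hi, true_and, and_true, h2, indicator_apply, mem_Ici]
        split_ifs <;> simp
      simp_rw [h1]
      rw [setLIntegral_indicator measurableSet_Ici]
      have h3 : (Ici (y / |M.c i|) ∩ Ioi 0 : Set ℝ) =ᵐ[volume] (Ioi (y / |M.c i|) : Set ℝ) := by
        have h4 : (Ioi (y / |M.c i|) : Set ℝ) =ᵐ[volume] (Ici (y / |M.c i|) : Set ℝ) :=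
          Ioi_ae_eq_Ici
        have h5 : (Ioi 0 : Set ℝ) =ᵐ[volume] (Ici 0 : Set ℝ) := Ioi_ae_eq_Ici
        have h6 : (Ici (y / |M.c i|) ∩ Ioi 0 : Set ℝ) =ᵐ[volume]
            (Ici (y / |M.c i|) ∩ Ici 0 : Set ℝ) := (Filter.EventuallyEq.rfl).inter h5
        rw [inter_eq_left.2 (Ici_subset_Ici.2 (by positivity))] at h6
        exact h6.trans h4.symm
      rw [setLIntegral_congr h3, lintegral_mul_const _ (by fun_prop), lintegral_exp_Ioi hr,
        ← ENNReal.ofReal_mul (Real.exp_nonneg _), ← Real.exp_add, holdRate_eq hT]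
      congr 2
      ring
    · rw [if_neg h]
      have h1 : ∀ τ, M.hitReward s j y (i, τ) = 0 := by
        intro τ
        rw [hitReward, if_neg]
        rintro ⟨h1, -, h2⟩
        exact h ⟨h1, h2⟩
      simp [h1]
  · have h1 : M.window i y = {τ | 0 ≤ y + M.c i * τ} ∩ Ioi 0 := by
      ext τ
      simp only [window, mem_ofPred_eq, mem_inter_iff, mem_Ioi]
      exact and_comm
    have h2 : Measurable fun τ : ℝ => y + M.c i * τ := by fun_prop
    rw [h1, ← setLIntegral_indicator (measurableSet_le measurable_const h2)]
    refine lintegral_congr fun τ => ?_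
    simp only [indicator_apply, mem_ofPred_eq]
    split_ifs
    · rw [jumpDensity, ENNReal.ofReal_mul hr.le]
      simp_rw [← ofReal_holdRate_mul_jumpProb hT, mul_assoc]
      rw [← Finset.mul_sum]
      have h4 : Real.exp (-((s - M.T i i) * τ))
          = Real.exp (-(M.holdRate i * τ)) * Real.exp (-(s * τ)) := by
        rw [← Real.exp_add, holdRate_eq hT]; congr 1; ring
      rw [h4, ENNReal.ofReal_mul (Real.exp_nonneg _)]
      ring
    · simp

/-- The expected discounts collected in the first sojourns, by the Markov property. -/
lemma lintegral_sum_hitReward (hT : ∀ i, M.T i i < 0) (s : ℝ) (j : S) {x : ℝ} (hx : 0 ≤ x) (i : S)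
    (n m : ℕ) :
    ∫⁻ ω, ((∑ k ∈ Finset.range n, M.weight s x ω k * M.hitReward s j (M.freeLevel x ω k) (ω k))
      + M.weight s x ω n * M.sojournValue s j (M.passageIter s j m) (M.freeLevel x ω n) (ω n))
        ∂(M.pathLaw i) = M.passageIter s j (n + m + 1) x i := by
  have hmv : ∀ m, Measurable fun q : ℝ × (S × ℝ) =>
      M.sojournValue s j (M.passageIter s j m) q.1 q.2 :=
    fun m => measurable_sojournValue s j (measurable_passageIter s j m)
  have hmr : ∀ k, Measurable fun ω : ℕ → S × ℝ =>
      M.weight s x ω k * M.hitReward s j (M.freeLevel x ω k) (ω k) := fun k =>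
    (measurable_weight s x k).mul ((measurable_hitReward s j).comp
      ((measurable_freeLevel x k).prodMk (measurable_pi_apply k)))
  induction n generalizing m with
  | zero =>
    simp only [Finset.range_zero, Finset.sum_empty, zero_add, weight, one_mul, freeLevel_zero]
    rw [lintegral_pathLaw_zero i
      (measurable_sojournValue_right s j (measurable_passageIter s j m) _),
      lintegral_sojournValue s j (measurable_passageIter s j m) (hT i) hx]
    rfl
  | succ n ih =>
    have h1 := ih (m + 1)
    simp_rw [weight_mul_sojournValue, ← add_assoc, ← Finset.sum_range_succ] at h1
    rw [show n + 1 + m + 1 = n + (m + 1) + 1 by ring, ← add_assoc, ← h1,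
      lintegral_add_left (Finset.measurable_fun_sum _ fun k _ => hmr k),
      lintegral_add_left (Finset.measurable_fun_sum _ fun k _ => hmr k)]
    congr 1
    rw [lintegral_pathLaw_succ i n (φ := fun ω p => M.weight s x ω (n + 1) *
      M.sojournValue s j (M.passageIter s j m) (M.freeLevel x ω (n + 1)) p)]
    · refine lintegral_congr fun ω => ?_
      rw [Finset.mul_sum]
      refine Finset.sum_congr rfl fun k _ => ?_
      by_cases h0 : 0 ≤ M.freeLevel x ω (n + 1)
      · rw [lintegral_const_mul _
          (measurable_sojournValue_right s j (measurable_passageIter s j m) _),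
          lintegral_sojournValue s j (measurable_passageIter s j m) (hT k) h0]
        rw [mul_left_comm]
        rfl
      · simp [weight_succ_eq_zero h0]
    · exact Measurable.mul ((measurable_weight (M := M) s x (n + 1)).comp measurable_fst)
        ((hmv m).comp (((measurable_freeLevel (M := M) x (n + 1)).comp measurable_fst).prodMk
          measurable_snd))
    · intro ω ω' h
      have h' : ∀ k < n + 1, ω k = ω' k := fun k hk => h k (Nat.lt_succ_iff.1 hk)
      simp_rw [weight_congr s x h', freeLevel_congr x h']

/-- The transform as an expectation over paths. -/
theorem passage_eq_lintegral (hT : ∀ i, M.T i i < 0) (s : ℝ) (j : S) {x : ℝ} (hx : 0 ≤ x) (i : S) :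
    M.passage s j x i
      = ∫⁻ ω, ∑' k, M.weight s x ω k * M.hitReward s j (M.freeLevel x ω k) (ω k)
        ∂(M.pathLaw i) := by
  have hmr : ∀ k, Measurable fun ω : ℕ → S × ℝ =>
      M.weight s x ω k * M.hitReward s j (M.freeLevel x ω k) (ω k) := fun k =>
    (measurable_weight s x k).mul ((measurable_hitReward s j).comp
      ((measurable_freeLevel x k).prodMk (measurable_pi_apply k)))
  simp_rw [ENNReal.tsum_eq_iSup_nat]
  rw [lintegral_iSup (fun n => Finset.measurable_fun_sum _ fun k _ => hmr k)]
  · rw [passage, ← (monotone_passageIter s j x i).iSup_nat_add 1]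
    have h : ∀ n, ∫⁻ ω, ∑ k ∈ Finset.range (n + 1),
        M.weight s x ω k * M.hitReward s j (M.freeLevel x ω k) (ω k) ∂(M.pathLaw i)
        = M.passageIter s j (n + 1) x i := by
      intro n
      have h := lintegral_sum_hitReward hT s j hx i n 0
      rw [add_zero] at h
      rw [← h]
      refine lintegral_congr fun ω => ?_
      rw [Finset.sum_range_succ, weight_mul_sojournValue]
      simp [passageIter]
    simp_rw [← h]
    refine Monotone.iSup_nat_add (f := fun n => ∫⁻ ω, ∑ k ∈ Finset.range n,
        M.weight s x ω k * M.hitReward s j (M.freeLevel x ω k) (ω k) ∂(M.pathLaw i)) ?_ 1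
    intro a b hab
    refine lintegral_mono fun ω => ?_
    exact Finset.sum_le_sum_of_subset (Finset.range_mono hab)
  · intro a b hab ω
    exact Finset.sum_le_sum_of_subset (Finset.range_mono hab)

end Functional

/-! ### Paths of the level and the identification of `Ψ` -/

section Paths

variable {S : Type*}

lemma strictMono_epoch {ω : ℕ → S × ℝ} (hτ : ∀ n, 0 < (ω n).2) : StrictMono (epoch ω) := by
  refine strictMono_nat_of_lt_succ fun n => ?_
  rw [epoch, epoch, Finset.sum_range_succ]
  linarith [hτ n]

lemma epoch_succ (ω : ℕ → S × ℝ) (n : ℕ) : epoch ω (n + 1) = epoch ω n + (ω n).2 := by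
  rw [epoch, epoch, Finset.sum_range_succ]

lemma epoch_nonneg {ω : ℕ → S × ℝ} (hτ : ∀ n, 0 < (ω n).2) (n : ℕ) : 0 ≤ epoch ω n :=
  Finset.sum_nonneg fun k _ => (hτ k).le

lemma sojournAt_eq {ω : ℕ → S × ℝ} (hτ : ∀ n, 0 < (ω n).2) {n : ℕ} {t : ℝ}
    (h1 : epoch ω n ≤ t) (h2 : t < epoch ω (n + 1)) : sojournAt ω t = n := by
  have hl : IsLeast {n | t < epoch ω (n + 1)} n := by
    refine ⟨h2, fun m hm => ?_⟩
    by_contra! hlt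
    have := (strictMono_epoch hτ).monotone (Nat.succ_le_of_lt hlt)
    have h3 : t < epoch ω (m + 1) := hm
    exact absurd (h3.trans_le (this.trans h1)) (lt_irrefl _)
  exact hl.csInf_eq

lemma exists_epoch_le_lt (ω : ℕ → S × ℝ) {t : ℝ} (ht : 0 ≤ t) {N : ℕ}
    (h : t < epoch ω N) : ∃ n < N, epoch ω n ≤ t ∧ t < epoch ω (n + 1) := by
  induction N with
  | zero => simp [epoch] at h; linarith
  | succ N ih =>
    by_cases h1 : t < epoch ω N
    · obtain ⟨n, hn, h2⟩ := ih h1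
      exact ⟨n, hn.trans N.lt_succ_self, h2⟩
    · exact ⟨N, N.lt_succ_self, not_lt.1 h1, h⟩

variable [Fintype S] {M : FluidModel S}

lemma levelAtEpoch_eq {x : ℝ} {ω : ℕ → S × ℝ} {n : ℕ} (h : ∀ k < n, 0 ≤ M.freeLevel x ω (k + 1)) :
    M.levelAtEpoch x ω n = M.freeLevel x ω n := by
  induction n with
  | zero => rw [levelAtEpoch, freeLevel_zero]
  | succ n ih =>
    rw [levelAtEpoch, ih fun k hk => h k (hk.trans n.lt_succ_self), ← freeLevel_succ]
    exact max_eq_right (h n n.lt_succ_self)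

lemma level_eq {x : ℝ} {ω : ℕ → S × ℝ} (hτ : ∀ n, 0 < (ω n).2) {n : ℕ}
    (h : ∀ k < n, 0 ≤ M.freeLevel x ω (k + 1)) {t : ℝ} (h1 : epoch ω n ≤ t)
    (h2 : t < epoch ω (n + 1)) :
    M.level x ω t = max 0 (M.freeLevel x ω n + M.c (ω n).1 * (t - epoch ω n)) := by
  rw [level, phase, sojournAt_eq hτ h1 h2, levelAtEpoch_eq h]

lemma freeLevel_nonneg {ω : ℕ → S × ℝ} {n : ℕ} (h : ∀ k < n, 0 < M.freeLevel 0 ω (k + 1)) :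
    0 ≤ M.freeLevel 0 ω n := by
  cases n with
  | zero => rw [freeLevel_zero]
  | succ n => exact (h n n.lt_succ_self).le

/-- Starting at level zero in an increasing phase, the level is positive as long as the free level
is. -/
lemma level_pos {ω : ℕ → S × ℝ} (h0 : 0 < M.c (ω 0).1) (hτ : ∀ n, 0 < (ω n).2) {N : ℕ}
    (h : ∀ k < N, 0 < M.freeLevel 0 ω (k + 1)) {t : ℝ} (ht : 0 < t) (htN : t < epoch ω N) :
    0 < M.level 0 ω t := by
  obtain ⟨n, hn, h1, h2⟩ := exists_epoch_le_lt ω ht.le htN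
  have hk : ∀ k < n, 0 < M.freeLevel 0 ω (k + 1) := fun k hk => h k (hk.trans hn)
  rw [level_eq hτ (fun k hk' => (hk k hk').le) h1 h2, lt_max_iff]
  right
  have hy := freeLevel_nonneg hk
  have hy1 := h n hn
  rw [freeLevel_succ] at hy1
  rw [epoch_succ] at h2
  rcases lt_or_ge (M.c (ω n).1) 0 with hc | hc
  · nlinarith
  · cases n with
    | zero =>
      simp only [freeLevel_zero, epoch, Finset.range_zero, Finset.sum_empty, sub_zero, zero_add]
      positivity
    | succ n =>
      have := hk n n.lt_succ_self
      have h3 : 0 ≤ t - epoch ω (n + 1) := sub_nonneg.2 h1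
      positivity

lemma weight_eq {s : ℝ} {ω : ℕ → S × ℝ} {n : ℕ}
    (h : ∀ k < n, 0 ≤ M.freeLevel 0 ω (k + 1)) :
    M.weight s 0 ω n = ENNReal.ofReal (Real.exp (-(s * epoch ω n))) := by
  induction n with
  | zero => simp [weight, epoch]
  | succ n ih =>
    rw [weight, if_pos (h n n.lt_succ_self), ih fun k hk => h k (hk.trans n.lt_succ_self),
      ← ENNReal.ofReal_mul (Real.exp_nonneg _), ← Real.exp_add, epoch_succ]
    congr 2
    ring

lemma weight_eq_zero {s x : ℝ} {ω : ℕ → S × ℝ} {N : ℕ} (h : M.freeLevel x ω (N + 1) < 0) {k : ℕ}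
    (hk : N < k) : M.weight s x ω k = 0 := by
  induction k, hk using Nat.le_induction with
  | base => exact weight_succ_eq_zero h.not_ge
  | succ k _ ih => rw [weight, ih]; simp

lemma freeLevel_pos_of_no_hit {ω : ℕ → S × ℝ} (h0 : 0 < M.c (ω 0).1) (hτ : ∀ n, 0 < (ω n).2)
    {n : ℕ} (h : ∀ k ≤ n, ¬ (M.c (ω k).1 < 0 ∧ M.freeLevel 0 ω (k + 1) ≤ 0)) :
    0 < M.freeLevel 0 ω (n + 1) := by
  induction n with
  | zero =>
    rw [freeLevel_succ, freeLevel_zero, zero_add]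
    exact mul_pos h0 (hτ 0)
  | succ n ih =>
    have h1 := ih fun k hk => h k (hk.trans n.le_succ)
    by_contra! h2
    refine h (n + 1) le_rfl ⟨?_, h2⟩
    by_contra! hc
    rw [freeLevel_succ] at h2
    have := mul_nonneg hc (hτ (n + 1)).le
    linarith

open Classical in
/-- Along a path that starts at level zero in an increasing phase, has positive holding times and
does not reach level zero at a jump, the discount at the passage time is collected in the sojourn
in which the level first goes below zero. If the jump times are bounded and there is no such
sojourn, the level does not return to zero, by the convention `sInf ∅ = 0` in `sojournAt`. -/
lemma discount_eq_tsum (s : ℝ) (j : S) {ω : ℕ → S × ℝ} (h0 : 0 < M.c (ω 0).1)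
    (hτ : ∀ n, 0 < (ω n).2) (hne : ∀ n, M.c (ω n).1 ≠ 0 → M.freeLevel 0 ω (n + 1) ≠ 0) :
    (if M.HitsZero 0 ω ∧ phase ω (M.theta 0 ω) = j
      then ENNReal.ofReal (Real.exp (-s * M.theta 0 ω)) else 0)
      = ∑' k, M.weight s 0 ω k * M.hitReward s j (M.freeLevel 0 ω k) (ω k) := by
  by_cases hex : ∃ n, M.c (ω n).1 < 0 ∧ M.freeLevel 0 ω (n + 1) ≤ 0
  · classical
    -- the passage happens in the first such sojourn `N`, at the time `θ` found by linear descent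
    obtain ⟨hcN, hyN⟩ := Nat.find_spec hex
    have hmin := fun k (hk : k < Nat.find hex) => Nat.find_min hex hk
    set N := Nat.find hex
    have hpos : ∀ k < N, 0 < M.freeLevel 0 ω (k + 1) := fun k hk =>
      freeLevel_pos_of_no_hit h0 hτ fun m hm => hmin m (hm.trans_lt hk)
    have hyN' : M.freeLevel 0 ω (N + 1) < 0 := lt_of_le_of_ne hyN (hne N hcN.ne)
    have hNpos : 0 < M.freeLevel 0 ω N := by
      rcases Nat.eq_zero_or_pos N with h | h
      · rw [h] at hcN; exact absurd h0 (not_lt.2 hcN.le)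
      · have := hpos (N - 1) (by omega)
        rwa [Nat.sub_add_cancel h] at this
    set y := M.freeLevel 0 ω N with hy
    have hyc : 0 < y / |M.c (ω N).1| := by
      have : M.c (ω N).1 ≠ 0 := hcN.ne
      positivity
    have hcanc : M.c (ω N).1 * (y / |M.c (ω N).1|) = -y := by
      rw [abs_of_neg hcN]
      have := hcN.ne
      field_simp
    set θ := epoch ω N + y / |M.c (ω N).1| with hθ
    have hθpos : 0 < θ := add_pos_of_nonneg_of_pos (epoch_nonneg hτ N) hyc
    have hθlt : θ < epoch ω (N + 1) := by
      rw [epoch_succ, hθ]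
      rw [freeLevel_succ, ← hy] at hyN'
      gcongr
      rw [div_lt_iff₀ (abs_pos.2 hcN.ne), abs_of_neg hcN]
      linarith
    have hlev : ∀ t, epoch ω N ≤ t → t < epoch ω (N + 1) →
        M.level 0 ω t = max 0 (y + M.c (ω N).1 * (t - epoch ω N)) := fun t h1 h2 =>
      level_eq hτ (fun k hk => (hpos k hk).le) h1 h2
    have hleast : IsLeast {t | 0 < t ∧ M.level 0 ω t = 0} θ := by
      refine ⟨⟨hθpos, ?_⟩, ?_⟩
      · rw [hlev θ (by linarith) hθlt, hθ, add_sub_cancel_left, hcanc]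
        simp
      · rintro t ⟨ht, hlt⟩
        by_contra! htθ
        rcases lt_or_ge t (epoch ω N) with h | h
        · exact (level_pos h0 hτ hpos ht h).ne' hlt
        · rw [hlev t h (htθ.trans hθlt)] at hlt
          have h1 : M.c (ω N).1 * (y / |M.c (ω N).1|) < M.c (ω N).1 * (t - epoch ω N) :=
            mul_lt_mul_of_neg_left (by linarith) hcN
          have h2 := max_eq_left_iff.1 hlt
          linarith
    have htheta : M.theta 0 ω = θ := hleast.csInf_eq
    have hhit : M.HitsZero 0 ω := ⟨θ, hleast.1⟩
    have hphase : phase ω θ = (ω N).1 := by rw [phase, sojournAt_eq hτ (by linarith) hθlt]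
    rw [tsum_eq_single N, htheta, hphase, weight_eq fun k hk => (hpos k hk).le, hitReward,
      ← freeLevel_succ]
    · simp only [hhit, true_and, hcN, hyN]
      split_ifs
      · rw [← ENNReal.ofReal_mul (Real.exp_nonneg _), ← Real.exp_add]
        congr 2
        rw [hθ]
        ring
      · simp
    · intro k hk
      rcases lt_or_gt_of_ne hk with h | h
      · rw [hitReward, if_neg, mul_zero]
        rintro ⟨-, h2, -⟩
        rw [← freeLevel_succ] at h2
        exact absurd (hpos k h) (not_lt.2 h2)
      · rw [weight_eq_zero hyN' h, zero_mul]
  · push Not at hex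
    have hpos : ∀ n, 0 < M.freeLevel 0 ω (n + 1) := fun n =>
      freeLevel_pos_of_no_hit h0 hτ fun k _ h => absurd (hex k h.1) (not_lt.2 h.2)
    rw [if_neg, eq_comm, ENNReal.tsum_eq_zero]
    · intro k
      rw [hitReward, if_neg, mul_zero]
      rintro ⟨h1, h2, -⟩
      rw [← freeLevel_succ] at h2
      exact absurd (hex k h1) (not_lt.2 h2)
    · rintro ⟨⟨t, ht, hlt⟩, -⟩
      by_cases hex2 : ∃ n, t < epoch ω n
      · obtain ⟨n, hn⟩ := hex2
        exact (level_pos h0 hτ (fun k _ => hpos k) ht hn).ne' hlt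
      · push Not at hex2
        -- past the accumulation point of the jump times, the index `sInf ∅ = 0` means that the
        -- level goes on rising from zero at the rate of the first phase
        have h1 : sojournAt ω t = 0 := by
          have : {n | t < epoch ω (n + 1)} = ∅ := by
            ext n
            simp [hex2 (n + 1)]
          rw [sojournAt, this, Nat.sInf_empty]
        rw [level, phase, h1] at hlt
        simp only [levelAtEpoch, epoch, Finset.range_zero, Finset.sum_empty, sub_zero,
          zero_add] at hlt
        have h2 := max_eq_left_iff.1 hlt
        have := mul_pos h0 ht
        linarith

variable [MeasurableSpace S] [MeasurableSingletonClass S]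

/-- An event about a sojourn, given the preceding ones, is almost sure along the whole path if it is
almost sure under each law of a sojourn. -/
lemma ae_pathLaw_succ (i : S) (n : ℕ) {R : Set ((ℕ → S × ℝ) × (S × ℝ))} (hR : MeasurableSet R)
    (hdep : ∀ ω ω' : ℕ → S × ℝ, (∀ k ≤ n, ω k = ω' k) → ∀ p, (ω, p) ∈ R ↔ (ω', p) ∈ R)
    (h : ∀ ω k, ∀ᵐ p ∂(M.sojournLaw k), (ω, p) ∈ R) :
    ∀ᵐ ω ∂(M.pathLaw i), (ω, ω (n + 1)) ∈ R := by
  have hm : Measurable (Rᶜ.indicator (1 : ((ℕ → S × ℝ) × (S × ℝ)) → ℝ≥0∞)) :=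
    measurable_one.indicator hR.compl
  have h1 := lintegral_pathLaw_succ (M := M) i n
    (φ := fun ω p => Rᶜ.indicator (1 : ((ℕ → S × ℝ) × (S × ℝ)) → ℝ≥0∞) (ω, p)) hm
    (by
      intro ω ω' hω
      ext p
      by_cases hp : (ω, p) ∈ R
      · simp [hp, (hdep ω ω' hω p).1 hp]
      · simp [hp, mt (hdep ω ω' hω p).2 hp])
  have h2 : ∀ ω k, ∫⁻ p, Rᶜ.indicator (1 : ((ℕ → S × ℝ) × (S × ℝ)) → ℝ≥0∞) (ω, p)
      ∂(M.sojournLaw k) = 0 := by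
    intro ω k
    have hm' : Measurable fun p => Rᶜ.indicator (1 : ((ℕ → S × ℝ) × (S × ℝ)) → ℝ≥0∞) (ω, p) :=
      hm.comp measurable_prodMk_left
    rw [lintegral_eq_zero_iff hm']
    filter_upwards [h ω k] with p hp
    simp [hp]
  simp_rw [h2, mul_zero, Finset.sum_const_zero, lintegral_zero] at h1
  have hm2 : Measurable fun ω : ℕ → S × ℝ =>
      Rᶜ.indicator (1 : ((ℕ → S × ℝ) × (S × ℝ)) → ℝ≥0∞) (ω, ω (n + 1)) :=
    hm.comp (measurable_id.prodMk (measurable_pi_apply _))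
  rw [lintegral_eq_zero_iff hm2] at h1
  filter_upwards [h1] with ω hω
  by_contra hcon
  simp [hcon] at hω

lemma ae_pathLaw_zero (i : S) {R : Set (S × ℝ)} (hR : MeasurableSet R)
    (h : ∀ᵐ p ∂(M.sojournLaw i), p ∈ R) : ∀ᵐ ω ∂(M.pathLaw i), ω 0 ∈ R := by
  have hm : Measurable (Rᶜ.indicator (1 : S × ℝ → ℝ≥0∞)) := measurable_one.indicator hR.compl
  have h1 := lintegral_pathLaw_zero (M := M) i hm
  have h2 : ∫⁻ p, Rᶜ.indicator (1 : S × ℝ → ℝ≥0∞) p ∂(M.sojournLaw i) = 0 := by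
    rw [lintegral_eq_zero_iff hm]
    filter_upwards [h] with p hp
    simp [hp]
  have hm2 : Measurable fun ω : ℕ → S × ℝ => Rᶜ.indicator (1 : S × ℝ → ℝ≥0∞) (ω 0) :=
    hm.comp (measurable_pi_apply _)
  rw [h2, lintegral_eq_zero_iff hm2] at h1
  filter_upwards [h1] with ω hω
  by_contra hcon
  simp [hcon] at hω

/-- Almost surely the path starts in its initial phase, the holding times are positive, and the
level is not zero at the end of a sojourn in which it varies. -/
lemma ae_pathLaw (i : S) : ∀ᵐ ω ∂(M.pathLaw i), (ω 0).1 = i ∧ (∀ n, 0 < (ω n).2) ∧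
    ∀ n, M.c (ω n).1 ≠ 0 → M.freeLevel 0 ω (n + 1) ≠ 0 := by
  have hc : Measurable fun q : ℝ × (S × ℝ) => M.c q.2.1 := measurable_rate.comp measurable_snd
  have hR : MeasurableSet {q : ℝ × (S × ℝ) | 0 < q.2.2 ∧
      (M.c q.2.1 ≠ 0 → q.1 + M.c q.2.1 * q.2.2 ≠ 0)} := by
    have h2 : Measurable fun q : ℝ × (S × ℝ) => q.1 + M.c q.2.1 * q.2.2 :=
      measurable_fst.add (hc.mul (measurable_snd.comp measurable_snd))
    have h3 : MeasurableSet {q : ℝ × (S × ℝ) | M.c q.2.1 = 0} := hc (measurableSet_singleton 0)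
    have h4 : MeasurableSet {q : ℝ × (S × ℝ) | q.1 + M.c q.2.1 * q.2.2 = 0} :=
      h2 (measurableSet_singleton 0)
    have h6 : MeasurableSet {q : ℝ × (S × ℝ) | 0 < q.2.2} :=
      measurableSet_lt measurable_const (measurable_snd.comp measurable_snd)
    have h7 : {q : ℝ × (S × ℝ) | M.c q.2.1 ≠ 0 → q.1 + M.c q.2.1 * q.2.2 ≠ 0}
        = {q : ℝ × (S × ℝ) | M.c q.2.1 = 0} ∪
          {q : ℝ × (S × ℝ) | q.1 + M.c q.2.1 * q.2.2 = 0}ᶜ := by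
      ext p
      simp only [mem_ofPred_eq, mem_union, mem_compl_iff]
      tauto
    have h8 := h3.union h4.compl
    rw [← h7] at h8
    exact h6.inter h8
  have hfirst : ∀ᵐ ω ∂(M.pathLaw i), (ω 0).1 = i ∧ 0 < (ω 0).2 ∧
      (M.c (ω 0).1 ≠ 0 → 0 + M.c (ω 0).1 * (ω 0).2 ≠ 0) := by
    have h1 : MeasurableSet {p : S × ℝ | p.1 = i ∧ 0 < p.2 ∧
        (M.c p.1 ≠ 0 → 0 + M.c p.1 * p.2 ≠ 0)} :=
      (measurable_fst (measurableSet_singleton i)).inter (measurable_prodMk_left hR)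
    exact ae_pathLaw_zero i h1 (ae_sojournLaw i 0)
  have hnext : ∀ n, ∀ᵐ ω ∂(M.pathLaw i), 0 < (ω (n + 1)).2 ∧
      (M.c (ω (n + 1)).1 ≠ 0 → M.freeLevel 0 ω (n + 1) +
        M.c (ω (n + 1)).1 * (ω (n + 1)).2 ≠ 0) := by
    intro n
    refine ae_pathLaw_succ i n (R := {q : (ℕ → S × ℝ) × (S × ℝ) | 0 < q.2.2 ∧
      (M.c q.2.1 ≠ 0 → M.freeLevel 0 q.1 (n + 1) + M.c q.2.1 * q.2.2 ≠ 0)}) ?_ ?_ ?_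
    · exact (((measurable_freeLevel 0 (n + 1)).comp measurable_fst).prodMk measurable_snd) hR
    · intro ω ω' h p
      simp only [mem_ofPred_eq]
      rw [freeLevel_congr 0 fun k hk => h k (Nat.lt_succ_iff.1 hk)]
    · intro ω k
      filter_upwards [ae_sojournLaw k (M.freeLevel 0 ω (n + 1))] with p hp
      exact hp.2
  filter_upwards [hfirst, ae_all_iff.2 hnext] with ω h1 h2
  refine ⟨h1.1, fun n => ?_, fun n hn => ?_⟩
  · cases n with
    | zero => exact h1.2.1
    | succ n => exact (h2 n).1
  · rw [freeLevel_succ]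
    cases n with
    | zero => rw [freeLevel_zero]; exact h1.2.2 hn
    | succ n => exact (h2 n).2 hn

/-- `Ψ(s)` is given by the least fixed point of the first-jump operator. -/
theorem Psi_eq_passage [DecidableEq S] (hT : ∀ i, M.T i i < 0) (s : ℝ) (i : M.Up) (j : M.Down) :
    M.Psi s i j = M.passage s j.1 0 i.1 := by
  rw [passage_eq_lintegral hT s j.1 le_rfl i.1, Psi]
  refine lintegral_congr_ae ?_
  filter_upwards [ae_pathLaw (M := M) i.1] with ω ⟨h0, hτ, hne⟩
  exact discount_eq_tsum s j.1 (by rw [h0]; exact i.2) hτ hne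

end Paths

open Filter Topology

/-! ### Supersolutions of the passage problem -/

section Riccati

variable {S : Type*} [Fintype S] [DecidableEq S] {M : FluidModel S}

lemma toReal_offRate (i k : S) : (M.offRate i k).toReal = if i = k then 0 else M.T i k := by
  unfold offRate
  split_ifs with h
  · simp
  · exact ENNReal.toReal_ofReal (M.offDiag_nonneg i k h)

lemma sum_offRate_mul (i : S) (x : S → ℝ) :
    ∑ k, (M.offRate i k).toReal * x k = ∑ k, M.T i k * x k - M.T i i * x i := by
  rw [eq_sub_iff_add_eq, ← Finset.add_sum_erase _ _ (Finset.mem_univ i),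
    ← Finset.add_sum_erase Finset.univ (fun k => M.T i k * x k) (Finset.mem_univ i)]
  have h : ∑ k ∈ Finset.univ.erase i, (M.offRate i k).toReal * x k
      = ∑ k ∈ Finset.univ.erase i, M.T i k * x k := by
    refine Finset.sum_congr rfl fun k hk => ?_
    rw [toReal_offRate, if_neg (Finset.ne_of_mem_erase hk).symm]
  rw [h, toReal_offRate]
  simp

/-- The real form of `jumpDensity`. -/
def jumpDensityReal (M : FluidModel S) (s : ℝ) (f : ℝ → S → ℝ) (i : S) (y τ : ℝ) : ℝ :=
  Real.exp (-((s - M.T i i) * τ)) * ∑ k, (M.offRate i k).toReal * f (y + M.c i * τ) k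

lemma jumpDensity_eq_ofReal (s : ℝ) {f : ℝ → S → ℝ} {i : S} {y τ : ℝ}
    (h : ∀ k, 0 ≤ f (y + M.c i * τ) k) :
    M.jumpDensity s (fun y k => ENNReal.ofReal (f y k)) i y τ
      = ENNReal.ofReal (M.jumpDensityReal s f i y τ) := by
  rw [jumpDensity, jumpDensityReal, ENNReal.ofReal_mul (Real.exp_nonneg _),
    ENNReal.ofReal_sum_of_nonneg fun k _ => mul_nonneg ENNReal.toReal_nonneg (h k)]
  congr 2
  ext k
  rw [ENNReal.ofReal_mul ENNReal.toReal_nonneg, ENNReal.ofReal_toReal (offRate_ne_top i k)]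

lemma add_mul_nonneg_of_le {y c t τ : ℝ} (hy : 0 ≤ y) (hyt : 0 ≤ y + c * t) (h0 : 0 ≤ τ)
    (h1 : τ ≤ t) : 0 ≤ y + c * τ := by
  rcases le_total 0 c with hc | hc
  · positivity
  · nlinarith

/-- A function that decreases along the flow, discounted at rate `s`, dominates the transform of the
passage time. -/
theorem passage_le_of_supersolution {s : ℝ} {j : S} {f f' : ℝ → S → ℝ}
    (hf : ∀ y i, HasDerivAt (fun y => f y i) (f' y i) y) (hnn : ∀ y, 0 ≤ y → ∀ i, 0 ≤ f y i)
    (hle : ∀ y, 0 ≤ y → ∀ i, M.c i * f' y i + ∑ k, M.T i k * f y k - s * f y i ≤ 0)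
    (hj : 1 ≤ f 0 j) {y : ℝ} (hy : 0 ≤ y) (i : S) :
    M.passage s j y i ≤ ENNReal.ofReal (f y i) := by
  have hcont : ∀ i, Continuous fun y => f y i := fun i =>
    continuous_iff_continuousAt.2 fun y => (hf y i).continuousAt
  have hjc : ∀ i y, Continuous (M.jumpDensityReal s f i y) := by
    intro i y
    unfold jumpDensityReal
    refine Continuous.mul (by fun_prop) (continuous_finsetSum _ fun k _ => ?_)
    have h1 : Continuous fun τ => y + M.c i * τ := by fun_prop
    exact continuous_const.mul ((hcont k).comp h1)
  -- `f`, discounted along the flow of phase `i`, decreases at least as fast as jumps collect value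
  have hint : ∀ i y t, 0 ≤ y → 0 ≤ t → 0 ≤ y + M.c i * t →
      (∫⁻ τ in Ioc 0 t, M.jumpDensity s (fun y k => ENNReal.ofReal (f y k)) i y τ)
        + ENNReal.ofReal (Real.exp (-((s - M.T i i) * t)) * f (y + M.c i * t) i)
        ≤ ENNReal.ofReal (f y i) := by
    intro i y t hy ht hyt
    have hpos : ∀ τ ∈ Ioc 0 t, 0 ≤ y + M.c i * τ := fun τ hτ =>
      add_mul_nonneg_of_le hy hyt hτ.1.le hτ.2
    rw [setLIntegral_congr_fun measurableSet_Ioc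
      fun τ hτ => jumpDensity_eq_ofReal s fun k => hnn _ (hpos τ hτ) k]
    have hI : IntegrableOn (M.jumpDensityReal s f i y) (Icc 0 t) :=
      (hjc i y).continuousOn.integrableOn_Icc
    have hI0 : ∀ τ ∈ Ioc 0 t, 0 ≤ M.jumpDensityReal s f i y τ := fun τ hτ =>
      mul_nonneg (Real.exp_nonneg _) (Finset.sum_nonneg fun k _ =>
        mul_nonneg ENNReal.toReal_nonneg (hnn _ (hpos τ hτ) k))
    rw [← ofReal_integral_eq_lintegral_ofReal (hI.mono_set Ioc_subset_Icc_self)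
      ((ae_restrict_iff' measurableSet_Ioc).2 (ae_of_all _ hI0)),
      ← ENNReal.ofReal_add (setIntegral_nonneg measurableSet_Ioc hI0)
        (mul_nonneg (Real.exp_nonneg _) (hnn _ hyt i))]
    apply ENNReal.ofReal_le_ofReal
    rw [← intervalIntegral.integral_of_le ht]
    have hd : ∀ τ, HasDerivAt
        (fun τ => -(Real.exp (-((s - M.T i i) * τ)) * f (y + M.c i * τ) i))
        (-(Real.exp (-((s - M.T i i) * τ)) * (-(s - M.T i i)) * f (y + M.c i * τ) i
          + Real.exp (-((s - M.T i i) * τ)) * (f' (y + M.c i * τ) i * M.c i))) τ := by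
      intro τ
      have h1 : HasDerivAt (fun τ : ℝ => -((s - M.T i i) * τ)) (-(s - M.T i i)) τ := by
        simpa using ((hasDerivAt_id' τ).const_mul (s - M.T i i)).fun_neg
      have h2 : HasDerivAt (fun τ : ℝ => y + M.c i * τ) (M.c i) τ := by
        simpa using ((hasDerivAt_id' τ).const_mul (M.c i)).const_add y
      exact (h1.exp.mul ((hf (y + M.c i * τ) i).comp τ h2)).neg
    have h3 := intervalIntegral.integral_le_sub_of_hasDeriv_right_of_le
      (φ := M.jumpDensityReal s f i y) ht
      (fun τ _ => (hd τ).continuousAt.continuousWithinAt)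
      (fun τ _ => (hd τ).hasDerivWithinAt) hI
      (by
        intro τ hτ
        have h4 := hle _ (hpos τ ⟨hτ.1, hτ.2.le⟩) i
        have h5 := sum_offRate_mul (M := M) i (f (y + M.c i * τ))
        have h6 := Real.exp_pos (-((s - M.T i i) * τ))
        rw [jumpDensityReal, h5]
        nlinarith)
    simp only [mul_zero, neg_zero, Real.exp_zero, one_mul, add_zero] at h3
    linarith
  refine passage_le_of_stepOp_le (g := fun y i => ENNReal.ofReal (f y i)) (fun y hy i => ?_) hy i
  unfold stepOp
  rcases lt_or_ge (M.c i) 0 with hc | hc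
  · have h0 : y + M.c i * (y / |M.c i|) = 0 := by
      have := hc.ne
      rw [abs_of_neg hc]
      field_simp
      ring
    have h1 := hint i y (y / |M.c i|) hy (by positivity) h0.ge
    rw [h0] at h1
    rw [window_of_neg hc, add_comm]
    refine le_trans ?_ h1
    gcongr 1
    split_ifs with hij
    · rw [hij.2]
      exact ENNReal.ofReal_le_ofReal (le_mul_of_one_le_right (Real.exp_nonneg _) hj)
    · exact zero_le
  · rw [if_neg fun h => absurd h.1 (not_lt.2 hc), zero_add, window_of_nonneg hc hy]
    have hU : Ioi (0 : ℝ) = ⋃ n : ℕ, Ioc 0 (n : ℝ) := by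
      ext τ
      simp only [mem_Ioi, mem_iUnion, mem_Ioc]
      constructor
      · intro h
        obtain ⟨n, hn⟩ := exists_nat_ge τ
        exact ⟨n, h, hn⟩
      · rintro ⟨n, h, -⟩
        exact h
    rw [hU, setLIntegral_iUnion_of_directed]
    · exact iSup_le fun n =>
        le_self_add.trans (hint i y n hy (by positivity) (by positivity))
    · exact Monotone.directed_le fun m n hmn => Ioc_subset_Ioc_right (by exact_mod_cast hmn)

end Riccati

/-! ### The Riccati equation of the passage transform -/

section RiccatiEquation

variable {S : Type*} [Fintype S] [DecidableEq S] {M : FluidModel S}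

/-- The generator, with discount rate `s`, of the phase process observed at the records of a
descending level, when `X i j` is the weight with which phase `i` is followed by the decreasing
phase `j` once the level is back where phase `i` began. For the transform it is the matrix
`D(s)`. -/
def downGen (M : FluidModel S) (s : ℝ) (X : S → M.Down → ℝ) (b j : M.Down) : ℝ :=
  (∑ k, M.T b k * X k j - s * X b j) / |M.c b|

/-- The Riccati expression. Its row `i` gives a Riccati equation for the increasing phases, a linear
equation for the flat phases, and vanishes for the decreasing phases if `X` is the identity
there. -/
def riccati (M : FluidModel S) (s : ℝ) (X : S → M.Down → ℝ) (i : S) (j : M.Down) : ℝ :=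
  M.c i * ∑ b, X i b * M.downGen s X b j + ∑ k, M.T i k * X k j - s * X i j

/-- The transform of the passage time from level zero, as a real matrix. -/
def hitMatrix (M : FluidModel S) (s : ℝ) (i : S) (j : M.Down) : ℝ := (M.passage s j 0 i).toReal

lemma hitMatrix_nonneg (s : ℝ) (i : S) (j : M.Down) : 0 ≤ M.hitMatrix s i j :=
  ENNReal.toReal_nonneg

lemma hitMatrix_of_neg (s : ℝ) {i : S} (hi : M.c i < 0) (j : M.Down) :
    M.hitMatrix s i j = if i = j.1 then 1 else 0 := by
  rw [hitMatrix, passage_zero_of_neg hi]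
  split_ifs <;> simp

lemma sum_offRate_mul_hitMatrix_sub (s : ℝ) (i : S) (j : M.Down) :
    ∑ k, (M.offRate i k).toReal * M.hitMatrix s k j - (s - M.T i i) * M.hitMatrix s i j
      = ∑ k, M.T i k * M.hitMatrix s k j - s * M.hitMatrix s i j := by
  rw [sum_offRate_mul i fun k => M.hitMatrix s k j]
  ring

lemma riccati_of_neg {s : ℝ} {X : S → M.Down → ℝ}
    (hX : ∀ b j : M.Down, X b j = if b = j then 1 else 0)
    {i : S} (hi : M.c i < 0) (j : M.Down) : M.riccati s X i j = 0 := by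
  have h1 : ∑ b, X i b * M.downGen s X b j = M.downGen s X ⟨i, hi⟩ j := by
    rw [Finset.sum_eq_single ⟨i, hi⟩]
    · rw [show X i ⟨i, hi⟩ = 1 by simpa using hX ⟨i, hi⟩ ⟨i, hi⟩, one_mul]
    · intro b _ hb
      rw [show X i b = 0 by simpa [hb.symm] using hX ⟨i, hi⟩ b, zero_mul]
    · simp
  rw [riccati, h1, downGen, abs_of_neg hi]
  have := hi.ne
  field_simp
  ring

/-- The transform is finite for all levels, phases and targets. -/
def AllFinite (M : FluidModel S) (s : ℝ) : Prop :=
  ∀ (j : M.Down) (i : S) (y : ℝ), 0 ≤ y → M.passage s j y i ≠ ∞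

section

variable {s : ℝ} (hfin : M.AllFinite s)
include hfin

lemma toReal_passage_add (j : M.Down) (i : S) {x y : ℝ} (hx : 0 ≤ x) (hy : 0 ≤ y) :
    (M.passage s j (x + y) i).toReal
      = ∑ b : M.Down, (M.passage s b x i).toReal * (M.passage s j y b).toReal := by
  rw [passage_add s j.1 i hx hy, ENNReal.toReal_sum]
  · simp_rw [ENNReal.toReal_mul]
  · intro b _
    exact ENNReal.mul_ne_top (hfin b i x hx) (hfin j b y hy)

lemma toReal_passage_eq (j : M.Down) (i : S) {y : ℝ} (hy : 0 ≤ y) :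
    (M.passage s j y i).toReal
      = ∑ b : M.Down, M.hitMatrix s i b * (M.passage s j y b).toReal := by
  have h := toReal_passage_add hfin j i le_rfl hy
  rwa [zero_add] at h

lemma toReal_jumpDensity (j : M.Down) {i : S} {y τ : ℝ} (h : 0 ≤ y + M.c i * τ) :
    (M.jumpDensity s (M.passage s j) i y τ).toReal
      = M.jumpDensityReal s (fun y k => (M.passage s j y k).toReal) i y τ := by
  have h1 := jumpDensity_eq_ofReal (M := M) s (f := fun y k => (M.passage s j y k).toReal)
    (i := i) (y := y) (τ := τ) (fun k => ENNReal.toReal_nonneg)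
  have h2 : M.jumpDensity s (M.passage s j) i y τ = M.jumpDensity s
      (fun y k => ENNReal.ofReal ((M.passage s j y k).toReal)) i y τ := by
    unfold jumpDensity
    congr 2
    ext k
    simp only [ENNReal.ofReal_toReal (hfin j k _ h)]
  rw [h2, h1, ENNReal.toReal_ofReal]
  exact mul_nonneg (Real.exp_nonneg _) (Finset.sum_nonneg fun k _ =>
    mul_nonneg ENNReal.toReal_nonneg ENNReal.toReal_nonneg)

/-- The real form of `passage_flow`. -/
lemma toReal_passage_flow (j : M.Down) (i : S) {y t : ℝ} (ht : 0 ≤ t) (hy : 0 ≤ y)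
    (hyt : 0 ≤ y + M.c i * t) :
    (M.passage s j y i).toReal
      = (∫ τ in (0 : ℝ)..t, M.jumpDensityReal s (fun y k => (M.passage s j y k).toReal) i y τ)
        + Real.exp (-((s - M.T i i) * t)) * (M.passage s j (y + M.c i * t) i).toReal := by
  have h1 : ∫⁻ τ in Ioc 0 t, M.jumpDensity s (M.passage s j) i y τ ≠ ∞ :=
    ne_top_of_le_ne_top (hfin j i y hy) (setLIntegral_le_passage s j.1 i ht hy hyt)
  have hm := measurable_jumpDensity_right (M := M) (s := s) (measurable_passage (M := M) s j.1) i y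
  rw [passage_flow s j.1 i ht hy hyt, ENNReal.toReal_add h1
    (ENNReal.mul_ne_top ENNReal.ofReal_ne_top (hfin j i _ hyt)), ENNReal.toReal_mul,
    ENNReal.toReal_ofReal (Real.exp_nonneg _)]
  congr 1
  rw [intervalIntegral.integral_of_le ht, ← integral_toReal hm.aemeasurable
    (ae_lt_top' hm.aemeasurable h1)]
  refine setIntegral_congr_fun measurableSet_Ioc fun τ hτ => ?_
  exact toReal_jumpDensity hfin j (add_mul_nonneg_of_le hy hyt hτ.1.le hτ.2)

/-- Near level zero the transform is bounded: a descent by `y ≤ 1` that ends in phase `j`, continued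
by an uninterrupted descent in that phase, is one way to descend by one. -/
lemma exists_toReal_passage_le (j : M.Down) (k : S) :
    ∃ C, ∀ y ∈ Icc (0 : ℝ) 1, (M.passage s j y k).toReal ≤ C := by
  have hj : 0 < |M.c j| := abs_pos.2 j.2.ne
  refine ⟨(M.passage s j 1 k).toReal * Real.exp (|s - M.T j j| / |M.c j|), fun y hy => ?_⟩
  have h1 := passage_mul_le s j j k hy.1 (sub_nonneg.2 hy.2)
  rw [add_sub_cancel] at h1
  have h2 := ENNReal.toReal_mono (hfin j k 1 zero_le_one) h1
  rw [ENNReal.toReal_mul] at h2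
  have h3 := ENNReal.toReal_mono (hfin j j (1 - y) (sub_nonneg.2 hy.2))
    (exp_le_passage s j.2 (1 - y))
  rw [ENNReal.toReal_ofReal (Real.exp_nonneg _)] at h3
  have h4 : -(|s - M.T j j| / |M.c j|) ≤ -((s - M.T j j) * ((1 - y) / |M.c j|)) := by
    rw [neg_le_neg_iff, mul_div_assoc']
    gcongr
    have := le_abs_self (s - M.T j j)
    have := abs_nonneg (s - M.T j j)
    nlinarith [hy.1, hy.2]
  have h5 := (Real.exp_le_exp.2 h4).trans h3
  have h6 : (M.passage s j y k).toReal * Real.exp (-(|s - M.T j j| / |M.c j|))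
      ≤ (M.passage s j 1 k).toReal :=
    (mul_le_mul_of_nonneg_left h5 ENNReal.toReal_nonneg).trans h2
  rw [Real.exp_neg, ← div_eq_mul_inv, div_le_iff₀ (Real.exp_pos _)] at h6
  exact h6

end

/-- The transform at the level `a * t` after a jump from phase `i`, summed with the rates of the
possible jumps, and with an exponential factor of rate `β`. For an increasing or flat phase, with
`a = c i` and `β = -(s - T i i)`, it is the density of the flow identity from level zero; for a
decreasing phase, with `a = |c i|` and `β = s - T i i`, it is, up to a factor, that density read
backwards in time. -/
def scaledDensity (M : FluidModel S) (s : ℝ) (j : M.Down) (i : S) (a β t : ℝ) : ℝ :=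
  Real.exp (β * t) * ∑ k, (M.offRate i k).toReal * (M.passage s j (a * t) k).toReal

lemma measurable_scaledDensity (s : ℝ) (j : M.Down) (i : S) (a β : ℝ) :
    Measurable (M.scaledDensity s j i a β) := by
  unfold scaledDensity
  refine Measurable.mul (by fun_prop) (Finset.measurable_fun_sum _ fun k _ => ?_)
  have h : Measurable fun t : ℝ => a * t := by fun_prop
  exact (((measurable_passage s j.1 k).comp h).ennreal_toReal).const_mul _

section

variable {s : ℝ} (hfin : M.AllFinite s)
include hfin

lemma integrableOn_scaledDensity (j : M.Down) (i : S) {a : ℝ} (ha : 0 ≤ a) (β : ℝ) {t : ℝ}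
    (hat : a * t ≤ 1) : IntegrableOn (M.scaledDensity s j i a β) (Icc 0 t) := by
  choose C hC using exists_toReal_passage_le hfin j
  refine Measure.integrableOn_of_bounded (M := Real.exp (|β| * t) *
    ∑ k, (M.offRate i k).toReal * C k) (by simp)
    (measurable_scaledDensity s j i a β).aestronglyMeasurable ?_
  refine (ae_restrict_iff' measurableSet_Icc).2 (ae_of_all _ fun τ hτ => ?_)
  have h0 : 0 ≤ ∑ k, (M.offRate i k).toReal * (M.passage s j (a * τ) k).toReal :=
    Finset.sum_nonneg fun k _ => mul_nonneg ENNReal.toReal_nonneg ENNReal.toReal_nonneg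
  rw [scaledDensity, Real.norm_of_nonneg (mul_nonneg (Real.exp_nonneg _) h0)]
  have h1 : β * τ ≤ |β| * t :=
    mul_le_mul (le_abs_self β) hτ.2 hτ.1 (abs_nonneg β)
  refine mul_le_mul (Real.exp_le_exp.2 h1) (Finset.sum_le_sum fun k _ => ?_) h0 (Real.exp_nonneg _)
  refine mul_le_mul_of_nonneg_left (hC k _ ⟨mul_nonneg ha hτ.1, ?_⟩) ENNReal.toReal_nonneg
  exact (mul_le_mul_of_nonneg_left hτ.2 ha).trans hat

/-- In a decreasing phase the transform is an explicit integral over the levels below. -/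
lemma toReal_passage_of_neg (j : M.Down) {i : S} (hi : M.c i < 0) {t : ℝ} (ht : 0 ≤ t) :
    (M.passage s j (|M.c i| * t) i).toReal = Real.exp (-((s - M.T i i) * t)) *
      ((if i = j.1 then 1 else 0)
        + ∫ τ in (0 : ℝ)..t, M.scaledDensity s j i |M.c i| (s - M.T i i) τ) := by
  have habs := abs_of_neg hi
  have h0 : |M.c i| * t + M.c i * t = 0 := by rw [habs]; ring
  have h1 := toReal_passage_flow hfin j i ht (mul_nonneg (abs_nonneg (M.c i)) ht) h0.ge
  have hz : (M.passage s j 0 i).toReal = if i = j.1 then 1 else 0 := hitMatrix_of_neg s hi j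
  rw [h0, hz] at h1
  rw [h1, mul_add, add_comm]
  congr 1
  have h2 : ∀ τ, M.jumpDensityReal s (fun y k => (M.passage s j y k).toReal) i (|M.c i| * t) τ
      = Real.exp (-((s - M.T i i) * t)) * M.scaledDensity s j i |M.c i| (s - M.T i i) (t - τ) := by
    intro τ
    rw [jumpDensityReal, scaledDensity, ← mul_assoc, ← Real.exp_add]
    congr 1
    · congr 1; ring
    · have : |M.c i| * t + M.c i * τ = |M.c i| * (t - τ) := by rw [habs]; ring
      rw [this]
  simp_rw [h2]
  rw [intervalIntegral.integral_const_mul,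
    intervalIntegral.integral_comp_sub_left (M.scaledDensity s j i |M.c i| (s - M.T i i)) t]
  simp

lemma continuousWithinAt_passage_of_neg (j : M.Down) {i : S} (hi : M.c i < 0) :
    ContinuousWithinAt (fun y => (M.passage s j y i).toReal) (Ici 0) 0 := by
  have hc : 0 < |M.c i| := abs_pos.2 hi.ne
  have hI := integrableOn_scaledDensity hfin j i hc.le (s - M.T i i) (t := 1 / |M.c i|)
    (by field_simp; exact le_rfl)
  have hpos : 0 ≤ 1 / |M.c i| := by positivity
  rw [← uIcc_of_le hpos] at hI
  have h1 := intervalIntegral.continuousOn_primitive_interval hI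
  rw [uIcc_of_le hpos] at h1
  have h2 : ContinuousOn (fun y : ℝ => y / |M.c i|) (Icc 0 1) := by fun_prop
  have h3 : MapsTo (fun y : ℝ => y / |M.c i|) (Icc 0 1) (Icc 0 (1 / |M.c i|)) := fun y hy =>
    ⟨div_nonneg hy.1 hc.le, div_le_div_of_nonneg_right hy.2 hc.le⟩
  have h4 := h1.comp h2 h3
  have h5 : ContinuousOn (fun y => (M.passage s j y i).toReal) (Icc 0 1) := by
    have h6 : ContinuousOn (fun y : ℝ => Real.exp (-((s - M.T i i) * (y / |M.c i|))) *
        ((if i = j.1 then 1 else 0) + ∫ τ in (0 : ℝ)..(y / |M.c i|),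
          M.scaledDensity s j i |M.c i| (s - M.T i i) τ)) (Icc 0 1) :=
      ContinuousOn.mul (by fun_prop) (continuousOn_const.add h4)
    refine h6.congr fun y hy => ?_
    dsimp only
    rw [← toReal_passage_of_neg hfin j hi (div_nonneg hy.1 hc.le)]
    congr 2
    field_simp
  exact (h5 0 ⟨le_rfl, zero_le_one⟩).mono_of_mem_nhdsWithin (Icc_mem_nhdsGE one_pos)

lemma continuousWithinAt_passage (j : M.Down) (i : S) :
    ContinuousWithinAt (fun y => (M.passage s j y i).toReal) (Ici 0) 0 := by
  have h : ContinuousWithinAt (fun y => ∑ b : M.Down,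
      M.hitMatrix s i b * (M.passage s j y b).toReal) (Ici 0) 0 :=
    tendsto_finsetSum _ fun b _ =>
      (continuousWithinAt_passage_of_neg hfin j b.2).const_smul (M.hitMatrix s i b)
  exact h.congr (fun y hy => toReal_passage_eq hfin j i hy) (toReal_passage_eq hfin j i le_rfl)

lemma hasDerivWithinAt_integral_scaledDensity (j : M.Down) (i : S) {a : ℝ} (ha : 0 ≤ a) (β : ℝ) :
    HasDerivWithinAt (fun t => ∫ τ in (0 : ℝ)..t, M.scaledDensity s j i a β τ)
      (∑ k, (M.offRate i k).toReal * M.hitMatrix s k j) (Ici 0) 0 := by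
  have h1 : ContinuousWithinAt (M.scaledDensity s j i a β) (Ici 0) 0 := by
    unfold scaledDensity
    refine ContinuousWithinAt.mul (by fun_prop) (tendsto_finsetSum _ fun k _ => ?_)
    refine Tendsto.const_mul _ ?_
    have h2 : ContinuousWithinAt (fun t : ℝ => a * t) (Ici 0) 0 := by fun_prop
    have h4 : ContinuousWithinAt (fun y => (M.passage s j y k).toReal) (Ici 0) (a * 0) := by
      rw [mul_zero]; exact continuousWithinAt_passage hfin j k
    exact h4.comp (f := fun t : ℝ => a * t) h2 fun t ht => mul_nonneg ha ht
  have h3 : M.scaledDensity s j i a β 0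
      = ∑ k, (M.offRate i k).toReal * M.hitMatrix s k j := by
    simp [scaledDensity, hitMatrix]
  rw [← h3]
  exact intervalIntegral.integral_hasDerivWithinAt_right (by simp)
    ((measurable_scaledDensity s j i a β).stronglyMeasurable.stronglyMeasurableAtFilter)
    (h1.mono Ioi_subset_Ici_self)

/-- The transform is right differentiable at level zero in the decreasing phases. -/
lemma hasDerivWithinAt_passage (j b : M.Down) :
    HasDerivWithinAt (fun y => (M.passage s j y b).toReal) (M.downGen s (M.hitMatrix s) b j)
      (Ici 0) 0 := by
  have hc : 0 < |M.c b| := abs_pos.2 b.2.ne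
  have h1 := hasDerivWithinAt_integral_scaledDensity hfin j b.1 hc.le (s - M.T b b)
  have h2 : HasDerivWithinAt (fun t : ℝ => Real.exp (-((s - M.T b b) * t)))
      (-(s - M.T b b)) (Ici 0) 0 := by
    have h3 : HasDerivAt (fun t : ℝ => -((s - M.T b b) * t)) (-(s - M.T b b)) 0 := by
      simpa using ((hasDerivAt_id' (0 : ℝ)).const_mul (s - M.T b b)).fun_neg
    simpa using h3.exp.hasDerivWithinAt
  have h4 := h2.mul (h1.const_add (if b.1 = j.1 then (1 : ℝ) else 0))
  have h5 : HasDerivWithinAt (fun y : ℝ => y / |M.c b|) (1 / |M.c b|) (Ici 0) 0 :=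
    ((hasDerivAt_id' (0 : ℝ)).div_const |M.c b|).hasDerivWithinAt
  have h6 : HasDerivWithinAt ((fun t : ℝ => Real.exp (-((s - M.T b b) * t))) *
      fun t => (if b.1 = j.1 then (1 : ℝ) else 0)
        + ∫ τ in (0 : ℝ)..t, M.scaledDensity s j b |M.c b| (s - M.T b b) τ)
      (∑ k, M.T b k * M.hitMatrix s k j - s * M.hitMatrix s b j) (Ici 0) (0 / |M.c b|) := by
    rw [zero_div, ← sum_offRate_mul_hitMatrix_sub, hitMatrix_of_neg s b.2 j]
    refine h4.congr_deriv ?_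
    simp only [intervalIntegral.integral_same, mul_zero, neg_zero, Real.exp_zero, one_mul]
    ring
  have h7 := h6.comp (h := fun y : ℝ => y / |M.c b|) 0 h5 (fun y hy => div_nonneg hy hc.le)
  have h8 : M.downGen s (M.hitMatrix s) b j
      = (∑ k, M.T b k * M.hitMatrix s k j - s * M.hitMatrix s b j) * (1 / |M.c b|) := by
    rw [downGen, mul_one_div]
  rw [h8]
  refine h7.congr (fun y hy => ?_) ?_
  · simp only [Function.comp, Pi.mul_apply]
    rw [← toReal_passage_of_neg hfin j b.2 (div_nonneg hy hc.le)]
    congr 2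
    field_simp
  · simp only [Function.comp, Pi.mul_apply]
    rw [← toReal_passage_of_neg hfin j b.2 (by simp)]
    simp

/-- The Riccati equation of the transform of the passage time, obtained by letting the time tend
to zero in the flow identity. -/
theorem riccati_hitMatrix (i : S) (j : M.Down) : M.riccati s (M.hitMatrix s) i j = 0 := by
  rcases lt_or_ge (M.c i) 0 with hi | hi
  · refine riccati_of_neg (fun b j => ?_) hi j
    rw [hitMatrix_of_neg s b.2 j]
    simp [Subtype.ext_iff]
  · have h1 := hasDerivWithinAt_integral_scaledDensity hfin j i hi (-(s - M.T i i))
    have h2 : HasDerivWithinAt (fun t : ℝ => Real.exp (-((s - M.T i i) * t)))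
        (-(s - M.T i i)) (Ici 0) 0 := by
      have h3 : HasDerivAt (fun t : ℝ => -((s - M.T i i) * t)) (-(s - M.T i i)) 0 := by
        simpa using ((hasDerivAt_id' (0 : ℝ)).const_mul (s - M.T i i)).fun_neg
      simpa using h3.exp.hasDerivWithinAt
    have h5 : HasDerivWithinAt (fun t : ℝ => M.c i * t) (M.c i) (Ici 0) 0 := by
      simpa using ((hasDerivAt_id' (0 : ℝ)).const_mul (M.c i)).hasDerivWithinAt
    have h6 : ∀ b : M.Down, HasDerivWithinAt (fun t => (M.passage s j (M.c i * t) b).toReal)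
        (M.downGen s (M.hitMatrix s) b j * M.c i) (Ici 0) 0 := by
      intro b
      have h7 : HasDerivWithinAt (fun y => (M.passage s j y b).toReal)
          (M.downGen s (M.hitMatrix s) b j) (Ici 0) (M.c i * 0) := by
        rw [mul_zero]; exact hasDerivWithinAt_passage hfin j b
      exact h7.comp (h := fun t : ℝ => M.c i * t) 0 h5 fun t ht => mul_nonneg hi ht
    have h8 : HasDerivWithinAt (fun t => ∑ b : M.Down, M.hitMatrix s i b *
        (M.passage s j (M.c i * t) b).toReal)
        (∑ b : M.Down, M.hitMatrix s i b * (M.downGen s (M.hitMatrix s) b j * M.c i))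
        (Ici 0) 0 :=
      HasDerivWithinAt.fun_sum fun b _ => (h6 b).const_mul _
    have h9 := h1.add (h2.mul h8)
    have h10 : HasDerivWithinAt (fun _ : ℝ => M.hitMatrix s i j) 0 (Ici 0) 0 :=
      hasDerivWithinAt_const _ _ _
    have h11 := h10.congr_of_eventuallyEq (f₁ := ((fun t : ℝ =>
      ∫ τ in (0 : ℝ)..t, M.scaledDensity s j i (M.c i) (-(s - M.T i i)) τ) +
      (fun t : ℝ => Real.exp (-((s - M.T i i) * t))) * fun t => ∑ b : M.Down, M.hitMatrix s i b *
        (M.passage s j (M.c i * t) b).toReal)) ?_ ?_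
    · have h12 := (uniqueDiffOn_Ici (0 : ℝ) 0 self_mem_Ici).eq_deriv _ h9 h11
      have h13 := sum_offRate_mul_hitMatrix_sub (M := M) s i j
      have h14 := toReal_passage_eq hfin j i le_rfl
      simp only [mul_zero, neg_zero, Real.exp_zero, one_mul, ← h14, ← mul_assoc,
        ← Finset.sum_mul] at h12
      rw [riccati]
      change _ + ((-(s - M.T i i)) * M.hitMatrix s i j + _) = _ at h12
      linarith
    · filter_upwards [self_mem_nhdsWithin] with t ht
      have ht' : (0 : ℝ) ≤ t := ht
      have hct : 0 ≤ M.c i * t := mul_nonneg hi ht'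
      simp only [Pi.add_apply, Pi.mul_apply]
      rw [← toReal_passage_eq hfin j i hct]
      have h15 := toReal_passage_flow hfin j i ht' le_rfl (by rwa [zero_add])
      rw [hitMatrix, h15, zero_add]
      congr 1
      refine intervalIntegral.integral_congr fun τ _ => ?_
      simp only [scaledDensity, jumpDensityReal, zero_add, neg_mul]
    · simp only [Pi.add_apply, Pi.mul_apply]
      rw [← toReal_passage_eq hfin j i (by simp)]
      simp [hitMatrix]

end

end RiccatiEquation

/-! ### Exponentials of matrices and the flat block -/

section MatrixExp

variable {n : Type*} [Fintype n] [DecidableEq n]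

section

attribute [local instance] Matrix.linftyOpNormedRing Matrix.linftyOpNormedAlgebra

lemma hasSum_exp_apply (A : Matrix n n ℝ) (i j : n) :
    HasSum (fun m : ℕ => (m.factorial : ℝ)⁻¹ * (A ^ m) i j) (NormedSpace.exp A i j) := by
  have h := NormedSpace.exp_series_hasSum_exp' (𝕂 := ℝ) A
  exact Pi.hasSum.1 (Pi.hasSum.1 h i) j

lemma hasDerivAt_exp_smul_apply (A : Matrix n n ℝ) (i j : n) (t : ℝ) :
    HasDerivAt (fun t : ℝ => NormedSpace.exp (t • A) i j)
      ((NormedSpace.exp (t • A) * A) i j) t := by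
  have h := hasDerivAt_exp_smul_const (𝕂 := ℝ) A t
  exact hasDerivAt_pi.1 (hasDerivAt_pi.1 h i) j

lemma exp_smul_mul_comm (A : Matrix n n ℝ) (t : ℝ) :
    NormedSpace.exp (t • A) * A = A * NormedSpace.exp (t • A) :=
  (((Commute.refl A).smul_left t).exp_left).eq

lemma exp_add_smul (A : Matrix n n ℝ) (t u : ℝ) :
    NormedSpace.exp ((t + u) • A) = NormedSpace.exp (t • A) * NormedSpace.exp (u • A) := by
  rw [add_smul]
  exact Matrix.exp_add_of_commute _ _ (((Commute.refl A).smul_left t).smul_right u)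

lemma exp_smul_eq_shift (A : Matrix n n ℝ) (μ t : ℝ) :
    NormedSpace.exp (t • A) = Real.exp (-(t * μ)) • NormedSpace.exp (t • (A + μ • 1)) := by
  have h1 : t • A = t • (A + μ • (1 : Matrix n n ℝ)) + algebraMap ℝ (Matrix n n ℝ) (-(t * μ)) := by
    rw [Algebra.algebraMap_eq_smul_one, smul_add, smul_smul, neg_smul]
    abel
  rw [h1, Matrix.exp_add_of_commute _ _ (Algebra.commute_algebraMap_right _ _)]
  have h2 : NormedSpace.exp (algebraMap ℝ (Matrix n n ℝ) (-(t * μ)))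
      = algebraMap ℝ (Matrix n n ℝ) (Real.exp (-(t * μ))) := by
    rw [Real.exp_eq_exp_ℝ]
    exact (NormedSpace.algebraMap_exp_comm (𝕂 := ℝ) (-(t * μ))).symm
  rw [h2, Algebra.algebraMap_eq_smul_one, mul_smul_comm, mul_one]

end

lemma pow_apply_nonneg {B : Matrix n n ℝ} (hB : ∀ i j, 0 ≤ B i j) (m : ℕ) (i j : n) :
    0 ≤ (B ^ m) i j := by
  induction m generalizing i j with
  | zero =>
    rw [pow_zero, Matrix.one_apply]
    split_ifs <;> norm_num
  | succ m ih =>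
    rw [pow_succ, Matrix.mul_apply]
    exact Finset.sum_nonneg fun k _ => mul_nonneg (ih i k) (hB k j)

lemma pow_apply_le_exp {B : Matrix n n ℝ} (hB : ∀ i j, 0 ≤ B i j) (m : ℕ) (i j : n) :
    (m.factorial : ℝ)⁻¹ * (B ^ m) i j ≤ NormedSpace.exp B i j :=
  le_hasSum (hasSum_exp_apply B i j) m fun l _ =>
    mul_nonneg (by positivity) (pow_apply_nonneg hB l i j)

/-- A matrix with nonnegative off-diagonal entries becomes nonnegative, with diagonal at least one,
after adding a multiple of the identity. -/
lemma exists_shift_nonneg {A : Matrix n n ℝ} (hA : ∀ i j, i ≠ j → 0 ≤ A i j) :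
    ∃ μ : ℝ, 0 < μ ∧ ∀ i j, (if i = j then 1 else 0) ≤ (A + μ • (1 : Matrix n n ℝ)) i j ∧
      A i j ≤ (A + μ • (1 : Matrix n n ℝ)) i j := by
  refine ⟨1 + ∑ i, |A i i|, by positivity, fun i j => ?_⟩
  have h1 := Finset.single_le_sum (f := fun i => |A i i|) (fun _ _ => abs_nonneg _)
    (Finset.mem_univ i)
  rcases eq_or_ne i j with rfl | h
  · have := neg_abs_le (A i i)
    have := abs_nonneg (A i i)
    simp only [if_true, Matrix.add_apply, Matrix.smul_apply, Matrix.one_apply_eq, smul_eq_mul,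
      mul_one]
    constructor <;> linarith
  · simp [h, hA i j h]

lemma exp_smul_apply_nonneg {A : Matrix n n ℝ} (hA : ∀ i j, i ≠ j → 0 ≤ A i j) {t : ℝ} (ht : 0 ≤ t)
    (i j : n) : 0 ≤ NormedSpace.exp (t • A) i j := by
  obtain ⟨μ, -, hμ⟩ := exists_shift_nonneg hA
  rw [exp_smul_eq_shift A μ t, Matrix.smul_apply, smul_eq_mul]
  have hB : ∀ i j, 0 ≤ (t • (A + μ • (1 : Matrix n n ℝ))) i j := fun i j => by
    refine mul_nonneg ht (le_trans ?_ (hμ i j).1)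
    split_ifs <;> norm_num
  refine mul_nonneg (Real.exp_nonneg _) (le_trans ?_ (pow_apply_le_exp hB 0 i j))
  exact mul_nonneg (by positivity) (pow_apply_nonneg hB 0 i j)

lemma exp_smul_apply_pos {A : Matrix n n ℝ} (hA : ∀ i j, i ≠ j → 0 ≤ A i j) {t : ℝ} (ht : 0 < t)
    {i j : n} (hij : i = j ∨ 0 < A i j) : 0 < NormedSpace.exp (t • A) i j := by
  obtain ⟨μ, -, hμ⟩ := exists_shift_nonneg hA
  rw [exp_smul_eq_shift A μ t, Matrix.smul_apply, smul_eq_mul]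
  have hB : ∀ i j, 0 ≤ (t • (A + μ • (1 : Matrix n n ℝ))) i j := fun i j => by
    refine mul_nonneg ht.le (le_trans ?_ (hμ i j).1)
    split_ifs <;> norm_num
  refine mul_pos (Real.exp_pos _) (lt_of_lt_of_le ?_ (pow_apply_le_exp hB 1 i j))
  rw [pow_one, Nat.factorial_one, Nat.cast_one, inv_one, one_mul, Matrix.smul_apply, smul_eq_mul]
  refine mul_pos ht ?_
  rcases hij with rfl | h
  · have := (hμ i i).1
    rw [if_pos rfl] at this
    linarith
  · exact h.trans_le (hμ i j).2

end MatrixExp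

section Supersolution

variable {S : Type*} [Fintype S] {M : FluidModel S}

lemma T00_offDiag (a b : M.Flat) (h : a ≠ b) : 0 ≤ M.T00 a b :=
  M.offDiag_nonneg _ _ fun h' => h (Subtype.ext h')

variable [DecidableEq S]

lemma downGen_nonneg {s : ℝ} {X : S → M.Down → ℝ} (hX0 : ∀ i j, 0 ≤ X i j)
    (hX : ∀ b j : M.Down, X b j = if b = j then 1 else 0) {b j : M.Down} (h : b ≠ j) :
    0 ≤ M.downGen s X b j := by
  have hbj : X b j = 0 := by rw [hX b j, if_neg h]
  rw [downGen, hbj, mul_zero, sub_zero]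
  refine div_nonneg (Finset.sum_nonneg fun k _ => ?_) (abs_nonneg _)
  by_cases hk : b.1 = k
  · rw [← hk, hbj, mul_zero]
  · exact mul_nonneg (M.offDiag_nonneg _ _ hk) (hX0 k j)

/-- A nonnegative supersolution `X` of the Riccati equation gives the supersolution
`X e^{D y}` of the passage problem, so the transform is finite. -/
theorem allFinite_of_riccati_nonpos {s : ℝ} {X : S → M.Down → ℝ} (hX0 : ∀ i j, 0 ≤ X i j)
    (hX : ∀ b j : M.Down, X b j = if b = j then 1 else 0) (hle : ∀ i j, M.riccati s X i j ≤ 0) :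
    M.AllFinite s := by
  intro j i y hy
  let A : Matrix M.Down M.Down ℝ := Matrix.of (M.downGen s X)
  have hA : ∀ b l, b ≠ l → 0 ≤ A b l := fun b l h => downGen_nonneg hX0 hX h
  have h := passage_le_of_supersolution (M := M) (s := s) (j := j.1)
    (f := fun y i => ∑ b, X i b * NormedSpace.exp (y • A) b j)
    (f' := fun y i => ∑ b, X i b * (A * NormedSpace.exp (y • A)) b j)
    (fun y i => HasDerivAt.fun_sum fun b _ => by
      have := hasDerivAt_exp_smul_apply A b j y
      rw [exp_smul_mul_comm] at this
      exact this.const_mul _)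
    (fun y hy i => Finset.sum_nonneg fun b _ =>
      mul_nonneg (hX0 i b) (exp_smul_apply_nonneg hA hy b j))
    ?_ ?_ hy i
  · exact ne_top_of_le_ne_top ENNReal.ofReal_ne_top h
  · intro y hy i
    have h1 : M.c i * ∑ b, X i b * (A * NormedSpace.exp (y • A)) b j
        + ∑ k, M.T i k * ∑ b, X k b * NormedSpace.exp (y • A) b j
        - s * ∑ b, X i b * NormedSpace.exp (y • A) b j
        = ∑ l, M.riccati s X i l * NormedSpace.exp (y • A) l j := by
      simp_rw [riccati, sub_mul, add_mul, Matrix.mul_apply, Finset.sum_sub_distrib,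
        Finset.sum_add_distrib, Finset.mul_sum, Finset.sum_mul]
      congr 1
      · congr 1
        · rw [Finset.sum_comm]
          refine Finset.sum_congr rfl fun l _ => Finset.sum_congr rfl fun b _ => ?_
          simp only [A, Matrix.of_apply]
          ring
        · rw [Finset.sum_comm]
          refine Finset.sum_congr rfl fun l _ => Finset.sum_congr rfl fun b _ => ?_
          ring
      · exact Finset.sum_congr rfl fun l _ => by ring
    rw [h1]
    exact Finset.sum_nonpos fun l _ =>
      mul_nonpos_of_nonpos_of_nonneg (hle i l) (exp_smul_apply_nonneg hA hy l j)
  · refine le_of_eq ?_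
    rw [Finset.sum_eq_single j]
    · simp [hX]
    · intro b _ hb
      simp [hX, hb.symm]
    · simp

/-- The flat rows of the Riccati equation, transported to level `y`. -/
lemma flat_equation {s : ℝ} (hfin : M.AllFinite s) (j : M.Down) {i : S} (hi : M.c i = 0) {y : ℝ}
    (hy : 0 ≤ y) :
    ∑ k, M.T i k * (M.passage s j y k).toReal = s * (M.passage s j y i).toReal := by
  have h : ∀ b, ∑ k, M.T i k * M.hitMatrix s k b = s * M.hitMatrix s i b := by
    intro b
    have := riccati_hitMatrix hfin i b
    rw [riccati, hi, zero_mul, zero_add] at this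
    linarith
  rw [toReal_passage_eq hfin j i hy, Finset.mul_sum,
    Finset.sum_congr rfl fun k _ => by rw [toReal_passage_eq hfin j k hy, Finset.mul_sum],
    Finset.sum_comm]
  refine Finset.sum_congr rfl fun b _ => ?_
  simp_rw [← mul_assoc]
  rw [← Finset.sum_mul, h b]

/-- Where the transform is finite, the flat block has a positive vector on which `T₀₀ - s` is
negative: it is the transform at level one, moved for a unit time by the semigroup of the flat
block, which spreads the exits from the flat phases to all of them. -/
theorem exists_flat_pos (hirr : M.Irreducible) (j : M.Down) {s : ℝ} (hfin : M.AllFinite s) :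
    ∃ z : M.Flat → ℝ, (∀ a, 0 < z a) ∧ ∀ a, ∑ b, M.T00 a b * z b < s * z a := by
  let u : S → ℝ := fun k => (M.passage s j 1 k).toReal
  have hu : ∀ k, 0 < u k := fun k => ENNReal.toReal_pos
    (passage_pos hirr s j k one_pos).ne' (hfin j k 1 zero_le_one)
  let v : M.Flat → ℝ := fun a => u a
  let g : M.Flat → ℝ := fun a => s * v a - ∑ b, M.T00 a b * v b
  have hg : ∀ a : M.Flat, g a = ∑ k : {k : S // ¬ M.c k = 0}, M.T a k * u k := by
    intro a
    have h1 := flat_equation hfin j a.2 zero_le_one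
    rw [← Fintype.sum_subtype_add_sum_subtype (fun k => M.c k = 0)] at h1
    simp only [g, v, u, T00, Matrix.submatrix_apply]
    linarith
  have hne : ∀ a : M.Flat, ∀ k : S, ¬ M.c k = 0 → a.1 ≠ k := by
    rintro a k hk rfl
    exact hk a.2
  have hg0 : ∀ a, 0 ≤ g a := by
    intro a
    rw [hg]
    exact Finset.sum_nonneg fun k _ =>
      mul_nonneg (M.offDiag_nonneg _ _ (hne a k k.2)) (hu k).le
  -- induction along a path from the flat phase `x` to the decreasing phase `j`: at the exit from
  -- the flat phases `g` is positive, and each earlier step costs half of the remaining time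
  have hpos : ∀ x : S, ∀ hx : M.c x = 0, ∀ t : ℝ, 0 < t →
      0 < ∑ b, NormedSpace.exp (t • M.T00) ⟨x, hx⟩ b * g b := by
    intro x
    induction hirr x j using Relation.ReflTransGen.head_induction_on with
    | refl => intro hx; exact absurd hx j.2.ne
    | @head x k hxk _ ih =>
      intro hx t ht
      by_cases hk : M.c k = 0
      · have ht2 : 0 < t / 2 := by positivity
        have h1 := ih hk (t / 2) ht2
        have h2 : ∑ b, NormedSpace.exp (t • M.T00) ⟨x, hx⟩ b * g b
            = ∑ l, NormedSpace.exp ((t / 2) • M.T00) ⟨x, hx⟩ l *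
              ∑ b, NormedSpace.exp ((t / 2) • M.T00) l b * g b := by
          conv_lhs => rw [← add_halves t, exp_add_smul]
          simp_rw [Matrix.mul_apply, Finset.sum_mul, Finset.mul_sum]
          rw [Finset.sum_comm]
          exact Finset.sum_congr rfl fun l _ => Finset.sum_congr rfl fun b _ => by ring
        rw [h2]
        refine lt_of_lt_of_le ?_ (Finset.single_le_sum (f := fun l =>
          NormedSpace.exp ((t / 2) • M.T00) ⟨x, hx⟩ l *
            ∑ b, NormedSpace.exp ((t / 2) • M.T00) l b * g b) (fun l _ => ?_)
          (Finset.mem_univ ⟨k, hk⟩))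
        · exact mul_pos (exp_smul_apply_pos T00_offDiag ht2 (Or.inr hxk)) h1
        · exact mul_nonneg (exp_smul_apply_nonneg T00_offDiag ht2.le _ _)
            (Finset.sum_nonneg fun b _ =>
              mul_nonneg (exp_smul_apply_nonneg T00_offDiag ht2.le _ _) (hg0 b))
      · have h1 : 0 < g ⟨x, hx⟩ := by
          rw [hg]
          refine lt_of_lt_of_le ?_ (Finset.single_le_sum
            (f := fun k : {k : S // ¬ M.c k = 0} => M.T x k * u k) (fun l _ => ?_)
            (Finset.mem_univ ⟨k, hk⟩))
          · exact mul_pos hxk (hu k)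
          · exact mul_nonneg (M.offDiag_nonneg _ _ (hne ⟨x, hx⟩ l l.2)) (hu l).le
        refine lt_of_lt_of_le ?_ (Finset.single_le_sum (f := fun b =>
          NormedSpace.exp (t • M.T00) ⟨x, hx⟩ b * g b) (fun l _ => ?_)
          (Finset.mem_univ ⟨x, hx⟩))
        · exact mul_pos (exp_smul_apply_pos T00_offDiag ht (Or.inl rfl)) h1
        · exact mul_nonneg (exp_smul_apply_nonneg T00_offDiag ht.le _ _) (hg0 l)
  refine ⟨fun a => ∑ b, NormedSpace.exp ((1 : ℝ) • M.T00) a b * v b, fun a => ?_, fun a => ?_⟩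
  · refine lt_of_lt_of_le ?_ (Finset.single_le_sum (f := fun b =>
      NormedSpace.exp ((1 : ℝ) • M.T00) a b * v b) (fun l _ => ?_) (Finset.mem_univ a))
    · exact mul_pos (exp_smul_apply_pos T00_offDiag one_pos (Or.inl rfl)) (hu a)
    · exact mul_nonneg (exp_smul_apply_nonneg T00_offDiag zero_le_one _ _) (hu l).le
  · have h1 := hpos a.1 a.2 1 one_pos
    have h2 : ∑ b, M.T00 a b * ∑ l, NormedSpace.exp ((1 : ℝ) • M.T00) b l * v l
        = ∑ b, NormedSpace.exp ((1 : ℝ) • M.T00) a b * ∑ l, M.T00 b l * v l := by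
      have h3 := exp_smul_mul_comm M.T00 1
      have h4 : (M.T00 * NormedSpace.exp ((1 : ℝ) • M.T00)).mulVec v a
          = (NormedSpace.exp ((1 : ℝ) • M.T00) * M.T00).mulVec v a := by rw [h3]
      rw [← Matrix.mulVec_mulVec, ← Matrix.mulVec_mulVec] at h4
      exact h4
    rw [h2]
    simp only [g, mul_sub, Finset.sum_sub_distrib] at h1
    rw [Finset.mul_sum]
    have h5 : ∑ b, NormedSpace.exp ((1 : ℝ) • M.T00) a b * (s * v b)
        = ∑ b, s * (NormedSpace.exp ((1 : ℝ) • M.T00) a b * v b) :=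
      Finset.sum_congr rfl fun b _ => by ring
    rw [h5] at h1
    simp only [Subtype.coe_eta] at h1
    linarith

/-- A positive vector on which `T₀₀ - s` is negative bounds the integral of the discounted semigroup
of the flat block. -/
theorem QExists_of_flat_pos {s : ℝ} {z : M.Flat → ℝ} (hz : ∀ a, 0 < z a)
    (hlt : ∀ a, ∑ b, M.T00 a b * z b < s * z a) : M.QExists s := by
  intro a b
  let g : M.Flat → ℝ := fun a => s * z a - ∑ b, M.T00 a b * z b
  have hg : ∀ a, 0 < g a := fun a => sub_pos.2 (hlt a)
  have hE : ∀ t : ℝ, 0 ≤ t → ∀ l, 0 ≤ NormedSpace.exp (t • M.T00) a l := fun t ht l =>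
    exp_smul_apply_nonneg T00_offDiag ht a l
  have hcont : ∀ l, Continuous fun t : ℝ => NormedSpace.exp (t • M.T00) a l := fun l =>
    continuous_iff_continuousAt.2 fun t => (hasDerivAt_exp_smul_apply M.T00 a l t).continuousAt
  have hd : ∀ t : ℝ, HasDerivAt
      (fun t => Real.exp (-s * t) * ∑ l, NormedSpace.exp (t • M.T00) a l * z l)
      (-(Real.exp (-s * t) * ∑ l, NormedSpace.exp (t • M.T00) a l * g l)) t := by
    intro t
    have h1 : HasDerivAt (fun t : ℝ => -s * t) (-s) t := by
      simpa using (hasDerivAt_id' t).const_mul (-s)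
    have h2 : HasDerivAt (fun t : ℝ => ∑ l, NormedSpace.exp (t • M.T00) a l * z l)
        (∑ l, (NormedSpace.exp (t • M.T00) * M.T00) a l * z l) t :=
      HasDerivAt.fun_sum fun l _ => (hasDerivAt_exp_smul_apply M.T00 a l t).mul_const _
    refine (h1.exp.mul h2).congr_deriv ?_
    have h3 : ∑ l, (NormedSpace.exp (t • M.T00) * M.T00) a l * z l
        = ∑ b, NormedSpace.exp (t • M.T00) a b * ∑ l, M.T00 b l * z l := by
      have h4 : (NormedSpace.exp (t • M.T00) * M.T00).mulVec z a
          = (NormedSpace.exp (t • M.T00)).mulVec (M.T00.mulVec z) a := by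
        rw [Matrix.mulVec_mulVec]
      exact h4
    have h5 : ∑ l, NormedSpace.exp (t • M.T00) a l * (s * z l)
        = s * ∑ l, NormedSpace.exp (t • M.T00) a l * z l := by
      rw [Finset.mul_sum]
      exact Finset.sum_congr rfl fun b _ => by ring
    rw [h3]
    simp only [g, mul_sub, Finset.sum_sub_distrib, h5]
    ring
  have hc : Continuous fun t : ℝ => Real.exp (-s * t) * NormedSpace.exp (t • M.T00) a b :=
    Continuous.mul (by fun_prop) (hcont b)
  refine integrableOn_Ioi_of_intervalIntegral_norm_bounded (z a / g b) 0
    (b := fun n : ℕ => (n : ℝ)) (l := atTop)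
    (fun n => (hc.integrableOn_Icc).mono_set Ioc_subset_Icc_self) tendsto_natCast_atTop_atTop ?_
  refine Eventually.of_forall fun n => ?_
  have hn : (0 : ℝ) ≤ n := n.cast_nonneg
  rw [le_div_iff₀ (hg b), ← intervalIntegral.integral_mul_const]
  have h1 : ∫ t in (0 : ℝ)..n, ‖Real.exp (-s * t) * NormedSpace.exp (t • M.T00) a b‖ * g b
      ≤ -(Real.exp (-s * n) * ∑ l, NormedSpace.exp ((n : ℝ) • M.T00) a l * z l)
        - -(Real.exp (-s * 0) * ∑ l, NormedSpace.exp ((0 : ℝ) • M.T00) a l * z l) := by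
    refine intervalIntegral.integral_le_sub_of_hasDeriv_right_of_le hn
      (fun t _ => ((hd t).fun_neg.continuousAt).continuousWithinAt)
      (fun t _ => (hd t).fun_neg.hasDerivWithinAt)
      ((hc.norm.mul continuous_const).integrableOn_Icc) ?_
    intro t ht
    have ht0 : 0 ≤ t := ht.1.le
    rw [Real.norm_of_nonneg (mul_nonneg (Real.exp_nonneg _) (hE t ht0 b)), neg_neg, mul_assoc]
    refine mul_le_mul_of_nonneg_left ?_ (Real.exp_nonneg _)
    exact Finset.single_le_sum (f := fun l => NormedSpace.exp (t • M.T00) a l * g l)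
      (fun l _ => mul_nonneg (hE t ht0 l) (hg l).le) (Finset.mem_univ b)
  refine h1.trans ?_
  have h2 : 0 ≤ Real.exp (-s * n) * ∑ l, NormedSpace.exp ((n : ℝ) • M.T00) a l * z l :=
    mul_nonneg (Real.exp_nonneg _) (Finset.sum_nonneg fun l _ =>
      mul_nonneg (hE n hn l) (hz l).le)
  have h3 : Real.exp (-s * 0) * ∑ l, NormedSpace.exp ((0 : ℝ) • M.T00) a l * z l = z a := by
    simp [NormedSpace.exp_zero, Matrix.one_apply]
  rw [h3]
  linarith

end Supersolution

/-! ### Quasi-positive operators and the Sylvester equation -/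

section LinearAlgebra

/-- Let `A` be linear with nonnegative off-diagonal coefficients. If `A` is negative on some
nonnegative `Δ`, then `A x ≤ 0` implies `0 ≤ x`: otherwise add to `x` the least multiple of `Δ` that
makes it nonnegative, and look at a coordinate where the sum vanishes. -/
lemma nonneg_of_quasiPositive {ι κ : Type*} [Finite ι] [Finite κ]
    (A : (ι → κ → ℝ) →ₗ[ℝ] (ι → κ → ℝ))
    (hA : ∀ x i j, (∀ i j, 0 ≤ x i j) → x i j = 0 → 0 ≤ A x i j)
    {Δ : ι → κ → ℝ} (hΔ0 : ∀ i j, 0 ≤ Δ i j) (hAΔ : ∀ i j, A Δ i j < 0)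
    {x : ι → κ → ℝ} (hx : ∀ i j, A x i j ≤ 0) (i : ι) (j : κ) : 0 ≤ x i j := by
  have hΔ : ∀ i j, 0 < Δ i j := fun i j =>
    lt_of_le_of_ne (hΔ0 i j) fun h => absurd (hA Δ i j hΔ0 h.symm) (not_le.2 (hAΔ i j))
  have : Nonempty (ι × κ) := ⟨(i, j)⟩
  obtain ⟨⟨i₀, j₀⟩, hmin⟩ := Finite.exists_min fun p : ι × κ => x p.1 p.2 / Δ p.1 p.2
  set m := x i₀ j₀ / Δ i₀ j₀ with hm
  have hge : ∀ i j, m * Δ i j ≤ x i j := fun i j => by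
    have := hmin (i, j)
    rwa [le_div_iff₀ (hΔ i j)] at this
  by_contra! hneg
  have hm0 : m < 0 := by
    by_contra! h
    exact absurd (hge i j) (not_le.2 (hneg.trans_le (mul_nonneg h (hΔ0 i j))))
  have h1 := hA (x - m • Δ) i₀ j₀ (fun i j => by simpa using hge i j) (by
    have := (hΔ i₀ j₀).ne'
    simp only [Pi.sub_apply, Pi.smul_apply, smul_eq_mul, hm]
    field_simp
    ring)
  rw [map_sub, map_smul] at h1
  simp only [Pi.sub_apply, Pi.smul_apply, smul_eq_mul] at h1
  have h2 := mul_pos_of_neg_of_neg hm0 (hAΔ i₀ j₀)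
  linarith [hx i₀ j₀]

lemma injective_of_quasiPositive {ι κ : Type*} [Finite ι] [Finite κ]
    (A : (ι → κ → ℝ) →ₗ[ℝ] (ι → κ → ℝ))
    (hA : ∀ x i j, (∀ i j, 0 ≤ x i j) → x i j = 0 → 0 ≤ A x i j)
    {Δ : ι → κ → ℝ} (hΔ0 : ∀ i j, 0 ≤ Δ i j) (hAΔ : ∀ i j, A Δ i j < 0)
    {x : ι → κ → ℝ} (hx : A x = 0) : x = 0 := by
  have h1 := nonneg_of_quasiPositive A hA hΔ0 hAΔ (x := x) (fun i j => by simp [hx])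
  have h2 := nonneg_of_quasiPositive A hA hΔ0 hAΔ (x := -x) (fun i j => by simp [hx])
  ext i j
  have := h2 i j
  simp only [Pi.neg_apply] at this
  simp only [Pi.zero_apply]
  linarith [h1 i j]

variable {m n : Type*} [Fintype m] [DecidableEq m] [Fintype n] [DecidableEq n]

lemma mem_spectrum_iff_det (A : Matrix m m ℂ) (μ : ℂ) :
    μ ∈ spectrum ℂ A ↔ (algebraMap ℂ (Matrix m m ℂ) μ - A).det = 0 := by
  rw [spectrum.mem_iff, Matrix.isUnit_iff_isUnit_det, isUnit_iff_ne_zero, not_not]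

/-- A common eigenvalue of `K` and `-D` gives a real solution of the Sylvester equation: the product
of a right eigenvector of `K` and a left eigenvector of `D` is a complex one, and `K` and `D` are
real. -/
lemma exists_sylvester_of_spectrum {K : Matrix m m ℝ} {D : Matrix n n ℝ}
    (h : (spectrum ℂ (K.map Complex.ofReal) ∩ spectrum ℂ ((-D).map Complex.ofReal)).Nonempty) :
    ∃ H : Matrix m n ℝ, H ≠ 0 ∧ K * H + H * D = 0 := by
  obtain ⟨μ, hK, hD⟩ := h
  rw [mem_spectrum_iff_det] at hK hD
  obtain ⟨v, hv0, hv⟩ := Matrix.exists_mulVec_eq_zero_iff.2 hK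
  obtain ⟨w, hw0, hw⟩ := Matrix.exists_vecMul_eq_zero_iff.2 hD
  have hv' : ∀ i, ∑ k, (K i k : ℂ) * v k = μ * v i := by
    intro i
    have := congrFun hv i
    rw [Matrix.sub_mulVec, Algebra.algebraMap_eq_smul_one, Matrix.smul_mulVec,
      Matrix.one_mulVec] at this
    simp only [Pi.sub_apply, Pi.smul_apply, smul_eq_mul, Pi.zero_apply] at this
    rw [sub_eq_zero] at this
    exact this.symm
  have hw' : ∀ j, ∑ k, w k * (D k j : ℂ) = -(μ * w j) := by
    intro j
    have := congrFun hw j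
    rw [Matrix.vecMul_sub, Algebra.algebraMap_eq_smul_one, Matrix.vecMul_smul,
      Matrix.vecMul_one] at this
    simp only [Pi.sub_apply, Pi.smul_apply, smul_eq_mul, Pi.zero_apply] at this
    rw [sub_eq_zero] at this
    rw [this]
    simp [Matrix.vecMul, dotProduct]
  have hsum : ∀ i j, ∑ k, (K i k : ℂ) * (v k * w j) + ∑ k, (v i * w k) * (D k j : ℂ) = 0 := by
    intro i j
    simp_rw [← mul_assoc]
    rw [← Finset.sum_mul, hv' i]
    simp_rw [mul_assoc]
    rw [← Finset.mul_sum, hw' j]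
    ring
  obtain ⟨i₀, hi₀⟩ := Function.ne_iff.1 hv0
  obtain ⟨j₀, hj₀⟩ := Function.ne_iff.1 hw0
  by_cases hre : (v i₀ * w j₀).re = 0
  · refine ⟨Matrix.of fun i j => (v i * w j).im, fun h0 => ?_, ?_⟩
    · have h1 : (v i₀ * w j₀).im = 0 := congrFun (congrFun h0 i₀) j₀
      exact mul_ne_zero hi₀ hj₀ (Complex.ext hre h1)
    · ext i j
      have := congrArg Complex.im (hsum i j)
      rw [Complex.add_im, Complex.im_sum, Complex.im_sum] at this
      simp only [Complex.im_ofReal_mul, Complex.im_mul_ofReal] at this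
      exact this
  · refine ⟨Matrix.of fun i j => (v i * w j).re, fun h0 => hre (congrFun (congrFun h0 i₀) j₀), ?_⟩
    ext i j
    have := congrArg Complex.re (hsum i j)
    rw [Complex.add_re, Complex.re_sum, Complex.re_sum] at this
    simp only [Complex.re_ofReal_mul, Complex.re_mul_ofReal] at this
    exact this

/-- A nonzero solution of the Sylvester equation intertwines `-D` and `K`, so the characteristic
polynomial of `K` at `-D` is singular. -/
lemma spectrum_inter_of_sylvester {K : Matrix m m ℝ} {D : Matrix n n ℝ} {H : Matrix m n ℝ}
    (hH : H ≠ 0) (h : K * H + H * D = 0) :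
    (spectrum ℂ (K.map Complex.ofReal) ∩ spectrum ℂ ((-D).map Complex.ofReal)).Nonempty := by
  set Kc := K.map Complex.ofReal
  set Dc := (-D).map Complex.ofReal with hDc
  set Hc := H.map Complex.ofReal with hHc
  have h1 : Kc * Hc = Hc * Dc := by
    have h2 : K * H = H * (-D) := by rw [Matrix.mul_neg]; exact eq_neg_of_add_eq_zero_left h
    have h3 := congrArg (fun A => A.map Complex.ofRealHom) h2
    simp only [Matrix.map_mul] at h3
    exact h3
  have hHc0 : Hc ≠ 0 := by
    intro h0
    apply hH
    ext i j
    have := congrFun (congrFun h0 i) j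
    simpa [hHc] using this
  have hpoly : ∀ p : Polynomial ℂ, Polynomial.aeval Kc p * Hc = Hc * Polynomial.aeval Dc p := by
    intro p
    induction p using Polynomial.induction_on' with
    | add p q hp hq => rw [map_add, map_add, Matrix.add_mul, Matrix.mul_add, hp, hq]
    | monomial d a =>
      have hpow : Kc ^ d * Hc = Hc * Dc ^ d := by
        induction d with
        | zero => simp
        | succ d ih => rw [pow_succ, Matrix.mul_assoc, h1, ← Matrix.mul_assoc, ih,
            Matrix.mul_assoc, ← pow_succ]
      rw [Polynomial.aeval_monomial, Polynomial.aeval_monomial, Algebra.algebraMap_eq_smul_one,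
        Algebra.algebraMap_eq_smul_one, smul_one_mul, smul_one_mul, Matrix.smul_mul,
        Matrix.mul_smul, hpow]
  have h2 := hpoly Kc.charpoly
  rw [Matrix.aeval_self_charpoly, Matrix.zero_mul] at h2
  have hne : Nonempty n := by
    by_contra hn
    rw [not_nonempty_iff] at hn
    exact hHc0 (by ext i j; exact hn.elim j)
  have h3 : ¬ IsUnit (Polynomial.aeval Dc Kc.charpoly) := by
    intro hu
    rw [Matrix.isUnit_iff_isUnit_det] at hu
    apply hHc0
    have h4 := Matrix.mul_nonsing_inv_cancel_right (A := Polynomial.aeval Dc Kc.charpoly) Hc hu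
    rw [← h2, Matrix.zero_mul] at h4
    exact h4.symm
  have h4 : (0 : ℂ) ∈ spectrum ℂ (Polynomial.aeval Dc Kc.charpoly) := by
    rwa [spectrum.zero_mem_iff]
  rw [spectrum.map_polynomial_aeval_of_nonempty Dc Kc.charpoly
    (spectrum.nonempty_of_isAlgClosed_of_finiteDimensional ℂ Dc)] at h4
  obtain ⟨μ, hμ, hev⟩ := h4
  exact ⟨μ, Matrix.mem_spectrum_iff_isRoot_charpoly.2 hev, hμ⟩

end LinearAlgebra

/-! ### The linearized Riccati equation and its block form -/

section Linearization

variable {S : Type*} [Fintype S] (M : FluidModel S)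

/-- The derivative of `downGen` in a direction that vanishes on the decreasing phases. -/
def downGenLin (H : S → M.Down → ℝ) (b j : M.Down) : ℝ := (∑ k, M.T b k * H k j) / |M.c b|

/-- The derivative of the Riccati expression at `X` in a direction that vanishes on the decreasing
phases. -/
def riccatiLin (s : ℝ) (X H : S → M.Down → ℝ) (i : S) (j : M.Down) : ℝ :=
  M.c i * (∑ b, H i b * M.downGen s X b j + ∑ b, X i b * M.downGenLin H b j)
    + ∑ k, M.T i k * H k j - s * H i j

open Classical in
/-- The restriction of a direction to the phases that are not decreasing. -/
def cutDown : (S → M.Down → ℝ) →ₗ[ℝ] (S → M.Down → ℝ) where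
  toFun H i j := if M.c i < 0 then 0 else H i j
  map_add' H H' := by ext i j; simp only [Pi.add_apply]; split_ifs <;> simp
  map_smul' a H := by ext i j; simp only [Pi.smul_apply, RingHom.id_apply]; split_ifs <;> simp

open Classical in
/-- The linearization of the Riccati expression as an operator whose off-diagonal coefficients are
nonnegative. On the decreasing phases, where directions are to vanish, it is minus the
identity. -/
def riccatiOp (s : ℝ) (X : S → M.Down → ℝ) : (S → M.Down → ℝ) →ₗ[ℝ] (S → M.Down → ℝ) where
  toFun H i j := if M.c i < 0 then -H i j else M.riccatiLin s X (M.cutDown H) i j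
  map_add' H H' := by
    ext i j
    simp only [Pi.add_apply, map_add]
    split_ifs
    · ring
    · simp only [riccatiLin, downGenLin, Pi.add_apply, mul_add, add_mul, add_div,
        Finset.sum_add_distrib]
      ring
  map_smul' a H := by
    ext i j
    simp only [Pi.smul_apply, map_smul, RingHom.id_apply, smul_eq_mul]
    split_ifs
    · ring
    · simp only [riccatiLin, downGenLin, Pi.smul_apply, smul_eq_mul]
      have h1 : ∑ b, a * M.cutDown H i b * M.downGen s X b j
          = a * ∑ b, M.cutDown H i b * M.downGen s X b j := by
        rw [Finset.mul_sum]; exact Finset.sum_congr rfl fun b _ => by ring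
      have h2 : ∀ i, ∑ k, M.T i k * (a * M.cutDown H k j) = a * ∑ k, M.T i k * M.cutDown H k j := by
        intro i
        rw [Finset.mul_sum]; exact Finset.sum_congr rfl fun b _ => by ring
      have h3 : ∑ b : M.Down, X i b * ((∑ k, M.T b k * (a * M.cutDown H k j)) / |M.c b|)
          = a * ∑ b : M.Down, X i b * ((∑ k, M.T b k * M.cutDown H k j) / |M.c b|) := by
        rw [Finset.mul_sum]
        refine Finset.sum_congr rfl fun b _ => ?_
        rw [h2 b]; ring
      rw [h1, h2 i, h3]
      ring

variable {M}

lemma cutDown_of_neg (H : S → M.Down → ℝ) {i : S} (hi : M.c i < 0) (j : M.Down) :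
    M.cutDown H i j = 0 := if_pos hi

lemma cutDown_of_nonneg (H : S → M.Down → ℝ) {i : S} (hi : 0 ≤ M.c i) (j : M.Down) :
    M.cutDown H i j = H i j := if_neg (not_lt.2 hi)

lemma cutDown_eq_self {H : S → M.Down → ℝ} (hH : ∀ b j : M.Down, H b j = 0) : M.cutDown H = H := by
  ext i j
  rcases lt_or_ge (M.c i) 0 with h | h
  · rw [cutDown_of_neg H h, hH ⟨i, h⟩ j]
  · exact cutDown_of_nonneg H h j

lemma riccatiOp_of_neg (s : ℝ) (X H : S → M.Down → ℝ) {i : S} (hi : M.c i < 0) (j : M.Down) :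
    M.riccatiOp s X H i j = -H i j := if_pos hi

lemma riccatiOp_of_nonneg (s : ℝ) (X H : S → M.Down → ℝ) {i : S} (hi : 0 ≤ M.c i) (j : M.Down) :
    M.riccatiOp s X H i j = M.riccatiLin s X (M.cutDown H) i j := if_neg (not_lt.2 hi)

/-- The quadratic expansion of the Riccati expression. -/
lemma riccati_add (s : ℝ) (X : S → M.Down → ℝ) {H : S → M.Down → ℝ}
    (hH : ∀ b j : M.Down, H b j = 0) (i : S) (j : M.Down) :
    M.riccati s (X + H) i j = M.riccati s X i j + M.riccatiLin s X H i j
      + M.c i * ∑ b, H i b * M.downGenLin H b j := by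
  have h1 : ∀ b, M.downGen s (X + H) b j = M.downGen s X b j + M.downGenLin H b j := by
    intro b
    simp only [downGen, downGenLin, Pi.add_apply, hH b j, add_zero, mul_add,
      Finset.sum_add_distrib]
    ring
  simp only [riccati, riccatiLin, h1, Pi.add_apply, mul_add, add_mul, Finset.sum_add_distrib]
  ring

lemma riccati_sub_rate (s s' : ℝ) (X : S → M.Down → ℝ) (i : S) (j : M.Down) :
    M.riccati s' X i j = M.riccati s X i j
      + (s - s') * (M.c i * ∑ b, X i b * (X b j / |M.c b|) + X i j) := by
  have h1 : ∀ b, M.downGen s' X b j = M.downGen s X b j + (s - s') * (X b j / |M.c b|) := by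
    intro b
    simp only [downGen]
    ring
  have h2 : ∑ b, X i b * ((s - s') * (X b j / |M.c b|))
      = (s - s') * ∑ b : M.Down, X i b * (X b j / |M.c b|) := by
    rw [Finset.mul_sum]; exact Finset.sum_congr rfl fun b _ => by ring
  simp only [riccati, h1, mul_add, Finset.sum_add_distrib, h2]
  ring

lemma downGenLin_nonneg {H : S → M.Down → ℝ} (hH0 : ∀ i j, 0 ≤ H i j)
    (hH : ∀ b j : M.Down, H b j = 0) (b j : M.Down) : 0 ≤ M.downGenLin H b j := by
  refine div_nonneg (Finset.sum_nonneg fun k _ => ?_) (abs_nonneg _)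
  by_cases hk : b.1 = k
  · rw [← hk, hH b j, mul_zero]
  · exact mul_nonneg (M.offDiag_nonneg _ _ hk) (hH0 k j)

lemma riccatiOp_quasiPositive [DecidableEq S] {s : ℝ} {X : S → M.Down → ℝ}
    (hX0 : ∀ i j, 0 ≤ X i j) (hX : ∀ b j : M.Down, X b j = if b = j then 1 else 0)
    (H : S → M.Down → ℝ) (i : S) (j : M.Down) (hH0 : ∀ i j, 0 ≤ H i j) (hij : H i j = 0) :
    0 ≤ M.riccatiOp s X H i j := by
  rcases lt_or_ge (M.c i) 0 with hi | hi
  · rw [riccatiOp_of_neg s X H hi, hij, neg_zero]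
  · rw [riccatiOp_of_nonneg s X H hi, riccatiLin]
    have hc0 : ∀ i j, 0 ≤ M.cutDown H i j := by
      intro i j
      rcases lt_or_ge (M.c i) 0 with h | h
      · rw [cutDown_of_neg H h]
      · rw [cutDown_of_nonneg H h]; exact hH0 i j
    have hcij : M.cutDown H i j = 0 := by rw [cutDown_of_nonneg H hi, hij]
    rw [hcij, mul_zero, sub_zero]
    refine add_nonneg (mul_nonneg hi (add_nonneg (Finset.sum_nonneg fun b _ => ?_)
      (Finset.sum_nonneg fun b _ => ?_))) (Finset.sum_nonneg fun k _ => ?_)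
    · by_cases hb : b = j
      · rw [hb, hcij, zero_mul]
      · exact mul_nonneg (hc0 i b) (downGen_nonneg hX0 hX hb)
    · exact mul_nonneg (hX0 i b) (downGenLin_nonneg hc0 (fun b j => cutDown_of_neg H b.2 j) b j)
    · by_cases hk : i = k
      · rw [← hk, hcij, mul_zero]
      · exact mul_nonneg (M.offDiag_nonneg _ _ hk) (hc0 k j)

end Linearization

section Blocks

variable {S : Type*} [Fintype S] {M : FluidModel S}

lemma sum_eq_sum_blocks (f : S → ℝ) :
    ∑ k, f k = ∑ k : M.Up, f k + ∑ k : M.Flat, f k + ∑ k : M.Down, f k := by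
  have h : ∀ (p : S → Prop) [DecidablePred p], ∑ k : {k // p k}, f k
      = ∑ k, if p k then f k else 0 := by
    intro p _
    rw [← Finset.sum_filter, Finset.sum_subtype (p := p) (Finset.univ.filter p) (by simp) f]
  rw [h fun k => 0 < M.c k, h fun k => M.c k = 0, h fun k => M.c k < 0, ← Finset.sum_add_distrib,
    ← Finset.sum_add_distrib]
  refine Finset.sum_congr rfl fun k _ => ?_
  rcases lt_trichotomy (M.c k) 0 with h | h | h
  · simp [h, h.ne, h.not_gt]
  · simp [h]
  · simp [h, h.ne', h.not_gt]

variable [DecidableEq S]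

lemma inv_C1_mul_apply {n : Type*} (A : Matrix M.Up n ℝ) (i : M.Up) (j : n) :
    (M.C1⁻¹ * A) i j = A i j / M.c i := by
  have h : M.C1⁻¹ = Matrix.diagonal fun i : M.Up => (M.c i)⁻¹ := by
    refine Matrix.inv_eq_right_inv ?_
    rw [C1, Matrix.diagonal_mul_diagonal, ← Matrix.diagonal_one]
    congr 1
    ext i
    exact mul_inv_cancel₀ i.2.ne'
  rw [h, Matrix.diagonal_mul]
  ring

lemma inv_C2_mul_apply {n : Type*} (A : Matrix M.Down n ℝ) (i : M.Down) (j : n) :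
    (M.C2⁻¹ * A) i j = A i j / |M.c i| := by
  have h : M.C2⁻¹ = Matrix.diagonal fun i : M.Down => |M.c i|⁻¹ := by
    refine Matrix.inv_eq_right_inv ?_
    rw [C2, Matrix.diagonal_mul_diagonal, ← Matrix.diagonal_one]
    congr 1
    ext i
    exact mul_inv_cancel₀ (abs_pos.2 i.2.ne).ne'
  rw [h, Matrix.diagonal_mul]
  ring

/-- The matrix `T₀₀ - s` is nonsingular as a quasi-positive operator that is negative on `z`. -/
lemma isUnit_det_T00_sub {s : ℝ} {z : M.Flat → ℝ} (hz : ∀ a, 0 < z a)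
    (hlt : ∀ a, ∑ b, M.T00 a b * z b < s * z a) : IsUnit (M.T00 - s • 1).det := by
  rw [isUnit_iff_ne_zero]
  intro h0
  obtain ⟨v, hv0, hv⟩ := Matrix.exists_mulVec_eq_zero_iff.2 h0
  have happ : ∀ (x : M.Flat → ℝ) a,
      (M.T00 - s • 1).mulVec x a = ∑ b, M.T00 a b * x b - s * x a := by
    intro x a
    rw [Matrix.sub_mulVec, Matrix.smul_mulVec, Matrix.one_mulVec]
    rfl
  -- vectors on the flat phases, as functions with a second index that is trivial
  let A : (M.Flat → Unit → ℝ) →ₗ[ℝ] (M.Flat → Unit → ℝ) :=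
    { toFun := fun x a _ => (M.T00 - s • 1).mulVec (fun b => x b ()) a
      map_add' := fun x y => by
        ext a
        exact congrFun (Matrix.mulVec_add (M.T00 - s • 1) (fun b => x b ()) fun b => y b ()) a
      map_smul' := fun r x => by
        ext a
        exact congrFun (Matrix.mulVec_smul (M.T00 - s • 1) r fun b => x b ()) a }
  have h1 := injective_of_quasiPositive A (Δ := fun a _ => z a) (x := fun a _ => v a) ?_
    (fun a _ => (hz a).le) ?_ ?_
  · exact hv0 (funext fun a => congrFun (congrFun h1 a) ())
  · intro x a u hx hxa
    change 0 ≤ (M.T00 - s • 1).mulVec (fun b => x b ()) a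
    rw [happ, show x a () = 0 from hxa, mul_zero, sub_zero]
    refine Finset.sum_nonneg fun b _ => ?_
    by_cases h : a = b
    · rw [← h, show x a () = 0 from hxa, mul_zero]
    · exact mul_nonneg (T00_offDiag a b h) (hx b ())
  · intro a u
    change (M.T00 - s • 1).mulVec (fun b => z b) a < 0
    rw [happ]
    linarith [hlt a]
  · ext a u
    exact congrFun hv a

section

variable [MeasurableSpace S] [MeasurableSingletonClass S]

/-- The matrix `D(s)` is the matrix `downGen` of the transform: the flat rows of the Riccati
equation eliminate the flat phases. -/
lemma D_eq_downGen {s : ℝ} (hfin : M.AllFinite s) (hdet : IsUnit (M.T00 - s • 1).det)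
    (hPsi : ∀ (i : M.Up) (j : M.Down), M.PsiMatrix s i j = M.hitMatrix s i j) :
    M.D s = Matrix.of (M.downGen s (M.hitMatrix s)) := by
  let V : Matrix M.Flat M.Down ℝ := Matrix.of fun a j => M.hitMatrix s a j
  have hdown : ∀ (f : M.Down → ℝ) (j : M.Down), ∑ b : M.Down, f b * M.hitMatrix s b j = f j := by
    intro f j
    have h : ∀ b : M.Down, M.hitMatrix s b j = if b = j then 1 else 0 := fun b => by
      rw [hitMatrix_of_neg s b.2]
      simp only [Subtype.ext_iff]
    simp [h]
  have hV : (M.T00 - s • 1) * V = -(M.T01 * M.PsiMatrix s + M.T02) := by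
    ext a j
    have h1 := riccati_hitMatrix hfin a j
    rw [riccati, a.2, zero_mul, zero_add, sum_eq_sum_blocks (M := M), hdown] at h1
    rw [Matrix.sub_mul, Matrix.smul_mul, Matrix.one_mul]
    simp only [Matrix.sub_apply, Matrix.smul_apply, Matrix.neg_apply, Matrix.add_apply,
      Matrix.mul_apply, hPsi, smul_eq_mul, V, Matrix.of_apply, T00, T01, T02,
      Matrix.submatrix_apply]
    linarith
  have hV2 : V = -((M.T00 - s • 1)⁻¹ * (M.T01 * M.PsiMatrix s + M.T02)) := by
    rw [← Matrix.mul_neg, ← hV, ← Matrix.mul_assoc, Matrix.nonsing_inv_mul _ hdet, Matrix.one_mul]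
  have h1 : M.D s = M.C2⁻¹ * (M.T22 - s • 1 + M.T21 * M.PsiMatrix s + M.T20 * V) := by
    rw [D, Q22, Q21, hV2]
    simp only [Matrix.mul_add, Matrix.mul_sub, Matrix.sub_mul, Matrix.mul_neg, Matrix.mul_assoc]
    abel
  rw [h1]
  ext b j
  rw [inv_C2_mul_apply, Matrix.of_apply, downGen, sum_eq_sum_blocks (M := M), hdown]
  congr 1
  simp only [Matrix.add_apply, Matrix.sub_apply, Matrix.smul_apply, Matrix.mul_apply, hPsi,
    smul_eq_mul, V, Matrix.of_apply, T22, T21, T20, Matrix.submatrix_apply, Matrix.one_apply,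
    hitMatrix_of_neg s b.2, ← Subtype.ext_iff]
  ring

/-- In a direction whose flat part solves the linearized flat rows, the linearization of the Riccati
expression is the Sylvester operator of `K(s)` and `D(s)`. -/
lemma riccatiLin_eq_sylvester {s : ℝ} (hfin : M.AllFinite s) (hdet : IsUnit (M.T00 - s • 1).det)
    (hPsi : ∀ (i : M.Up) (j : M.Down), M.PsiMatrix s i j = M.hitMatrix s i j)
    {H : S → M.Down → ℝ} (hH : ∀ b j : M.Down, H b j = 0)
    (H₁ : Matrix M.Up M.Down ℝ) (hH₁ : ∀ i j, H₁ i j = H i j)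
    (H₀ : Matrix M.Flat M.Down ℝ) (hH₀ : ∀ i j, H₀ i j = H i j)
    (hflat : H₀ = -((M.T00 - s • 1)⁻¹ * (M.T01 * H₁))) (i : M.Up) (j : M.Down) :
    M.riccatiLin s (M.hitMatrix s) H i j = M.c i * (M.K s * H₁ + H₁ * M.D s) i j := by
  have h1 : M.K s * H₁ = M.C1⁻¹ * (M.T11 * H₁ - s • H₁ + M.T10 * H₀)
      + M.PsiMatrix s * (M.C2⁻¹ * (M.T21 * H₁ + M.T20 * H₀)) := by
    rw [K, Q11, Q21, hflat]
    simp only [Matrix.add_mul, Matrix.mul_add, Matrix.mul_sub, Matrix.sub_mul, Matrix.mul_neg,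
      Matrix.mul_assoc, Matrix.smul_mul, Matrix.mul_smul, Matrix.one_mul]
    abel
  have hz : ∀ f : M.Down → ℝ, ∑ b : M.Down, f b * H b j = 0 := fun f =>
    Finset.sum_eq_zero fun b _ => by rw [hH b j, mul_zero]
  have h2 : ∀ b, M.downGenLin H b j = (M.C2⁻¹ * (M.T21 * H₁ + M.T20 * H₀)) b j := by
    intro b
    rw [inv_C2_mul_apply, downGenLin, sum_eq_sum_blocks (M := M), hz, add_zero]
    simp only [Matrix.add_apply, Matrix.mul_apply, hH₁, hH₀, T21, T20, Matrix.submatrix_apply]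
  have h3 : M.c i * (M.C1⁻¹ * (M.T11 * H₁ - s • H₁ + M.T10 * H₀)) i j
      = ∑ k, M.T i k * H k j - s * H i j := by
    rw [inv_C1_mul_apply, mul_div_cancel₀ _ i.2.ne', sum_eq_sum_blocks (M := M), hz]
    simp only [Matrix.add_apply, Matrix.sub_apply, Matrix.smul_apply, Matrix.mul_apply, hH₁, hH₀,
      smul_eq_mul, T11, T10, Matrix.submatrix_apply]
    ring
  generalize M.C2⁻¹ * (M.T21 * H₁ + M.T20 * H₀) = P at h1 h2
  rw [h1, D_eq_downGen hfin hdet hPsi, riccatiLin]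
  simp only [Matrix.add_apply, mul_add, h3, h2]
  simp only [Matrix.mul_apply (M := M.PsiMatrix s), hPsi, Matrix.mul_apply (M := H₁),
    Matrix.of_apply, hH₁]
  ring

/-- The matrices `K(s)` and `-D(s)` have a common eigenvalue exactly where the linearization of the
Riccati equation is singular. -/
theorem commonEigenvalue_iff {s : ℝ} (hfin : M.AllFinite s) (hdet : IsUnit (M.T00 - s • 1).det)
    (hPsi : ∀ (i : M.Up) (j : M.Down), M.PsiMatrix s i j = M.hitMatrix s i j) :
    M.CommonEigenvalue s ↔ ∃ H, H ≠ 0 ∧ M.riccatiOp s (M.hitMatrix s) H = 0 := by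
  constructor
  · intro h
    obtain ⟨H₁, hne, hsyl⟩ := exists_sylvester_of_spectrum h
    let H₀ : Matrix M.Flat M.Down ℝ := -((M.T00 - s • 1)⁻¹ * (M.T01 * H₁))
    let H : S → M.Down → ℝ := fun i j =>
      if h : 0 < M.c i then H₁ ⟨i, h⟩ j else if h : M.c i = 0 then H₀ ⟨i, h⟩ j else 0
    have hH₁ : ∀ i j, H₁ i j = H i j := fun i j => by simp [H, i.2]
    have hH₀ : ∀ i j, H₀ i j = H i j := fun i j => by simp [H, i.2]
    have hH : ∀ b j : M.Down, H b j = 0 := fun b j => by simp [H, b.2.not_gt, b.2.ne]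
    refine ⟨H, fun h0 => hne ?_, ?_⟩
    · ext i j
      rw [hH₁, h0]; rfl
    · ext i j
      rcases lt_trichotomy (M.c i) 0 with hi | hi | hi
      · rw [riccatiOp_of_neg _ _ _ hi, hH ⟨i, hi⟩ j]
        simp
      · rw [riccatiOp_of_nonneg _ _ _ hi.ge, cutDown_eq_self hH, riccatiLin, hi, zero_mul, zero_add,
          sum_eq_sum_blocks (M := M)]
        have h1 : (M.T00 - s • 1) * H₀ = -(M.T01 * H₁) := by
          rw [Matrix.mul_neg, Matrix.mul_nonsing_inv_cancel_left _ _ hdet]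
        have h2 := congrFun (congrFun h1 ⟨i, hi⟩) j
        rw [Matrix.sub_mul, Matrix.smul_mul, Matrix.one_mul] at h2
        simp only [Matrix.sub_apply, Matrix.smul_apply, Matrix.neg_apply, Matrix.mul_apply,
          hH₁, hH₀, smul_eq_mul, T00, T01, Matrix.submatrix_apply] at h2
        simp only [hH, mul_zero, Finset.sum_const_zero, Pi.zero_apply]
        linarith
      · rw [riccatiOp_of_nonneg _ _ _ hi.le, cutDown_eq_self hH]
        have h1 := riccatiLin_eq_sylvester hfin hdet hPsi hH H₁ hH₁ H₀ hH₀ rfl ⟨i, hi⟩ j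
        rw [hsyl] at h1
        simpa using h1
  · rintro ⟨H, hne, hop⟩
    have hH : ∀ b j : M.Down, H b j = 0 := by
      intro b j
      have := congrFun (congrFun hop b.1) j
      rw [riccatiOp_of_neg _ _ _ b.2] at this
      simpa using this
    let H₁ : Matrix M.Up M.Down ℝ := Matrix.of fun i j => H i j
    let H₀ : Matrix M.Flat M.Down ℝ := Matrix.of fun i j => H i j
    have h1 : (M.T00 - s • 1) * H₀ = -(M.T01 * H₁) := by
      ext a j
      have h2 := congrFun (congrFun hop a.1) j
      rw [riccatiOp_of_nonneg _ _ _ a.2.ge, cutDown_eq_self hH, riccatiLin, a.2, zero_mul, zero_add,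
        sum_eq_sum_blocks (M := M)] at h2
      rw [Matrix.sub_mul, Matrix.smul_mul, Matrix.one_mul]
      simp only [Matrix.sub_apply, Matrix.smul_apply, Matrix.neg_apply, Matrix.mul_apply,
        smul_eq_mul, T00, T01, Matrix.submatrix_apply, H₁, H₀, Matrix.of_apply]
      simp only [hH, mul_zero, Finset.sum_const_zero, Pi.zero_apply] at h2
      linarith
    have hflat : H₀ = -((M.T00 - s • 1)⁻¹ * (M.T01 * H₁)) := by
      rw [← Matrix.mul_neg, ← h1, Matrix.nonsing_inv_mul_cancel_left _ _ hdet]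
    refine spectrum_inter_of_sylvester (H := H₁) (fun h0 => hne ?_) ?_
    · have h2 : H₀ = 0 := by rw [hflat, h0]; simp
      ext i j
      rcases lt_trichotomy (M.c i) 0 with hi | hi | hi
      · exact hH ⟨i, hi⟩ j
      · exact congrFun (congrFun h2 ⟨i, hi⟩) j
      · exact congrFun (congrFun h0 ⟨i, hi⟩) j
    · ext i j
      have h2 := riccatiLin_eq_sylvester hfin hdet hPsi hH H₁ (fun _ _ => rfl) H₀ (fun _ _ => rfl)
        hflat i j
      have h3 := congrFun (congrFun hop i.1) j
      rw [riccatiOp_of_nonneg _ _ _ i.2.le, cutDown_eq_self hH, h2] at h3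
      exact (mul_eq_zero.1 h3).resolve_left i.2.ne'

end

end Blocks

/-! ### Drift, and the least discount rate with finite transform -/

section Drift

variable {S : Type*} [Fintype S] {M : FluidModel S}

lemma T_diag_neg (hirr : M.Irreducible) (hup : ∃ i, 0 < M.c i) (hdown : ∃ j, M.c j < 0) (i : S) :
    M.T i i < 0 := by
  classical
  obtain ⟨k, hk⟩ : ∃ k, k ≠ i := by
    obtain ⟨u, hu⟩ := hup
    obtain ⟨d, hd⟩ := hdown
    by_cases h : u = i
    · refine ⟨d, fun h' => ?_⟩
      rw [h', ← h] at hd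
      exact lt_asymm hu hd
    · exact ⟨u, h⟩
  rcases (hirr i k).cases_head with h | ⟨l, hl, -⟩
  · exact absurd h.symm hk
  · have hli : l ≠ i := by
      rintro rfl
      exact absurd hl (not_lt.2 (M.diag_nonpos l))
    have h1 := M.row_sum i
    rw [← Finset.add_sum_erase _ _ (Finset.mem_univ i)] at h1
    have h2 : M.T i l ≤ ∑ j ∈ Finset.univ.erase i, M.T i j :=
      Finset.single_le_sum (f := fun j => M.T i j)
        (fun j hj => M.offDiag_nonneg i j (Finset.ne_of_mem_erase hj).symm)
        (Finset.mem_erase.2 ⟨hli, Finset.mem_univ l⟩)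
    linarith

/-- Maximum principle: harmonic functions of an irreducible generator are constant. -/
lemma eq_of_harmonic (hirr : M.Irreducible) {x : S → ℝ} (hx : ∀ i, ∑ k, M.T i k * x k = 0)
    (a b : S) : x a = x b := by
  have : Nonempty S := ⟨a⟩
  obtain ⟨i, hi⟩ := Finite.exists_max x
  have h : ∀ k, x k = x i := by
    intro k
    induction hirr i k with
    | refl => rfl
    | @tail b k _ hbk ih =>
      have h1 : ∑ m, M.T b m * (x m - x b) = 0 := by
        simp_rw [mul_sub, Finset.sum_sub_distrib, ← Finset.sum_mul, hx b, M.row_sum b]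
        simp
      have h2 : ∀ m ∈ Finset.univ, M.T b m * (x m - x b) ≤ 0 := by
        intro m _
        by_cases hbm : b = m
        · simp [hbm]
        · refine mul_nonpos_of_nonneg_of_nonpos (M.offDiag_nonneg b m hbm) ?_
          rw [ih]
          linarith [hi m]
      have h3 := (Finset.sum_eq_zero_iff_of_nonpos h2).1 h1 k (Finset.mem_univ k)
      have h4 := (mul_eq_zero.1 h3).resolve_left hbk.ne'
      linarith
  rw [h a, h b]

/-- The Poisson equation for the rates: the range of `T` is the annihilator of `ξ`, because it is
contained in it and, by the maximum principle, has codimension at most one. -/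
lemma exists_poisson (hirr : M.Irreducible) {ξ : S → ℝ} (hξ : M.IsStationary ξ) :
    ∃ g : S → ℝ, ∀ i, ∑ k, M.T i k * g k = -M.c i + ∑ k, M.c k * ξ k := by
  obtain ⟨-, hsum, hstat⟩ := hξ
  let φ : (S → ℝ) →ₗ[ℝ] ℝ := ∑ i, ξ i • LinearMap.proj i
  have hφ : ∀ x, φ x = ∑ i, ξ i * x i := fun x => by simp [φ]
  have hle : LinearMap.range M.T.mulVecLin ≤ LinearMap.ker φ := by
    rintro _ ⟨x, rfl⟩
    rw [LinearMap.mem_ker, hφ]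
    simp only [Matrix.mulVecLin_apply, Matrix.mulVec, dotProduct, Finset.mul_sum]
    rw [Finset.sum_comm]
    refine Finset.sum_eq_zero fun k _ => ?_
    simp_rw [← mul_assoc]
    rw [← Finset.sum_mul, hstat k, zero_mul]
  have hker : Module.finrank ℝ (LinearMap.ker M.T.mulVecLin) ≤ 1 := by
    have h1 : LinearMap.ker M.T.mulVecLin ≤ Submodule.span ℝ {fun _ => (1 : ℝ)} := by
      intro x hx
      rw [LinearMap.mem_ker] at hx
      have hx' : ∀ i, ∑ k, M.T i k * x k = 0 := fun i => congrFun hx i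
      rw [Submodule.mem_span_singleton]
      rcases isEmpty_or_nonempty S with h | ⟨⟨a⟩⟩
      · exact ⟨0, Subsingleton.elim _ _⟩
      · exact ⟨x a, funext fun b => by simp [eq_of_harmonic hirr hx' a b]⟩
    exact (Submodule.finrank_mono h1).trans ((finrank_span_le_card _).trans (by simp))
  have hsurj : LinearMap.range φ = ⊤ := by
    rw [LinearMap.range_eq_top]
    intro r
    refine ⟨fun _ => r, ?_⟩
    rw [hφ, ← Finset.sum_mul, hsum, one_mul]
  have h1 := LinearMap.finrank_range_add_finrank_ker M.T.mulVecLin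
  have h2 := LinearMap.finrank_range_add_finrank_ker φ
  rw [hsurj, finrank_top, Module.finrank_self] at h2
  have heq := Submodule.eq_of_le_of_finrank_le hle (by omega)
  have hmem : (fun i => -M.c i + ∑ k, M.c k * ξ k) ∈ LinearMap.ker φ := by
    rw [LinearMap.mem_ker, hφ]
    simp_rw [mul_add, Finset.sum_add_distrib, ← Finset.sum_mul, hsum, one_mul, mul_neg,
      Finset.sum_neg_distrib]
    rw [Finset.sum_congr rfl fun i _ => mul_comm (ξ i) (M.c i)]
    ring
  rw [← heq] at hmem
  obtain ⟨g, hg⟩ := hmem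
  exact ⟨g, fun i => congrFun hg i⟩

/-- Negative drift gives exponential moments of the passage times: for a solution `g` of the Poisson
equation and small `r > 0`, `e^{ry} (1 + r g)` is a supersolution at some negative discount
rate. -/
theorem exists_allFinite_neg [DecidableEq S] (hirr : M.Irreducible) {ξ : S → ℝ}
    (hξ : M.IsStationary ξ) (hstable : ∑ i, M.c i * ξ i < 0) : ∃ s < 0, M.AllFinite s := by
  obtain ⟨g, hg⟩ := exists_poisson hirr hξ
  set d := ∑ i, M.c i * ξ i with hd
  obtain ⟨r, hr, hr1, hr2⟩ : ∃ r : ℝ, 0 < r ∧ (∀ i, 0 < 1 + r * g i) ∧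
      ∀ i, d + r * (M.c i * g i) < 0 := by
    have h1 : ∀ᶠ r : ℝ in 𝓝[>] 0, ∀ i, 0 < 1 + r * g i := by
      refine eventually_all.2 fun i => ?_
      have : Tendsto (fun r : ℝ => 1 + r * g i) (𝓝[>] 0) (𝓝 (1 + 0 * g i)) :=
        (Continuous.tendsto (by fun_prop) 0).mono_left nhdsWithin_le_nhds
      exact this.eventually_const_lt (by simp)
    have h2 : ∀ᶠ r : ℝ in 𝓝[>] 0, ∀ i, d + r * (M.c i * g i) < 0 := by
      refine eventually_all.2 fun i => ?_
      have : Tendsto (fun r : ℝ => d + r * (M.c i * g i)) (𝓝[>] 0)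
          (𝓝 (d + 0 * (M.c i * g i))) :=
        (Continuous.tendsto (by fun_prop) 0).mono_left nhdsWithin_le_nhds
      exact this.eventually_lt_const (by simpa using hstable)
    obtain ⟨r, h⟩ := (eventually_mem_nhdsWithin.and (h1.and h2)).exists
    exact ⟨r, h.1, h.2.1, h.2.2⟩
  obtain ⟨s, hs, hs1⟩ : ∃ s < (0 : ℝ), ∀ i,
      r * (d + r * (M.c i * g i)) - s * (1 + r * g i) < 0 := by
    have h1 : ∀ᶠ s : ℝ in 𝓝[<] 0, ∀ i,
        r * (d + r * (M.c i * g i)) - s * (1 + r * g i) < 0 := by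
      refine eventually_all.2 fun i => ?_
      have : Tendsto (fun s : ℝ => r * (d + r * (M.c i * g i)) - s * (1 + r * g i)) (𝓝[<] 0)
          (𝓝 (r * (d + r * (M.c i * g i)) - 0 * (1 + r * g i))) :=
        (Continuous.tendsto (by fun_prop) 0).mono_left nhdsWithin_le_nhds
      refine this.eventually_lt_const ?_
      rw [zero_mul, sub_zero]
      exact mul_neg_of_pos_of_neg hr (hr2 i)
    obtain ⟨s, h⟩ := (eventually_mem_nhdsWithin.and h1).exists
    exact ⟨s, h.1, h.2⟩
  refine ⟨s, hs, fun j i y hy => ?_⟩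
  have h := passage_le_of_supersolution (M := M) (s := s) (j := j.1)
    (f := fun y i => Real.exp (r * y) * ((1 + r * g i) / (1 + r * g j)))
    (f' := fun y i => Real.exp (r * y) * r * ((1 + r * g i) / (1 + r * g j)))
    (fun y i => by
      have h1 : HasDerivAt (fun y : ℝ => r * y) r y := by
        simpa using (hasDerivAt_id' y).const_mul r
      exact h1.exp.mul_const _)
    (fun y _ i => mul_nonneg (Real.exp_nonneg _) (div_nonneg (hr1 i).le (hr1 j).le))
    (fun y _ i => by
      have hj := (hr1 j).ne'
      have h1 : ∑ k, M.T i k * (Real.exp (r * y) * ((1 + r * g k) / (1 + r * g j)))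
          = Real.exp (r * y) / (1 + r * g j) * (r * (-M.c i + d)) := by
        rw [← hg i]
        have h2 : ∑ k, M.T i k * (1 + r * g k) = r * ∑ k, M.T i k * g k := by
          simp_rw [mul_add, mul_one, Finset.sum_add_distrib, M.row_sum i, Finset.mul_sum, zero_add]
          exact Finset.sum_congr rfl fun k _ => by ring
        rw [← h2, Finset.mul_sum]
        exact Finset.sum_congr rfl fun k _ => by ring
      rw [h1]
      have h3 : M.c i * (Real.exp (r * y) * r * ((1 + r * g i) / (1 + r * g j)))
          + Real.exp (r * y) / (1 + r * g j) * (r * (-M.c i + d))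
          - s * (Real.exp (r * y) * ((1 + r * g i) / (1 + r * g j)))
          = Real.exp (r * y) / (1 + r * g j)
            * (r * (d + r * (M.c i * g i)) - s * (1 + r * g i)) := by ring
      rw [h3]
      exact mul_nonpos_of_nonneg_of_nonpos (div_nonneg (Real.exp_nonneg _) (hr1 j).le) (hs1 i).le)
    (by simp [div_self (hr1 j).ne']) hy i
  exact ne_top_of_le_ne_top ENNReal.ofReal_ne_top h

end Drift

section Abscissa

variable {S : Type*} [Fintype S] {M : FluidModel S}

lemma continuous_riccatiLin (H : S → M.Down → ℝ) (i : S) (j : M.Down) :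
    Continuous fun p : ℝ × (S → M.Down → ℝ) => M.riccatiLin p.1 p.2 H i j := by
  unfold riccatiLin downGen
  fun_prop

lemma continuous_riccati (X : S → M.Down → ℝ) (i : S) (j : M.Down) :
    Continuous fun s : ℝ => M.riccati s X i j := by
  unfold riccati downGen
  fun_prop

variable [DecidableEq S]

lemma hitMatrix_down (s : ℝ) (b j : M.Down) : M.hitMatrix s b j = if b = j then 1 else 0 := by
  rw [hitMatrix_of_neg s b.2 j]
  simp only [Subtype.ext_iff]

lemma allFinite_mono {s s' : ℝ} (h : M.AllFinite s') (hs : s' ≤ s) : M.AllFinite s :=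
  fun j i y hy => ne_top_of_le_ne_top (h j i y hy) (passage_anti hs j.1 i hy)

/-- The quadratic term of the Riccati equation bounds the transform in the phases to which a
decreasing phase `k` can jump: in the row of an increasing phase `l` and the column `k`, the terms
that do not contain the entry `(l, k)` as a factor are nonnegative, so dividing by this positive
entry bounds the coefficient `downGen` at `(k, k)`. -/
lemma T_mul_hitMatrix_le (hirr : M.Irreducible) {s : ℝ} (hfin : M.AllFinite s) (l : M.Up)
    (k : M.Down) {x : S} (hx : x ≠ k) :
    M.T k x * M.hitMatrix s x k ≤ s - M.T k k + |M.c k| * (s - M.T l l) / M.c l := by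
  have h1 := riccati_hitMatrix hfin l k
  rw [riccati] at h1
  have hpos : 0 < M.hitMatrix s l k := ENNReal.toReal_pos
    (passage_zero_pos hirr s k l.2).ne' (hfin k l 0 le_rfl)
  have hnn := fun i j => hitMatrix_nonneg (M := M) s i j
  have h2 : M.hitMatrix s l k * M.downGen s (M.hitMatrix s) k k
      ≤ ∑ b, M.hitMatrix s l b * M.downGen s (M.hitMatrix s) b k := by
    rw [← Finset.add_sum_erase _ _ (Finset.mem_univ k)]
    refine le_add_of_nonneg_right (Finset.sum_nonneg fun b hb => mul_nonneg (hnn _ _) ?_)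
    exact downGen_nonneg hnn (hitMatrix_down s) (Finset.ne_of_mem_erase hb)
  have h3 : M.T l l * M.hitMatrix s l k ≤ ∑ m, M.T l m * M.hitMatrix s m k := by
    rw [← Finset.add_sum_erase _ _ (Finset.mem_univ l.1)]
    refine le_add_of_nonneg_right (Finset.sum_nonneg fun b hb => mul_nonneg ?_ (hnn _ _))
    exact M.offDiag_nonneg _ _ (Finset.ne_of_mem_erase hb).symm
  have hcl : 0 < M.c l := l.2
  have h4 : M.hitMatrix s l k * (M.c l * M.downGen s (M.hitMatrix s) k k + M.T l l - s) ≤ 0 := by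
    have := mul_le_mul_of_nonneg_left h2 hcl.le
    linarith
  have h5 : M.c l * M.downGen s (M.hitMatrix s) k k ≤ s - M.T l l := by
    by_contra! h
    have := mul_pos hpos (by linarith : 0 < M.c l * M.downGen s (M.hitMatrix s) k k + M.T l l - s)
    linarith
  have h6 : M.T k k + M.T k x * M.hitMatrix s x k ≤ ∑ m, M.T k m * M.hitMatrix s m k := by
    rw [← Finset.add_sum_erase _ _ (Finset.mem_univ k.1), hitMatrix_down, if_pos rfl, mul_one]
    gcongr
    refine Finset.single_le_sum (f := fun m => M.T k m * M.hitMatrix s m k) (fun b hb => ?_)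
      (Finset.mem_erase.2 ⟨hx, Finset.mem_univ x⟩)
    exact mul_nonneg (M.offDiag_nonneg _ _ (Finset.ne_of_mem_erase hb).symm) (hnn _ _)
  have hck : 0 < |M.c k| := abs_pos.2 k.2.ne
  have h7 : |M.c k| * M.downGen s (M.hitMatrix s) k k
      = ∑ m, M.T k m * M.hitMatrix s m k - s := by
    rw [downGen, mul_div_cancel₀ _ hck.ne', hitMatrix_down, if_pos rfl, mul_one]
  have h8 : |M.c k| * M.downGen s (M.hitMatrix s) k k ≤ |M.c k| * (s - M.T l l) / M.c l := by
    rw [mul_div_assoc]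
    refine mul_le_mul_of_nonneg_left ?_ hck.le
    rw [le_div_iff₀ hcl]
    linarith
  linarith

/-- The bound of `T_mul_hitMatrix_le` is nonnegative wherever the transform is finite, and it is
increasing and affine in the discount rate. -/
lemma bddBelow_allFinite (hirr : M.Irreducible) (l : M.Up) (k : M.Down) :
    BddBelow {s | M.AllFinite s} := by
  have hcl : 0 < M.c l := l.2
  have hck : 0 < |M.c k| := abs_pos.2 k.2.ne
  have hlk : l.1 ≠ k := fun h => lt_asymm l.2 (h ▸ k.2)
  refine ⟨(M.T k k + |M.c k| * M.T l l / M.c l) / (1 + |M.c k| / M.c l), fun s hs => ?_⟩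
  have h1 := T_mul_hitMatrix_le hirr hs l k hlk
  have h2 := mul_nonneg (M.offDiag_nonneg k l hlk.symm) (hitMatrix_nonneg (M := M) s l k)
  rw [div_le_iff₀ (by positivity)]
  have h3 : |M.c k| * (s - M.T l l) / M.c l
      = s * (|M.c k| / M.c l) - |M.c k| * M.T l l / M.c l := by ring
  linarith

/-- The infimum of the discount rates with finite transform is attained. The bound by the Riccati
equation passes to the limit, and finiteness then spreads along a path from a decreasing to an
increasing phase. -/
theorem allFinite_of_tendsto (hirr : M.Irreducible) (l : M.Up) (k : M.Down) {s : ℝ} {σ : ℕ → ℝ}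
    (hσ : Antitone σ) (hlim : Tendsto σ atTop (𝓝 s)) (hfin : ∀ n, M.AllFinite (σ n)) :
    M.AllFinite s := by
  have key : ∀ z, Relation.ReflTransGen (fun a b => 0 < M.T a b) k.1 z →
      ∃ j : M.Down, M.passage s j 0 z ≠ ∞ := by
    intro z hkz
    induction hkz with
    | refl =>
      refine ⟨k, ?_⟩
      rw [passage_zero_of_neg k.2]
      simp
    | @tail z z' _ hz ih =>
      obtain ⟨j, hj⟩ := ih
      rcases lt_or_ge (M.c z') 0 with hz' | hz'
      · refine ⟨⟨z', hz'⟩, ?_⟩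
        rw [passage_zero_of_neg hz']
        simp
      rcases lt_trichotomy (M.c z) 0 with h | h | h
      · refine ⟨⟨z, h⟩, ?_⟩
        have hne : z' ≠ z := fun h' => absurd h (not_lt.2 (h' ▸ hz'))
        rw [← iSup_passage_eq hσ hlim z z' le_rfl]
        refine ne_top_of_le_ne_top (ENNReal.ofReal_ne_top
          (r := (σ 0 - M.T z z + |M.c z| * (σ 0 - M.T l l) / M.c l) / M.T z z'))
          (iSup_le fun n => ?_)
        rw [← ENNReal.ofReal_toReal (hfin n ⟨z, h⟩ z' 0 le_rfl)]
        apply ENNReal.ofReal_le_ofReal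
        have h1 := T_mul_hitMatrix_le hirr (hfin n) l ⟨z, h⟩ hne
        have h2 : σ n ≤ σ 0 := hσ n.zero_le
        have hcl : 0 < M.c l := l.2
        rw [le_div_iff₀ hz, mul_comm]
        refine h1.trans ?_
        dsimp only
        gcongr
      · -- the level does not move in the flat phase `z`, so the jump finds it at zero
        obtain ⟨τ, -, h1⟩ := exists_passage_ne_top one_pos le_rfl (by simp [h]) hj hz
        refine ⟨j, ?_⟩
        simpa [h] using h1
      · exact ⟨j, passage_ne_top_of_up hirr h hj j z' le_rfl⟩
  obtain ⟨j, hj⟩ := key l (hirr k l)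
  exact fun j' i y hy => passage_ne_top_of_up hirr l.2 hj j' i hy

lemma tendsto_hitMatrix {s : ℝ} {σ : ℕ → ℝ} (hσ : Antitone σ) (hlim : Tendsto σ atTop (𝓝 s))
    (hfin : M.AllFinite s) : Tendsto (fun n => M.hitMatrix (σ n)) atTop (𝓝 (M.hitMatrix s)) := by
  refine tendsto_pi_nhds.2 fun i => tendsto_pi_nhds.2 fun j => ?_
  refine (ENNReal.tendsto_toReal (hfin j i 0 le_rfl)).comp ?_
  rw [← iSup_passage_eq hσ hlim j.1 i le_rfl]
  exact tendsto_atTop_iSup fun m n hmn => passage_anti (hσ hmn) j.1 i le_rfl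

/-- Above the least discount rate with finite transform, the decrease of the transform in the
discount rate provides a nonnegative direction in which the linearized Riccati operator is
negative. The flat phases are treated by adding a multiple of a positive vector. -/
lemma exists_riccatiOp_neg (hirr : M.Irreducible) (j₀ : M.Down) {s₁ s : ℝ} (hs : s₁ < s)
    (hfin : M.AllFinite s₁) : ∃ Δ : S → M.Down → ℝ, (∀ i j, 0 ≤ Δ i j) ∧
      ∀ i j, M.riccatiOp s (M.hitMatrix s) Δ i j < 0 := by
  have hfin' := allFinite_mono hfin hs.le
  obtain ⟨z, hz, hzlt⟩ := exists_flat_pos hirr j₀ hfin'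
  set Δ₀ : S → M.Down → ℝ := M.hitMatrix s₁ - M.hitMatrix s with hΔ₀
  have hΔ0 : ∀ i j, 0 ≤ Δ₀ i j := fun i j => sub_nonneg.2
    (ENNReal.toReal_mono (hfin j i 0 le_rfl) (passage_anti hs.le j.1 i le_rfl))
  have hΔdown : ∀ b j : M.Down, Δ₀ b j = 0 := fun b j => by
    simp [hΔ₀, hitMatrix_down]
  have hLΔ : ∀ i, 0 ≤ M.c i → ∀ j, M.riccatiOp s (M.hitMatrix s) Δ₀ i j
      ≤ -((s - s₁) * (M.c i / |M.c j| + 1) * M.hitMatrix s₁ i j) := by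
    intro i hi j
    rw [riccatiOp_of_nonneg _ _ _ hi, cutDown_eq_self hΔdown]
    have h1 := riccati_add s (M.hitMatrix s) hΔdown i j
    have h2 := riccati_sub_rate s₁ s (M.hitMatrix s₁) i j
    have h3 : M.hitMatrix s + Δ₀ = M.hitMatrix s₁ := by rw [hΔ₀]; abel
    have h4 : 0 ≤ M.c i * ∑ b, Δ₀ i b * M.downGenLin Δ₀ b j :=
      mul_nonneg hi (Finset.sum_nonneg fun b _ =>
        mul_nonneg (hΔ0 i b) (downGenLin_nonneg hΔ0 hΔdown b j))
    have h5 : ∑ b : M.Down, M.hitMatrix s₁ i b * (M.hitMatrix s₁ b j / |M.c b|)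
        = M.hitMatrix s₁ i j / |M.c j| := by
      rw [Finset.sum_eq_single j]
      · rw [hitMatrix_down, if_pos rfl, mul_one_div]
      · intro b _ hb
        rw [hitMatrix_down, if_neg hb, zero_div, mul_zero]
      · simp
    rw [h3, h2, riccati_hitMatrix hfin, riccati_hitMatrix hfin', h5] at h1
    have h6 : (s₁ - s) * (M.c i * (M.hitMatrix s₁ i j / |M.c j|) + M.hitMatrix s₁ i j)
        = -((s - s₁) * (M.c i / |M.c j| + 1) * M.hitMatrix s₁ i j) := by ring
    linarith
  -- `Z` is negative under the operator on the decreasing and the flat phases; a small multiple of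
  -- it does not destroy the strict inequality on the increasing phases
  let Z : S → M.Down → ℝ := fun i _ =>
    if M.c i < 0 then 1 else if h : M.c i = 0 then z ⟨i, h⟩ else 0
  have hZ0 : ∀ i j, 0 ≤ Z i j := by
    intro i j
    simp only [Z]
    split_ifs with h1 h2
    · exact zero_le_one
    · exact (hz _).le
    · exact le_rfl
  have hZflat : ∀ i, M.c i = 0 → ∀ j, M.riccatiOp s (M.hitMatrix s) Z i j < 0 := by
    intro i hi j
    have h1 : ∑ k : M.Up, M.T i k * M.cutDown Z k j = 0 := Finset.sum_eq_zero fun k _ => by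
      rw [cutDown_of_nonneg Z k.2.le]
      simp [Z, k.2.not_gt, k.2.ne']
    have h2 : ∑ k : M.Down, M.T i k * M.cutDown Z k j = 0 := Finset.sum_eq_zero fun k _ => by
      rw [cutDown_of_neg Z k.2, mul_zero]
    have h3 : ∀ k : M.Flat, M.cutDown Z k j = z k := fun k => by
      rw [cutDown_of_nonneg Z k.2.ge]
      simp [Z, k.2]
    rw [riccatiOp_of_nonneg _ _ _ hi.ge, riccatiLin, hi, zero_mul, zero_add,
      sum_eq_sum_blocks (M := M), h1, h2, zero_add, add_zero, h3 ⟨i, hi⟩]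
    simp_rw [h3]
    exact sub_neg.2 (hzlt ⟨i, hi⟩)
  obtain ⟨η, hη, hη1⟩ : ∃ η : ℝ, 0 < η ∧ ∀ i, 0 < M.c i → ∀ j,
      M.riccatiOp s (M.hitMatrix s) Δ₀ i j + η * M.riccatiOp s (M.hitMatrix s) Z i j < 0 := by
    have h1 : ∀ᶠ η : ℝ in 𝓝[>] 0, ∀ i, ∀ j, 0 < M.c i →
        M.riccatiOp s (M.hitMatrix s) Δ₀ i j + η * M.riccatiOp s (M.hitMatrix s) Z i j < 0 := by
      refine eventually_all.2 fun i => eventually_all.2 fun j => ?_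
      by_cases hi : 0 < M.c i
      · have h2 : M.riccatiOp s (M.hitMatrix s) Δ₀ i j < 0 := by
          refine (hLΔ i hi.le j).trans_lt (neg_lt_zero.2 ?_)
          have h3 : 0 < M.hitMatrix s₁ i j := ENNReal.toReal_pos
            (passage_zero_pos hirr s₁ j hi).ne' (hfin j i 0 le_rfl)
          have h4 := sub_pos.2 hs
          positivity
        have h3 : Tendsto (fun η : ℝ => M.riccatiOp s (M.hitMatrix s) Δ₀ i j
            + η * M.riccatiOp s (M.hitMatrix s) Z i j) (𝓝[>] 0)
            (𝓝 (M.riccatiOp s (M.hitMatrix s) Δ₀ i j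
              + 0 * M.riccatiOp s (M.hitMatrix s) Z i j)) :=
          (Continuous.tendsto (by fun_prop) 0).mono_left nhdsWithin_le_nhds
        filter_upwards [h3.eventually_lt_const (by simpa using h2)] with η hη _ using hη
      · exact Eventually.of_forall fun _ h => absurd h hi
    obtain ⟨η, h⟩ := (eventually_mem_nhdsWithin.and h1).exists
    exact ⟨η, h.1, fun i hi j => h.2 i j hi⟩
  refine ⟨Δ₀ + η • Z, fun i j => add_nonneg (hΔ0 i j) (mul_nonneg hη.le (hZ0 i j)), fun i j => ?_⟩
  rw [map_add, map_smul]
  simp only [Pi.add_apply, Pi.smul_apply, smul_eq_mul]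
  rcases lt_trichotomy (M.c i) 0 with hi | hi | hi
  · rw [riccatiOp_of_neg _ _ _ hi, riccatiOp_of_neg _ _ _ hi, hΔdown ⟨i, hi⟩ j]
    simp [Z, hi, hη]
  · have h1 := hLΔ i hi.ge j
    have h2 := mul_neg_of_pos_of_neg hη (hZflat i hi j)
    have h3 : 0 ≤ (s - s₁) * (M.c i / |M.c j| + 1) * M.hitMatrix s₁ i j := by
      rw [hi, zero_div, zero_add, mul_one]
      exact mul_nonneg (sub_nonneg.2 hs.le) (hitMatrix_nonneg _ _ _)
    linarith
  · exact hη1 i hi j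

lemma riccatiOp_ker_of_lt (hirr : M.Irreducible) (j₀ : M.Down) {s₁ s : ℝ} (hs : s₁ < s)
    (hfin : M.AllFinite s₁) {H : S → M.Down → ℝ} (hH : M.riccatiOp s (M.hitMatrix s) H = 0) :
    H = 0 := by
  obtain ⟨Δ, hΔ0, hΔ⟩ := exists_riccatiOp_neg hirr j₀ hs hfin
  exact injective_of_quasiPositive _ (riccatiOp_quasiPositive (hitMatrix_nonneg s)
    (hitMatrix_down s)) hΔ0 hΔ hH

/-- If the linearized Riccati operator at `s` is nonsingular, and the transform is finite at `s`,
then it is finite at some smaller discount rate: the solution `H` of `L H = -1` is nonnegative, as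
a limit from the right, and the transform plus a small multiple of `H` is a strict supersolution,
which persists for slightly smaller discount rates. -/
theorem exists_allFinite_lt (hirr : M.Irreducible) (j₀ : M.Down) {s : ℝ} (hfin : M.AllFinite s)
    (hinj : ∀ H, M.riccatiOp s (M.hitMatrix s) H = 0 → H = 0) : ∃ s' < s, M.AllFinite s' := by
  have hsurj : Function.Surjective (M.riccatiOp s (M.hitMatrix s)) := by
    rw [← LinearMap.injective_iff_surjective, ← LinearMap.ker_eq_bot, LinearMap.ker_eq_bot']
    exact hinj
  obtain ⟨H, hH⟩ := hsurj fun _ _ => -1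
  have hH' : ∀ i j, M.riccatiOp s (M.hitMatrix s) H i j = -1 := fun i j =>
    congrFun (congrFun hH i) j
  let σ : ℕ → ℝ := fun n => s + 1 / ((n : ℝ) + 1)
  have hσ : Antitone σ := fun m n hmn => by
    simp only [σ]
    gcongr
  have hlim : Tendsto σ atTop (𝓝 s) := by
    have := (tendsto_one_div_add_atTop_nhds_zero_nat (𝕜 := ℝ)).const_add s
    rwa [add_zero] at this
  have hσs : ∀ n, s < σ n := fun n => by
    have : (0 : ℝ) < 1 / ((n : ℝ) + 1) := by positivity
    simp only [σ]
    linarith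
  have hev : ∀ᶠ n in atTop, ∀ i j, M.riccatiOp (σ n) (M.hitMatrix (σ n)) H i j ≤ 0 := by
    refine eventually_all.2 fun i => eventually_all.2 fun j => ?_
    rcases lt_or_ge (M.c i) 0 with hi | hi
    · refine Eventually.of_forall fun n => ?_
      have := hH' i j
      rw [riccatiOp_of_neg _ _ _ hi] at this ⊢
      linarith
    · have h1 := ((continuous_riccatiLin (M := M) (M.cutDown H) i j).tendsto
        (s, M.hitMatrix s)).comp (hlim.prodMk_nhds (tendsto_hitMatrix hσ hlim hfin))
      have h2 := hH' i j
      rw [riccatiOp_of_nonneg _ _ _ hi] at h2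
      rw [h2] at h1
      filter_upwards [h1.eventually_lt_const (by norm_num : (-1 : ℝ) < 0)] with n hn
      rw [riccatiOp_of_nonneg _ _ _ hi]
      exact le_of_lt hn
  -- at a rate `σ n` above `s` the operator is known to have a nonpositive inverse
  obtain ⟨n, hn⟩ := hev.exists
  obtain ⟨Δ, hΔ0, hΔ⟩ := exists_riccatiOp_neg hirr j₀ (hσs n) hfin
  have hH0 := nonneg_of_quasiPositive _ (riccatiOp_quasiPositive (hitMatrix_nonneg (σ n))
    (hitMatrix_down (σ n))) hΔ0 hΔ hn
  set G := M.cutDown H with hG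
  have hG0 : ∀ i j, 0 ≤ G i j := by
    intro i j
    rcases lt_or_ge (M.c i) 0 with h | h
    · rw [hG, cutDown_of_neg H h]
    · rw [hG, cutDown_of_nonneg H h]; exact hH0 i j
  have hGdown : ∀ b j : M.Down, G b j = 0 := fun b j => cutDown_of_neg H b.2 j
  obtain ⟨ε, hε, hε1⟩ : ∃ ε : ℝ, 0 < ε ∧ ∀ i, 0 ≤ M.c i → ∀ j,
      M.riccati s (M.hitMatrix s + ε • G) i j < 0 := by
    have h1 : ∀ᶠ ε : ℝ in 𝓝[>] 0, ∀ i j,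
        -1 + ε * (M.c i * ∑ b, G i b * M.downGenLin G b j) < 0 := by
      refine eventually_all.2 fun i => eventually_all.2 fun j => ?_
      have h2 : Tendsto (fun ε : ℝ => -1 + ε * (M.c i * ∑ b, G i b * M.downGenLin G b j)) (𝓝[>] 0)
          (𝓝 (-1 + 0 * (M.c i * ∑ b, G i b * M.downGenLin G b j))) :=
        (Continuous.tendsto (by fun_prop) 0).mono_left nhdsWithin_le_nhds
      exact h2.eventually_lt_const (by simp)
    obtain ⟨ε, hε, h⟩ := (eventually_mem_nhdsWithin.and h1).exists
    have hε' : (0 : ℝ) < ε := hε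
    refine ⟨ε, hε', fun i hi j => ?_⟩
    have hεG : ∀ b j : M.Down, (ε • G) b j = 0 := fun b j => by simp [hGdown]
    have h3 := hH' i j
    rw [riccatiOp_of_nonneg _ _ _ hi, ← hG] at h3
    have h4 : M.riccatiOp s (M.hitMatrix s) (ε • G) i j = ε * -1 := by
      rw [map_smul]
      simp only [Pi.smul_apply, smul_eq_mul]
      rw [riccatiOp_of_nonneg _ _ _ hi, cutDown_eq_self hGdown, h3]
    rw [riccatiOp_of_nonneg _ _ _ hi, cutDown_eq_self hεG] at h4
    have h5 : ∀ b, M.downGenLin (ε • G) b j = ε * M.downGenLin G b j := by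
      intro b
      simp only [downGenLin, Pi.smul_apply, smul_eq_mul]
      rw [← mul_div_assoc, Finset.mul_sum]
      congr 1
      exact Finset.sum_congr rfl fun k _ => by ring
    have h6 : ∑ b, (ε • G) i b * M.downGenLin (ε • G) b j
        = ε * (ε * ∑ b, G i b * M.downGenLin G b j) := by
      rw [Finset.mul_sum, Finset.mul_sum]
      refine Finset.sum_congr rfl fun b _ => ?_
      rw [h5 b]
      simp only [Pi.smul_apply, smul_eq_mul]
      ring
    rw [riccati_add s _ hεG, riccati_hitMatrix hfin, h4, h6]
    have h7 := mul_neg_of_pos_of_neg hε' (h i j)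
    linarith
  have hX : ∀ b j : M.Down, (M.hitMatrix s + ε • G) b j = if b = j then 1 else 0 := fun b j => by
    simp [hGdown, hitMatrix_down]
  obtain ⟨s', hs', hle⟩ : ∃ s' < s, ∀ i j, 0 ≤ M.c i →
      M.riccati s' (M.hitMatrix s + ε • G) i j < 0 := by
    have h1 : ∀ᶠ s' : ℝ in 𝓝[<] s, ∀ i j, 0 ≤ M.c i →
        M.riccati s' (M.hitMatrix s + ε • G) i j < 0 := by
      refine eventually_all.2 fun i => eventually_all.2 fun j => ?_
      by_cases hi : 0 ≤ M.c i
      · have h2 := ((continuous_riccati (M := M) (M.hitMatrix s + ε • G) i j).tendsto s).mono_left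
          (nhdsWithin_le_nhds (s := Iio s))
        filter_upwards [h2.eventually_lt_const (hε1 i hi j)] with s' h _ using h
      · exact Eventually.of_forall fun _ h => absurd h hi
    obtain ⟨s', h⟩ := (eventually_mem_nhdsWithin.and h1).exists
    exact ⟨s', h.1, h.2⟩
  refine ⟨s', hs', allFinite_of_riccati_nonpos (X := M.hitMatrix s + ε • G) (fun i j => ?_) hX
    fun i j => ?_⟩
  · exact add_nonneg (hitMatrix_nonneg s i j) (mul_nonneg hε.le (hG0 i j))
  · rcases lt_or_ge (M.c i) 0 with hi | hi
    · exact (riccati_of_neg hX hi j).le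
    · exact (hle i j hi).le

end Abscissa
end FluidModel

end

theorem mainTheorem4 {S : Type*} [Fintype S] [DecidableEq S] [MeasurableSpace S]
    [MeasurableSingletonClass S] (M : FluidModel S) (hirr : M.Irreducible)
    (hup : ∃ i, 0 < M.c i)
    (ξ : S → ℝ) (hξ : M.IsStationary ξ) (hstable : ∑ i, M.c i * ξ i < 0) :
    ∃ sStar : ℝ,
      IsGreatest M.abscissaSet sStar ∧
      (∀ s, sStar ≤ s → M.PsiFinite s ∧ M.QExists s) ∧
      IsGreatest (M.coincidenceSet sStar) sStar := by
  have hdown : ∃ j, M.c j < 0 := by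
    by_contra! h
    exact absurd hstable (not_lt.2 (Finset.sum_nonneg fun i _ => mul_nonneg (h i) (hξ.1 i)))
  -- there are at least two phases, so none is absorbing
  have hT := FluidModel.T_diag_neg hirr hup hdown
  obtain ⟨l₀, hl₀⟩ := hup
  obtain ⟨k₀, hk₀⟩ := hdown
  let l : M.Up := ⟨l₀, hl₀⟩
  let k : M.Down := ⟨k₀, hk₀⟩
  have hPsi : ∀ s, M.PsiFinite s ↔ M.AllFinite s := by
    intro s
    refine ⟨fun h j i y hy => ?_, fun h i j => ?_⟩
    · refine FluidModel.passage_ne_top_of_up hirr (k := k) hl₀ ?_ j i hy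
      have := (h l k).ne
      rwa [FluidModel.Psi_eq_passage hT] at this
    · rw [FluidModel.Psi_eq_passage hT]
      exact (h j i 0 le_rfl).lt_top
  have hPsiM : ∀ s (i : M.Up) (j : M.Down), M.PsiMatrix s i j = M.hitMatrix s i j := by
    intro s i j
    rw [FluidModel.PsiMatrix, Matrix.of_apply, FluidModel.Psi_eq_passage hT]
    rfl
  obtain ⟨s₀, hs₀, hfin₀⟩ := FluidModel.exists_allFinite_neg hirr hξ hstable
  have hbdd := FluidModel.bddBelow_allFinite hirr l k
  set sStar := sInf {s | M.AllFinite s} with hsStar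
  have habove : ∀ s, sStar < s → M.AllFinite s := by
    intro s hs
    obtain ⟨s', hs', hlt⟩ := exists_lt_of_csInf_lt ⟨s₀, hfin₀⟩ hs
    exact FluidModel.allFinite_mono hs' hlt.le
  have hbelow : ∀ s, s < sStar → ¬ M.AllFinite s := fun s hs h =>
    absurd (csInf_le hbdd h) (not_le.2 hs)
  have hfin : M.AllFinite sStar := by
    refine FluidModel.allFinite_of_tendsto hirr l k (σ := fun n : ℕ => sStar + 1 / ((n : ℝ) + 1))
      (fun m n hmn => by dsimp only; gcongr) ?_ fun n => habove _ ?_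
    · have := (tendsto_one_div_add_atTop_nhds_zero_nat (𝕜 := ℝ)).const_add sStar
      rwa [add_zero] at this
    · have : (0 : ℝ) < 1 / ((n : ℝ) + 1) := by positivity
      linarith
  have hge : ∀ s, sStar ≤ s → M.AllFinite s := fun s hs => FluidModel.allFinite_mono hfin hs
  have hneg : sStar < 0 := (csInf_le hbdd hfin₀).trans_lt hs₀
  have hcommon : ∀ s, sStar ≤ s → (M.CommonEigenvalue s ↔
      ∃ H, H ≠ 0 ∧ M.riccatiOp s (M.hitMatrix s) H = 0) := by
    intro s hs
    obtain ⟨z, hz, hlt⟩ := FluidModel.exists_flat_pos hirr k (hge s hs)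
    exact FluidModel.commonEigenvalue_iff (hge s hs) (FluidModel.isUnit_det_T00_sub hz hlt)
      (hPsiM s)
  refine ⟨sStar, ⟨⟨hneg.le, (hPsi _).2 hfin, fun z hz h => hbelow z hz ((hPsi z).1 h)⟩, ?_⟩,
    fun s hs => ⟨(hPsi s).2 (hge s hs), ?_⟩, ⟨⟨le_rfl, hneg⟩, ?_⟩, ?_⟩
  · rintro s ⟨-, -, hs⟩
    by_contra! h
    exact hs sStar h ((hPsi _).2 hfin)
  · obtain ⟨z, hz, hlt⟩ := FluidModel.exists_flat_pos hirr k (hge s hs)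
    exact FluidModel.QExists_of_flat_pos hz hlt
  · -- at `sStar` the linearized Riccati operator is singular, since finiteness ends there
    rw [hcommon sStar le_rfl]
    by_contra! h
    obtain ⟨s', hs', hfin'⟩ := FluidModel.exists_allFinite_lt hirr k hfin fun H hH => by
      by_contra hne
      exact h H hne hH
    exact hbelow s' hs' hfin'
  · -- above `sStar` it is not
    rintro s ⟨⟨hs, -⟩, hs1⟩
    by_contra! hlt
    obtain ⟨H, hne, hH⟩ := (hcommon s hs).1 hs1
    exact hne (FluidModel.riccatiOp_ker_of_lt hirr k hlt hfin hH)
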